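/- Let $k$ be an ordered field. (Ordered fields and ordered abelian groups are totally ordered; an ordered vector space $\Gamma$ over $k$ is an ordered abelian group with a $k$-vector space structure such that $c\gamma>0$ for all $c>0$ in $k$ and $\gamma>0$ in $\Gamma$.) An $H$-couple is an ordered abelian group $\Gamma$ with a map $\psi:\Gamma^{\neq}\to\Gamma$, where $\Gamma^{\ne}=\Gamma\setminus\{0\}$, such that for all $\alpha,\beta\in\Gamma^{\neq}$: $\psi(\alpha+\beta)\ge\min(\psi(\alpha),\psi(\beta))$ if $\alpha+\beta\neq 0$; $\psi(n\alpha)=\psi(\alpha)$ for all nonzero integers $n$; $\alpha+\psi(\alpha)>\psi(\beta)$ if $\alpha>0$; and $\psi(\alpha)\ge\psi(\beta)$ if $0<\alpha\le\beta$. Put $\Psi=\psi(\Gamma^{\neq})$. An $H$-triple over $k$ is a triple $(\Gamma,\psi,P)$ such that $(\Gamma,\psi)$ is an $H$-couple, $\Gamma$ is an ordered vector space over $k$, $\psi(c\gamma)=\psi(\gamma)$ for all $c\in k\setminus\{0\}$ and $\gamma\in\Gamma^{\neq}$, and $P\subseteq\Gamma$ is a downward closed set with $\Psi\subseteq P$ and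 $p<\alpha+\psi(\alpha)$ for all $p\in P$ and $\alpha\in\Gamma$ with $\alpha>0$. It is closed if $\Gamma$ is divisible, $\Psi$ is downward closed in $\Gamma$, and $\Gamma=\{\alpha+\psi(\alpha):\alpha\in\Gamma^{\neq}\}$. Let $\mathcal L_k$ be the one-sorted first-order language with constant symbols $0,\infty$, unary function symbols $-$, $\psi$ and one for multiplication by each $c\in k$, a binary function symbol $+$, a binary relation symbol $<$ and a unary relation symbol $P$. An $H$-triple $(\Gamma,\psi,P)$ over $k$ is viewed as an $\mathcal L_k$-structure with underlying set $\Gamma\cup\{\infty\}$, where $\gamma<\infty$ for all $\gamma\in\Gamma$, $\infty\notin P$, $\psi(0)=\infty$, and the operations $-$, $+$, $\psi$ and multiplication by $c$, for every $c\in k$ (including $c=0$), take the value $\infty$ as soon as an argument is $\infty$. Let $T_k$ be the $\mathcal L_k$-theory of closed $H$-triples over $k$, that is, the set of $\mathcal L_k$-sentences true in all of them, and let $T_k^{>}$ and $T_k^{<}$ be the $\mathcal L_k$-theories of the closed $H$-triples $(\Gamma,\psi,P)$ over $k$ with $0\in P$ and with $0\notin P$, respectively. A completion of $T_k$ is a complete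 (in particular consistent), deductively closed set of $\mathcal L_k$-sentences that contains $T_k$. Then $T_k$ has exactly two completions: $T_k^{>}$ and $T_k^{<}$, which are distinct. Up to isomorphism of $\mathcal L_k$-structures, the models of $T_k$, $T_k^{>}$ and $T_k^{<}$ are, respectively, the closed $H$-triples over $k$, those with $0\in P$, and those with $0\notin P$. Moreover, for every closed $H$-triple $(\Gamma,\psi,P)$ over $k$, $$0\in P\iff\Psi\cap\Gamma^{>}\neq\emptyset,\qquad\text{and}\qquad 0\notin P\iff\Psi\subseteq\Gamma^{<},$$ where $\Gamma^{>}$ and $\Gamma^{<}$ are the sets of positive and of negative elements of $\Gamma$. -/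

import Mathlib

open scoped FirstOrder

universe u w

/-- An asymptotic couple of `H`-type: an ordered abelian group `Γ` with a map `psi` from the
nonzero elements of `Γ` to `Γ`. -/
structure HCouple (Γ : Type w) [AddCommGroup Γ] [LinearOrder Γ] [IsOrderedAddMonoid Γ] where
  psi : {γ : Γ // γ ≠ 0} → Γ
  ac1 : ∀ (α β : {γ : Γ // γ ≠ 0}) (h : α.1 + β.1 ≠ 0),
    min (psi α) (psi β) ≤ psi ⟨α.1 + β.1, h⟩
  ac2 : ∀ (n : ℤ), n ≠ 0 → ∀ (α : {γ : Γ // γ ≠ 0}) (h : n • α.1 ≠ 0), psi ⟨n • α.1, h⟩ = psi α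
  ac3 : ∀ α β : {γ : Γ // γ ≠ 0}, 0 < α.1 → psi β < α.1 + psi α
  hc : ∀ α β : {γ : Γ // γ ≠ 0}, 0 < α.1 → α.1 ≤ β.1 → psi β ≤ psi α

namespace HCouple

variable {Γ : Type w} [AddCommGroup Γ] [LinearOrder Γ] [IsOrderedAddMonoid Γ]

/-- The set `Ψ` of values of `psi`. -/
def Psi (H : HCouple Γ) : Set Γ := Set.range H.psi

/-- The map `α ↦ α' = α + psi α` on the nonzero elements. -/
def deriv (H : HCouple Γ) (α : {γ : Γ // γ ≠ 0}) : Γ := α.1 + H.psi α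

/-- Every element of `Γ` is of the form `α'` with `α ≠ 0`. -/
def HasAsymptoticIntegration (H : HCouple Γ) : Prop :=
  ∀ γ : Γ, ∃ α : {γ : Γ // γ ≠ 0}, H.deriv α = γ

/-- `Γ` is divisible, `Ψ` is downward closed, and there is asymptotic integration. -/
structure IsClosed (H : HCouple Γ) : Prop where
  divisible : ∀ n : ℕ, n ≠ 0 → ∀ γ : Γ, ∃ δ : Γ, n • δ = γ
  psi_lower : IsLowerSet H.Psi
  integration : H.HasAsymptoticIntegration

/-- `H`-cuts: downward closed sets `P` with `Ψ ⊆ P < (Γ^>)'`. -/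
structure IsHCut (H : HCouple Γ) (P : Set Γ) : Prop where
  lower : IsLowerSet P
  psi_subset : H.Psi ⊆ P
  lt_deriv : ∀ p ∈ P, ∀ α : {γ : Γ // γ ≠ 0}, 0 < α.1 → p < H.deriv α

/-- The extension of `psi` to a map `Γ → Γ ∪ {∞}` with `psi 0 = ∞`. -/
def psiExt (H : HCouple Γ) (γ : Γ) : WithTop Γ :=
  if h : γ = 0 then ⊤ else ((H.psi ⟨γ, h⟩ : Γ) : WithTop Γ)

end HCouple

/-- An `H`-triple `(Γ, psi, P)` over the ordered field `k`, on an ordered vector space `Γ`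
over `k`. -/
structure HTriple (k : Type u) [Field k] [LinearOrder k] [IsStrictOrderedRing k]
    (Γ : Type w) [AddCommGroup Γ] [LinearOrder Γ] [IsOrderedAddMonoid Γ]
    [Module k Γ] [PosSMulStrictMono k Γ] extends HCouple Γ where
  psi_smul : ∀ (c : k), c ≠ 0 → ∀ (α : {γ : Γ // γ ≠ 0}) (h : c • α.1 ≠ 0),
    psi ⟨c • α.1, h⟩ = psi α
  P : Set Γ
  isHCut : toHCouple.IsHCut P

/-- A closed `H`-triple over `k`, together with its underlying ordered vector space. -/
structure ClosedHTriple (k : Type u) [Field k] [LinearOrder k] [IsStrictOrderedRing k] where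
  Γ : Type w
  [addCommGroup : AddCommGroup Γ]
  [linearOrder : LinearOrder Γ]
  [isOrderedAddMonoid : IsOrderedAddMonoid Γ]
  [module : Module k Γ]
  [posSMulStrictMono : PosSMulStrictMono k Γ]
  triple : HTriple k Γ
  closed : triple.toHCouple.IsClosed

attribute [instance] ClosedHTriple.addCommGroup ClosedHTriple.linearOrder
  ClosedHTriple.isOrderedAddMonoid ClosedHTriple.module ClosedHTriple.posSMulStrictMono

/-- Function symbols: those of vector spaces over `k`, and `∞` and `psi`. -/
inductive HTripleFunctions (k : Type u) : ℕ → Type u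
  | zero : HTripleFunctions k 0
  | infty : HTripleFunctions k 0
  | neg : HTripleFunctions k 1
  | smul (c : k) : HTripleFunctions k 1
  | psi : HTripleFunctions k 1
  | add : HTripleFunctions k 2

/-- Relation symbols: the strict order and the unary predicate `P`. -/
inductive HTripleRelations : ℕ → Type
  | P : HTripleRelations 1
  | lt : HTripleRelations 2

/-- The language of `H`-triples over `k`. -/
def HTripleLanguage (k : Type u) : FirstOrder.Language.{u, 0} :=
  ⟨HTripleFunctions k, HTripleRelations⟩

namespace HTriple

variable {k : Type u} [Field k] [LinearOrder k] [IsStrictOrderedRing k]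
  {Γ : Type w} [AddCommGroup Γ] [LinearOrder Γ] [IsOrderedAddMonoid Γ]
  [Module k Γ] [PosSMulStrictMono k Γ]

/-- The underlying set `Γ ∪ {∞}` of an `H`-triple viewed as a first-order structure. -/
def Carrier (_H : HTriple k Γ) : Type w := WithTop Γ

/-- Here `∞` is the largest element, it is the default value of all operations (also
`0 • ∞ = ∞`), and it is not in `P`. -/
instance instStructure (H : HTriple k Γ) : (HTripleLanguage k).Structure H.Carrier where
  funMap {_} f := match f with
    | .zero => fun _ => ((0 : Γ) : WithTop Γ)
    | .infty => fun _ => (⊤ : WithTop Γ)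
    | .neg => fun x => WithTop.map (fun γ : Γ => -γ) (x 0)
    | .smul c => fun x => WithTop.map (fun γ : Γ => c • γ) (x 0)
    | .psi => fun x => WithTop.recTopCoe (C := fun _ => WithTop Γ) ⊤ H.psiExt (x 0)
    | .add => fun x => (fun a b : WithTop Γ => a + b) (x 0) (x 1)
  RelMap {_} r := match r with
    | .P => fun x => ∃ γ ∈ H.P, x 0 = (γ : WithTop Γ)
    | .lt => fun x => (fun a b : WithTop Γ => a < b) (x 0) (x 1)

end HTriple

section Theories

variable (k : Type u) [Field k] [LinearOrder k] [IsStrictOrderedRing k]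

/-- The theory of closed `H`-triples over `k`. -/
def closedHTripleTheory : (HTripleLanguage k).Theory :=
  {φ | ∀ H : ClosedHTriple.{u, u} k, H.triple.Carrier ⊨ φ}

/-- The theory of closed `H`-triples over `k` with `0 ∈ P`. -/
def closedHTripleTheoryGT : (HTripleLanguage k).Theory :=
  {φ | ∀ H : ClosedHTriple.{u, u} k, (0 : H.Γ) ∈ H.triple.P → H.triple.Carrier ⊨ φ}

/-- The theory of closed `H`-triples over `k` with `0 ∉ P`. -/
def closedHTripleTheoryLT : (HTripleLanguage k).Theory :=
  {φ | ∀ H : ClosedHTriple.{u, u} k, (0 : H.Γ) ∉ H.triple.P → H.triple.Carrier ⊨ φ}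

end Theories

/-- `T'` is a completion of `T`: a complete (in particular satisfiable), deductively closed
set of sentences that contains `T`. -/
def IsCompletionOf {L : FirstOrder.Language.{u, w}} (T' T : L.Theory) : Prop :=
  T ⊆ T' ∧ T'.IsComplete ∧ ∀ φ : L.Sentence, T' ⊨ᵇ φ → φ ∈ T'

/-! The core is a back-and-forth argument: a partial isomorphism between closed `H`-triples (a
`k`-subspace of the product, closed under pairs of `ps`-values, respecting order and `P`) preserves
all formulas (`ClosedHTriple.realize_iff`). The induction on formulas needs only that a partial
isomorphism extends to the whole first structure once the second is replaced by an elementary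
extension (`extendsTo_top`). The zero subspace is a partial isomorphism exactly when the two triples
agree about `0 ∈ P`, so this single bit determines the complete theory.

By Zorn's lemma, with ultraproducts bounding chains, it suffices to enlarge a proper domain `A`
(`stepExtends`). If some `z + ps z = β` has no solution in `A`, its solution is infinitesimal over
`A`, and `P` fixes its sign. If some element of `A` in `P` is not a `ps`-value over `A`, a preimage
is adjoined. If there is a gap over `A`, then there is one in `P`, and its counterpart is found in
an elementary extension. Otherwise either some `b` outside `A` has all `ps (b - a)` in `A`, and its
type is approximated by elements of `A`; or iterating `ps` and subtracting elements of `A` produces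
a sequence with new, strictly increasing `ps`-values, so the cut of `b` determines the structure
generated.

Closed `H`-triples are axiomatized by sentences (`Ax`), so models of the theories are again closed
triples (`exists_closedHTriple`). Over a countable ordered field a closed triple is built on a
lexicographic space (`LexSpace.exists_triple`); compactness gives one over every `k`, and shifting
`psi` by a constant gives both `0 ∈ P` and `0 ∉ P`. -/

set_option linter.unusedSectionVars false

/-! ### Valuation-like behaviour of `ps` in a single triple -/

namespace HTriple

section Basic

variable {k : Type u} [Field k] [LinearOrder k] [IsStrictOrderedRing k]
  {Γ : Type w} [AddCommGroup Γ] [LinearOrder Γ] [IsOrderedAddMonoid Γ]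
  [Module k Γ] [PosSMulStrictMono k Γ]

open Classical in
/-- The map `psi` extended to all of `Γ` by `ps 0 = 0`. -/
noncomputable def ps (H : HTriple k Γ) (x : Γ) : Γ := if h : x = 0 then 0 else H.psi ⟨x, h⟩

variable (H : HTriple k Γ) {x y z : Γ}

-- The default `0`, in place of `∞`, lets closure of a subspace under `ps` be stated without
-- excluding `0`; inequalities between values need nonzero arguments instead.
@[simp] theorem ps_zero : H.ps 0 = 0 := by simp [ps]

theorem ps_of_ne (h : x ≠ 0) : H.ps x = H.psi ⟨x, h⟩ := by simp [ps, h]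

theorem ps_smul {c : k} (hc : c ≠ 0) (x : Γ) : H.ps (c • x) = H.ps x := by
  by_cases h : x = 0
  · simp [h]
  · have h' : c • x ≠ 0 := smul_ne_zero hc h
    rw [ps_of_ne H h, ps_of_ne H h', H.psi_smul c hc ⟨x, h⟩ h']

theorem ps_neg (x : Γ) : H.ps (-x) = H.ps x := by
  simpa using H.ps_smul (c := (-1 : k)) (by simp) x

theorem ps_sub_comm (x y : Γ) : H.ps (x - y) = H.ps (y - x) := by
  rw [← ps_neg, neg_sub]

theorem ps_abs (x : Γ) : H.ps |x| = H.ps x := by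
  rcases abs_choice x with h | h <;> rw [h]
  exact H.ps_neg x

theorem ps_lt_add (hx : 0 < x) (hy : y ≠ 0) : H.ps y < x + H.ps x := by
  rw [ps_of_ne H hy, ps_of_ne H hx.ne']
  exact H.ac3 ⟨x, hx.ne'⟩ ⟨y, hy⟩ hx

theorem ps_anti (hx : x ≠ 0) (h : |x| ≤ |y|) : H.ps y ≤ H.ps x := by
  have hx' : 0 < |x| := abs_pos.2 hx
  have hy' : 0 < |y| := hx'.trans_le h
  rw [← H.ps_abs x, ← H.ps_abs y, ps_of_ne H hx'.ne', ps_of_ne H hy'.ne']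
  exact H.hc ⟨_, hx'.ne'⟩ ⟨_, hy'.ne'⟩ hx' h

theorem ps_anti_of_pos (hx : 0 < x) (h : x ≤ y) : H.ps y ≤ H.ps x :=
  H.ps_anti hx.ne' (by rwa [abs_of_pos hx, abs_of_pos (hx.trans_le h)])

theorem abs_lt_of_ps_lt (hx : x ≠ 0) (h : H.ps x < H.ps y) : |y| < |x| := by
  by_contra! h'
  exact absurd (H.ps_anti hx h') h.not_ge

theorem min_ps_le (hx : x ≠ 0) (hy : y ≠ 0) (hxy : x + y ≠ 0) :
    min (H.ps x) (H.ps y) ≤ H.ps (x + y) := by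
  rw [ps_of_ne H hx, ps_of_ne H hy, ps_of_ne H hxy]
  exact H.ac1 ⟨x, hx⟩ ⟨y, hy⟩ hxy

theorem add_ne_zero_of_ps_lt (h : H.ps x < H.ps y) : x + y ≠ 0 := by
  intro h0
  rw [eq_neg_of_add_eq_zero_left h0, ps_neg] at h
  exact h.false

theorem ps_add_of_lt (hx : x ≠ 0) (hy : y ≠ 0) (h : H.ps x < H.ps y) : H.ps (x + y) = H.ps x := by
  have h0 := H.add_ne_zero_of_ps_lt h
  apply le_antisymm
  · by_contra! h1
    have h2 := H.min_ps_le h0 (neg_ne_zero.2 hy) (by simpa using hx)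
    rw [ps_neg, add_neg_cancel_right] at h2
    exact absurd h2 (lt_min h1 h).not_ge
  · simpa [h.le] using H.min_ps_le hx hy h0

theorem ps_add_of_gt (hx : x ≠ 0) (hy : y ≠ 0) (h : H.ps y < H.ps x) : H.ps (x + y) = H.ps y := by
  rw [add_comm, H.ps_add_of_lt hy hx h]

theorem ps_sub_of_lt (hx : x ≠ 0) (hy : y ≠ 0) (h : H.ps x < H.ps y) : H.ps (x - y) = H.ps x := by
  rw [sub_eq_add_neg, H.ps_add_of_lt hx (neg_ne_zero.2 hy) (by rwa [ps_neg])]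

theorem ps_sub_of_gt (hx : x ≠ 0) (hy : y ≠ 0) (h : H.ps y < H.ps x) : H.ps (x - y) = H.ps y := by
  rw [ps_sub_comm, H.ps_sub_of_lt hy hx h]

theorem ps_add_pos (hx : 0 < x) (hy : 0 < y) : H.ps (x + y) = min (H.ps x) (H.ps y) := by
  apply le_antisymm
  · exact le_min (H.ps_anti_of_pos hx (by simpa using hy.le))
      (H.ps_anti_of_pos hy (by simpa using hx.le))
  · exact H.min_ps_le hx.ne' hy.ne' (add_pos hx hy).ne'

theorem pos_add_iff_of_ps_lt (hx : x ≠ 0) (h : H.ps x < H.ps y) : 0 < x + y ↔ 0 < x := by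
  have h1 := H.abs_lt_of_ps_lt hx h
  grind

/-- Doubling does not change `ps`, so by monotonicity a factor of two is invisible to it. -/
theorem ps_eq_of_abs_le (hx : x ≠ 0) (hy : y ≠ 0) (h1 : |x| ≤ |y| + |y|) (h2 : |y| ≤ |x| + |x|) :
    H.ps x = H.ps y := by
  have key (z : Γ) : H.ps (z + z) = H.ps z := by
    rw [← two_smul k]; exact H.ps_smul two_ne_zero z
  apply le_antisymm
  · rw [← key x]
    exact H.ps_anti hy (by grind)
  · rw [← key y]
    exact H.ps_anti hx (by grind)

/-- A small perturbation does not change the value of `ps`. -/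
theorem ps_add_of_abs_le (hx : x ≠ 0) (h : |y| + |y| ≤ |x|) : H.ps (x + y) = H.ps x := by
  apply H.ps_eq_of_abs_le _ hx <;> grind

/-- This is the axiom `ps y < δ + ps δ` for the positive element `δ = ps y - ps x`. It drives the
fixed-point arguments below. -/
theorem ps_lt_ps_sub (hy : y ≠ 0) (h : H.ps x < H.ps y) :
    H.ps x < H.ps (H.ps y - H.ps x) := by
  have := H.ps_lt_add (sub_pos.2 h) hy
  grind

/-- When `ps y < ps x`, the difference `y - x` has value `ps y`, and the axiom for `y - x > 0`
against `x` bounds the loss `ps x - ps y` by `y - x`. -/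
theorem add_ps_lt (hx : x ≠ 0) (hy : y ≠ 0) (h : x < y) : x + H.ps x < y + H.ps y := by
  rcases le_or_gt (H.ps x) (H.ps y) with h' | h'
  · exact add_lt_add_of_lt_of_le h h'
  · have h1 := H.ps_lt_add (sub_pos.2 h) hx
    rw [H.ps_sub_of_lt hy hx h'] at h1
    grind

theorem lt_of_add_ps_lt (hx : x ≠ 0) (hy : y ≠ 0) (h : x + H.ps x < y + H.ps y) : x < y := by
  by_contra! h'
  rcases h'.eq_or_lt with rfl | h'
  · exact h.false
  · exact absurd (H.add_ps_lt hy hx h') h.not_gt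

theorem ps_mem_P (hx : x ≠ 0) : H.ps x ∈ H.P := by
  rw [ps_of_ne H hx]
  exact H.isHCut.psi_subset ⟨_, rfl⟩

theorem add_ps_notMem_P (hx : 0 < x) : x + H.ps x ∉ H.P := fun h => by
  have := H.isHCut.lt_deriv _ h ⟨x, hx.ne'⟩ hx
  rw [ps_of_ne H hx.ne'] at this
  exact this.false

theorem mem_P_of_le (h : x ≤ y) (hy : y ∈ H.P) : x ∈ H.P := H.isHCut.lower h hy

theorem lt_add_ps_of_mem_P (hy : y ∈ H.P) (hx : 0 < x) : y < x + H.ps x := by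
  by_contra! h
  exact H.add_ps_notMem_P hx (H.mem_P_of_le h hy)

/-! ### Solving `z + ps z = β` inside a subspace, and gaps -/

/-- A fixed-point argument: solving `z + ps z = β` in a subspace. -/
theorem exists_add_ps_eq_of_ps_le {A : Submodule k Γ} (hA : ∀ x ∈ A, H.ps x ∈ A) {β γ : Γ}
    (hβ : β ∈ A) (hγ : γ ∈ A) (h0 : γ ≠ 0) (h1 : β - H.ps γ ≠ 0)
    (h : H.ps (β - H.ps γ) ≤ H.ps γ) : ∃ z ∈ A, z ≠ 0 ∧ z + H.ps z = β := by
  set α := β - H.ps γ with hα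
  have hαA : α ∈ A := A.sub_mem hβ (hA _ hγ)
  -- In case of equality `β - ps γ` is itself a solution. Otherwise the correction `ps γ - ps α` has
  -- larger value than `α`, so adding it yields `β - ps α` and leaves the value `ps α` unchanged.
  rcases h.eq_or_lt with h | h
  · exact ⟨α, hαA, h1, by rw [h, hα]; abel⟩
  · have h2 := H.ps_lt_ps_sub h0 h
    have h3 : H.ps γ - H.ps α ≠ 0 := (sub_pos.2 h).ne'
    refine ⟨α + (H.ps γ - H.ps α), A.add_mem hαA (A.sub_mem (hA _ hγ) (hA _ hαA)),
      H.add_ne_zero_of_ps_lt h2, ?_⟩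
    rw [H.ps_add_of_lt h1 h3 h2, hα]
    abel

theorem exists_add_ps_eq_of_lt_ps {A : Submodule k Γ} (hA : ∀ x ∈ A, H.ps x ∈ A) {β γ : Γ}
    (hβ : β ∈ A) (hγ : γ ∈ A) (h0 : γ ≠ 0) (h : β < H.ps γ) :
    ∃ z ∈ A, z ≠ 0 ∧ z + H.ps z = β := by
  rcases le_or_gt (H.ps (β - H.ps γ)) (H.ps γ) with h1 | h1
  · exact H.exists_add_ps_eq_of_ps_le hA hβ hγ h0 (sub_neg.2 h).ne h1
  -- Restart with `γ' = β - ps γ`: since `ps γ' > ps γ`, the element `β - ps γ'` is even more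
  -- negative than `γ'`, and monotonicity gives the required inequality.
  · have h2 : β - H.ps γ ≠ 0 := (sub_neg.2 h).ne
    refine H.exists_add_ps_eq_of_ps_le hA hβ (A.sub_mem hβ (hA _ hγ)) h2
      (sub_neg.2 (h.trans h1)).ne (H.ps_anti h2 ?_)
    grind

theorem exists_add_ps_eq_of_add_ps_le {A : Submodule k Γ} (hA : ∀ x ∈ A, H.ps x ∈ A) {β γ : Γ}
    (hβ : β ∈ A) (hγ : γ ∈ A) (h0 : 0 < γ) (h : γ + H.ps γ ≤ β) :
    ∃ z ∈ A, z ≠ 0 ∧ z + H.ps z = β := by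
  have h1 : γ ≤ β - H.ps γ := by grind
  exact H.exists_add_ps_eq_of_ps_le hA hβ hγ h0.ne' (h0.trans_le h1).ne' (H.ps_anti_of_pos h0 h1)

/-- `x` lies between the values of `ps` on the nonzero elements of `A` and the values of
`z + ps z` on its positive elements. -/
def IsGap (A : Submodule k Γ) (x : Γ) : Prop :=
  (∀ z ∈ A, z ≠ 0 → H.ps z < x) ∧ ∀ z ∈ A, 0 < z → x < z + H.ps z

variable {H}

/-- Both gaps lie in the interval from `ps z` to `z + ps z`, of length `z`. -/
theorem IsGap.abs_sub_lt {A : Submodule k Γ} (hx : H.IsGap A x) (hy : H.IsGap A y) (hz : z ∈ A)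
    (h : 0 < z) : |x - y| < z := by
  have h1 := hx.1 z hz h.ne'
  have h2 := hx.2 z hz h
  have h3 := hy.1 z hz h.ne'
  have h4 := hy.2 z hz h
  grind

theorem half_smul_add_half_smul (x : Γ) : (2⁻¹ : k) • x + (2⁻¹ : k) • x = x := by
  rw [← two_smul k, smul_inv_smul₀ two_ne_zero]

theorem half_smul_pos (h : 0 < x) : 0 < (2⁻¹ : k) • x := smul_pos (by positivity) h

/-- For negative `z` the difference lies between `|z|` and `2|z|`; for positive `z`, using `z / 2`,
it lies between `-z` and `-z / 2`. When every element of `A` has the form `z + ps z`, this computes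
`ps (x - a)` for all `a` in `A`. -/
theorem IsGap.sub_ne_zero_and_ps_sub_eq {A : Submodule k Γ} (hx : H.IsGap A x) (hz : z ∈ A)
    (h : z ≠ 0) : x - (z + H.ps z) ≠ 0 ∧ H.ps (x - (z + H.ps z)) = H.ps z := by
  rcases lt_or_gt_of_ne h with h | h
  · have h1 := hx.1 z hz h.ne
    have h2 := hx.2 (-z) (A.neg_mem hz) (neg_pos.2 h)
    rw [ps_neg] at h2
    have h3 : x - (z + H.ps z) ≠ 0 := by grind
    exact ⟨h3, H.ps_eq_of_abs_le h3 h.ne (by grind) (by grind)⟩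
  · have hw : (2⁻¹ : k) • z ∈ A := A.smul_mem _ hz
    have hww := half_smul_add_half_smul (k := k) z
    have hw0 := half_smul_pos (k := k) h
    have hps : H.ps ((2⁻¹ : k) • z) = H.ps z := H.ps_smul (by simp) z
    have h1 := hx.1 _ hw hw0.ne'
    have h2 := hx.2 _ hw hw0
    rw [hps] at h1 h2
    have h3 : x - (z + H.ps z) ≠ 0 := by grind
    exact ⟨h3, H.ps_eq_of_abs_le h3 h.ne' (by grind) (by grind)⟩

variable (H)

theorem exists_add_ps_eq (hH : H.toHCouple.IsClosed) (g : Γ) : ∃ z, z ≠ 0 ∧ z + H.ps z = g := by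
  obtain ⟨⟨z, hz⟩, h⟩ := hH.integration g
  exact ⟨z, hz, by rw [ps_of_ne H hz, ← h]; rfl⟩

/-- `P` records the sign of the solution of `z + ps z = β`; this is its role in making extensions
unique. -/
theorem add_ps_mem_P_iff (hx : x ≠ 0) : x + H.ps x ∈ H.P ↔ x < 0 := by
  constructor
  · intro h
    by_contra! h'
    exact H.add_ps_notMem_P (lt_of_le_of_ne h' hx.symm) h
  · intro h
    exact H.mem_P_of_le (by simpa using h.le) (H.ps_mem_P hx)

/-- An element of `P` is `z + ps z` with `z < 0`, hence lies below `ps z`, and `Ψ` is downward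
closed. So `P = Ψ` in a closed triple. -/
theorem exists_ps_eq_of_mem_P (hH : H.toHCouple.IsClosed) (hx : x ∈ H.P) : ∃ z, 0 < z ∧ H.ps z = x := by
  obtain ⟨z, hz, rfl⟩ := H.exists_add_ps_eq hH x
  rw [H.add_ps_mem_P_iff hz] at hx
  obtain ⟨⟨y, hy⟩, h⟩ := hH.psi_lower (show z + H.ps z ≤ H.psi ⟨z, hz⟩ by
    rw [ps_of_ne H hz]; simpa using hx.le) ⟨_, rfl⟩
  exact ⟨|y|, abs_pos.2 hy, by rw [ps_abs, ps_of_ne H hy, h]⟩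

theorem mem_P_iff (hH : H.toHCouple.IsClosed) : x ∈ H.P ↔ ∃ z, z ≠ 0 ∧ H.ps z = x := by
  constructor
  · intro h
    obtain ⟨z, hz, h⟩ := H.exists_ps_eq_of_mem_P hH h
    exact ⟨z, hz.ne', h⟩
  · rintro ⟨z, hz, rfl⟩
    exact H.ps_mem_P hz

end Basic
end HTriple

/-! ### Partial isomorphisms, cuts, and infinitesimal solutions of `z + ps z = β` -/

namespace HTriple

section PartialIso

variable {k : Type u} [Field k] [LinearOrder k] [IsStrictOrderedRing k]
  {Γ : Type*} [AddCommGroup Γ] [LinearOrder Γ] [IsOrderedAddMonoid Γ]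
  [Module k Γ] [PosSMulStrictMono k Γ]
  {Δ : Type*} [AddCommGroup Δ] [LinearOrder Δ] [IsOrderedAddMonoid Δ]
  [Module k Δ] [PosSMulStrictMono k Δ]

/-- An isomorphism between substructures of two `H`-triples, given by its graph. -/
structure IsPartialIso (H : HTriple k Γ) (K : HTriple k Δ) (R : Submodule k (Γ × Δ)) : Prop where
  pos_iff : ∀ p ∈ R, 0 < p.1 ↔ 0 < p.2
  mem_P_iff : ∀ p ∈ R, p.1 ∈ H.P ↔ p.2 ∈ K.P
  ps_mem : ∀ p ∈ R, (H.ps p.1, K.ps p.2) ∈ R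

/-- The domain of a relation. -/
abbrev dom (R : Submodule k (Γ × Δ)) : Submodule k Γ := R.map (LinearMap.fst k Γ Δ)

/-- The range of a relation. -/
abbrev rng (R : Submodule k (Γ × Δ)) : Submodule k Δ := R.map (LinearMap.snd k Γ Δ)

variable {H : HTriple k Γ} {K : HTriple k Δ} {R : Submodule k (Γ × Δ)} {b : Γ} {y : Δ}

theorem mem_dom {x : Γ} : x ∈ dom R ↔ ∃ x', (x, x') ∈ R := by simp

theorem mem_rng {x : Δ} : x ∈ rng R ↔ ∃ x', (x', x) ∈ R := by simp

theorem fst_mem_dom {p : Γ × Δ} (hp : p ∈ R) : p.1 ∈ dom R := mem_dom.2 ⟨_, hp⟩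

theorem snd_mem_rng {p : Γ × Δ} (hp : p ∈ R) : p.2 ∈ rng R := mem_rng.2 ⟨_, hp⟩

/-- `b` and `y` realize corresponding cuts. -/
def SameCut (R : Submodule k (Γ × Δ)) (b : Γ) (y : Δ) : Prop :=
  ∀ p ∈ R, (p.1 < b ↔ p.2 < y) ∧ (b < p.1 ↔ y < p.2)

/-- The relation generated by `R` and the pair `(b, y)`. -/
def adjoin (R : Submodule k (Γ × Δ)) (b : Γ) (y : Δ) : Submodule k (Γ × Δ) :=
  R ⊔ Submodule.span k {(b, y)}

theorem mem_adjoin {q : Γ × Δ} :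
    q ∈ adjoin R b y ↔ ∃ p ∈ R, ∃ c : k, q = p + c • (b, y) := by
  simp only [adjoin, Submodule.mem_sup, Submodule.mem_span_singleton, exists_exists_eq_and]
  simp only [eq_comm]

theorem le_adjoin : R ≤ adjoin R b y := le_sup_left

theorem mk_mem_adjoin : (b, y) ∈ adjoin R b y :=
  Submodule.mem_sup_right (Submodule.mem_span_singleton_self _)

theorem IsPartialIso.swap (hR : IsPartialIso H K R) :
    IsPartialIso K H (R.map (LinearEquiv.prodComm k Γ Δ).toLinearMap) where
  pos_iff := by
    rintro _ ⟨p, hp, rfl⟩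
    exact (hR.pos_iff p hp).symm
  mem_P_iff := by
    rintro _ ⟨p, hp, rfl⟩
    exact (hR.mem_P_iff p hp).symm
  ps_mem := by
    rintro _ ⟨p, hp, rfl⟩
    exact ⟨_, hR.ps_mem p hp, rfl⟩

theorem IsPartialIso.ps_mem_dom (hR : IsPartialIso H K R) : ∀ x ∈ dom R, H.ps x ∈ dom R := by
  intro x hx
  obtain ⟨x', hx⟩ := mem_dom.1 hx
  exact fst_mem_dom (hR.ps_mem _ hx)

theorem lt_iff_of_pos_iff (hR : ∀ p ∈ R, 0 < p.1 ↔ 0 < p.2) {p q : Γ × Δ} (hp : p ∈ R)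
    (hq : q ∈ R) : p.1 < q.1 ↔ p.2 < q.2 := by
  simpa using hR _ (R.sub_mem hq hp)

/-- Positivity for a pair and its negative makes `R` the graph of an injective map, so this need not
be required separately. -/
theorem eq_iff_of_pos_iff (hR : ∀ p ∈ R, 0 < p.1 ↔ 0 < p.2) {p q : Γ × Δ} (hp : p ∈ R)
    (hq : q ∈ R) : p.1 = q.1 ↔ p.2 = q.2 := by
  have h1 := lt_iff_of_pos_iff hR hp hq
  have h2 := lt_iff_of_pos_iff hR hq hp
  grind

namespace IsPartialIso

variable (hR : IsPartialIso H K R)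
include hR

theorem lt_iff {p q : Γ × Δ} (hp : p ∈ R) (hq : q ∈ R) : p.1 < q.1 ↔ p.2 < q.2 :=
  lt_iff_of_pos_iff hR.pos_iff hp hq

theorem le_iff {p q : Γ × Δ} (hp : p ∈ R) (hq : q ∈ R) : p.1 ≤ q.1 ↔ p.2 ≤ q.2 := by
  rw [← not_lt, ← not_lt, hR.lt_iff hq hp]

theorem eq_iff {p q : Γ × Δ} (hp : p ∈ R) (hq : q ∈ R) : p.1 = q.1 ↔ p.2 = q.2 :=
  eq_iff_of_pos_iff hR.pos_iff hp hq

theorem eq_zero_iff {p : Γ × Δ} (hp : p ∈ R) : p.1 = 0 ↔ p.2 = 0 :=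
  hR.eq_iff hp R.zero_mem

theorem neg_iff {p : Γ × Δ} (hp : p ∈ R) : p.1 < 0 ↔ p.2 < 0 :=
  hR.lt_iff hp R.zero_mem

theorem add_ps_mem {p : Γ × Δ} (hp : p ∈ R) : (p.1 + H.ps p.1, p.2 + K.ps p.2) ∈ R :=
  R.add_mem hp (hR.ps_mem p hp)

end IsPartialIso

theorem SameCut.neg (h : SameCut R b y) : SameCut R (-b) (-y) := fun p hp => by
  have := h (-p) (R.neg_mem hp)
  simp only [Prod.fst_neg, Prod.snd_neg] at this
  grind

theorem SameCut.sub (h : SameCut R b y) {p : Γ × Δ} (hp : p ∈ R) :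
    SameCut R (b - p.1) (y - p.2) := fun q hq => by
  have := h (q + p) (R.add_mem hq hp)
  simp only [Prod.fst_add, Prod.snd_add] at this
  grind

theorem SameCut.smul (h : SameCut R b y) {c : k} (hc : 0 < c) :
    SameCut R (c • b) (c • y) := fun p hp => by
  have := h (c⁻¹ • p) (R.smul_mem _ hp)
  simpa only [Prod.smul_fst, Prod.smul_snd, inv_smul_lt_iff_of_pos hc, lt_inv_smul_iff_of_pos hc]
    using this

theorem SameCut.pos_iff (h : SameCut R b y) : 0 < b ↔ 0 < y := (h 0 R.zero_mem).1

theorem SameCut.neg_iff (h : SameCut R b y) : b < 0 ↔ y < 0 := (h 0 R.zero_mem).2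

theorem SameCut.ne_zero_iff (h : SameCut R b y) : b ≠ 0 ↔ y ≠ 0 := by
  have h1 := h.pos_iff
  have h2 := h.neg_iff
  grind

theorem SameCut.pos_iff_adjoin (h : SameCut R b y) (hR : ∀ p ∈ R, 0 < p.1 ↔ 0 < p.2) :
    ∀ q ∈ adjoin R b y, 0 < q.1 ↔ 0 < q.2 := by
  intro q hq
  obtain ⟨p, hp, c, rfl⟩ := mem_adjoin.1 hq
  simp only [Prod.fst_add, Prod.snd_add, Prod.smul_fst, Prod.smul_snd]
  rcases lt_trichotomy c 0 with hc | rfl | hc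
  · have := (h.neg.smul (neg_pos.2 hc)) (-p) (R.neg_mem hp)
    simp only [smul_neg, neg_smul, neg_neg, Prod.fst_neg, Prod.snd_neg] at this
    grind
  · simpa using hR p hp
  · have := (h.smul hc) (-p) (R.neg_mem hp)
    simp only [Prod.fst_neg, Prod.snd_neg] at this
    grind

/-- Since `ps` ignores nonzero scalars, on `adjoin R b y` only its values at differences `b - a` are
new. -/
theorem ps_add_smul (H : HTriple k Γ) {c : k} (hc : c ≠ 0) (a b : Γ) :
    H.ps (a + c • b) = H.ps (b - -(c⁻¹ • a)) := by
  rw [← H.ps_smul hc (b - -(c⁻¹ • a)), sub_neg_eq_add, smul_add, smul_inv_smul₀ hc, add_comm]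

theorem IsPartialIso.adjoin (hR : IsPartialIso H K R) (h : SameCut R b y)
    (hP : ∀ p ∈ R, ∀ c : k, c ≠ 0 → (p.1 + c • b ∈ H.P ↔ p.2 + c • y ∈ K.P))
    (hps : ∀ p ∈ R, (H.ps (b - p.1), K.ps (y - p.2)) ∈ HTriple.adjoin R b y) :
    IsPartialIso H K (HTriple.adjoin R b y) where
  pos_iff := h.pos_iff_adjoin hR.pos_iff
  mem_P_iff := by
    intro q hq
    obtain ⟨p, hp, c, rfl⟩ := mem_adjoin.1 hq
    by_cases hc : c = 0
    · simpa [hc] using hR.mem_P_iff p hp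
    · exact hP p hp c hc
  ps_mem := by
    intro q hq
    obtain ⟨p, hp, c, rfl⟩ := mem_adjoin.1 hq
    by_cases hc : c = 0
    · simpa [hc] using le_adjoin (hR.ps_mem p hp)
    · have := hps (-(c⁻¹ • p)) (R.neg_mem (R.smul_mem _ hp))
      simpa [ps_add_smul _ hc] using this

/-- Some partial isomorphism extends `R` to a larger domain. -/
def Extends (H : HTriple k Γ) (K : HTriple k Δ) (R : Submodule k (Γ × Δ)) : Prop :=
  ∃ R', R ≤ R' ∧ IsPartialIso H K R' ∧ ∃ x ∈ dom R', x ∉ dom R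

theorem IsPartialIso.extends (h : IsPartialIso H K (HTriple.adjoin R b y)) (hb : b ∉ dom R) :
    Extends H K R :=
  ⟨_, le_adjoin, h, b, fst_mem_dom mk_mem_adjoin, hb⟩

/-- The map `z ↦ z + ps z` is strictly increasing; compare its values at `α`, `γ` and `-γ`. -/
theorem abs_lt_of_add_ps_eq {A : Submodule k Γ} {α β : Γ}
    (h1 : ∀ γ ∈ A, γ ≠ 0 → H.ps γ ≤ β) (h2 : ∀ γ ∈ A, 0 < γ → β < γ + H.ps γ)
    (h0 : α ≠ 0) (h : α + H.ps α = β) {γ : Γ} (hγ : γ ∈ A) (hpos : 0 < γ) : |α| < γ := by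
  have h3 := H.lt_of_add_ps_lt h0 hpos.ne' (by rw [h]; exact h2 γ hγ hpos)
  have h4 := H.lt_of_add_ps_lt (neg_ne_zero.2 hpos.ne') h0 (by
    rw [h, ps_neg]
    have := h1 γ hγ hpos.ne'
    grind)
  grind

/-- All of `P` lies below `ε|α| + ps α` for every positive scalar `ε`. An element exceeding `ps α`
does so by some `a + (c + 1)α` with `a` in `A`; as `α` is infinitesimal over `A`, this excess is at
least a positive multiple of `|α|`. -/
theorem mem_P_iff_le_ps {A : Submodule k Γ} {α x : Γ} {c : k}
    (hA : ∀ γ ∈ A, 0 < γ → |α| < γ) (h0 : α ≠ 0) (hβ : α + H.ps α ∈ A) (hx : x ∈ A) :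
    x + c • α ∈ H.P ↔ x + c • α ≤ H.ps α := by
  refine ⟨fun h => ?_, fun h => H.mem_P_of_le h (H.ps_mem_P h0)⟩
  by_contra! h'
  suffices ∃ ε : k, 0 < ε ∧ ε • |α| + H.ps α ≤ x + c • α by
    obtain ⟨ε, hε, h2⟩ := this
    have h3 := H.lt_add_ps_of_mem_P h (smul_pos hε (abs_pos.2 h0))
    rw [H.ps_smul hε.ne', H.ps_abs] at h3
    exact (h3.trans_le h2).false
  have h1 : x + c • α - H.ps α = (x - (α + H.ps α)) + (c + 1) • α := by
    rw [add_smul, one_smul]; abel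
  set a := x - (α + H.ps α) with ha
  have haA : a ∈ A := A.sub_mem hx hβ
  have h2 : 0 < a + (c + 1) • α := by rw [← h1]; exact sub_pos.2 h'
  have h3 : |(c + 1) • α| = |c + 1| • |α| := abs_smul _ _
  rcases lt_trichotomy a 0 with h4 | h4 | h4
  · have h5 : 0 < |c + 1| := by
      by_contra! h6
      rw [abs_nonpos_iff.1 h6, zero_smul] at h2
      grind
    have h6 := hA (|c + 1|⁻¹ • (-a)) (A.smul_mem _ (A.neg_mem haA))
      (smul_pos (inv_pos.2 h5) (neg_pos.2 h4))
    rw [lt_inv_smul_iff_of_pos h5, ← h3] at h6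
    grind
  · rw [h4, zero_add] at h2
    refine ⟨|c + 1|, abs_pos.2 ?_, ?_⟩
    · rintro h5
      simp [h5] at h2
    · rw [← h3, abs_of_pos h2]
      grind
  · refine ⟨1, one_pos, ?_⟩
    have h5 : 0 < |c + 1| + 1 := by positivity
    have h6 := hA ((|c + 1| + 1)⁻¹ • a) (A.smul_mem _ haA) (smul_pos (inv_pos.2 h5) h4)
    rw [lt_inv_smul_iff_of_pos h5, add_smul, ← h3] at h6
    grind

/-- Adjoining a solution of `z + ps z = β`. -/
theorem IsPartialIso.extends_of_add_ps_ne (hR : IsPartialIso H K R) (hH : H.toHCouple.IsClosed)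
    (hK : K.toHCouple.IsClosed) {p : Γ × Δ} (hp : p ∈ R)
    (hβ : ∀ z ∈ dom R, z ≠ 0 → z + H.ps z ≠ p.1) : Extends H K R := by
  obtain ⟨α, hα0, hα⟩ := H.exists_add_ps_eq hH p.1
  obtain ⟨y, hy0, hy⟩ := K.exists_add_ps_eq hK p.2
  -- Unsolvability over the domain squeezes `p.1`: it is at least every `ps`-value and below every
  -- `z + ps z` with `z > 0`. Hence `α` and `y` are infinitesimal over the domain and the range.
  have h1 : ∀ q ∈ R, q.1 ≠ 0 → H.ps q.1 ≤ p.1 := by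
    intro q hq h0
    by_contra! h
    obtain ⟨z, hz, hz0, h2⟩ := H.exists_add_ps_eq_of_lt_ps hR.ps_mem_dom (fst_mem_dom hp)
      (fst_mem_dom hq) h0 h
    exact hβ z hz hz0 h2
  have h2 : ∀ q ∈ R, 0 < q.1 → p.1 < q.1 + H.ps q.1 := by
    intro q hq h0
    by_contra! h
    obtain ⟨z, hz, hz0, h2⟩ := H.exists_add_ps_eq_of_add_ps_le hR.ps_mem_dom (fst_mem_dom hp)
      (fst_mem_dom hq) h0 h
    exact hβ z hz hz0 h2
  have hα' : ∀ γ ∈ dom R, 0 < γ → |α| < γ := by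
    intro γ hγ hpos
    refine abs_lt_of_add_ps_eq (A := dom R) ?_ ?_ hα0 hα hγ hpos <;> intro γ hγ <;>
      obtain ⟨γ', hγ⟩ := mem_dom.1 hγ
    · exact h1 _ hγ
    · exact h2 _ hγ
  have hy' : ∀ γ ∈ rng R, 0 < γ → |y| < γ := by
    intro γ hγ hpos
    refine abs_lt_of_add_ps_eq (A := rng R) ?_ ?_ hy0 hy hγ hpos <;> intro γ hγ <;>
      obtain ⟨γ', hγ⟩ := mem_rng.1 hγ
    · intro h0
      exact (hR.le_iff (hR.ps_mem _ hγ) hp).1 (h1 _ hγ ((hR.eq_zero_iff hγ).not.2 h0))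
    · intro h0
      exact (hR.lt_iff hp (hR.add_ps_mem hγ)).1 (h2 _ hγ ((hR.pos_iff _ hγ).2 h0))
  -- Infinitesimality fixes the cut up to sign, and the sign is read off from `P`.
  have hneg : α < 0 ↔ y < 0 := by
    rw [← H.add_ps_mem_P_iff hα0, ← K.add_ps_mem_P_iff hy0, hα, hy]
    exact hR.mem_P_iff p hp
  have hcut : SameCut R α y := by
    intro q hq
    have h3 := hα' _ (fst_mem_dom hq)
    have h4 := hy' _ (snd_mem_rng hq)
    have h5 := hα' _ (fst_mem_dom (R.neg_mem hq))
    have h6 := hy' _ (snd_mem_rng (R.neg_mem hq))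
    have h7 := hR.pos_iff q hq
    have h8 := hR.neg_iff hq
    simp only [Prod.fst_neg, Prod.snd_neg] at h5 h6
    grind
  have hps (q) (hq : q ∈ R) (h0 : q.1 ≠ 0) : H.ps (α - q.1) = H.ps q.1 := by
    rw [ps_sub_comm, sub_eq_add_neg]
    apply H.ps_add_of_abs_le h0
    have h3 := hα' ((2⁻¹ : k) • |q.1|) ((dom R).smul_mem _ ?_) (half_smul_pos (abs_pos.2 h0))
    · have := half_smul_add_half_smul (k := k) |q.1|
      grind
    · rcases abs_choice q.1 with h | h <;> rw [h]
      · exact fst_mem_dom hq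
      · exact (dom R).neg_mem (fst_mem_dom hq)
  have hps' (q) (hq : q ∈ R) (h0 : q.2 ≠ 0) : K.ps (y - q.2) = K.ps q.2 := by
    rw [ps_sub_comm, sub_eq_add_neg]
    apply K.ps_add_of_abs_le h0
    have h3 := hy' ((2⁻¹ : k) • |q.2|) ((rng R).smul_mem _ ?_) (half_smul_pos (abs_pos.2 h0))
    · have := half_smul_add_half_smul (k := k) |q.2|
      grind
    · rcases abs_choice q.2 with h | h <;> rw [h]
      · exact snd_mem_rng hq
      · exact (rng R).neg_mem (snd_mem_rng hq)
  -- The value `ps α = p.1 - α` already lies in the span, so no further element is needed.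
  have hpair : (H.ps α, K.ps y) ∈ HTriple.adjoin R α y := by
    have : (H.ps α, K.ps y) = p - (α, y) := by
      ext
      · simp [← hα]
      · simp [← hy]
    rw [this]
    exact Submodule.sub_mem _ (le_adjoin hp) mk_mem_adjoin
  refine (hR.adjoin hcut ?_ ?_).extends (fun h => hβ α h hα0 hα)
  · intro q hq c _
    rw [mem_P_iff_le_ps hα' hα0 (hα ▸ fst_mem_dom hp) (fst_mem_dom hq),
      mem_P_iff_le_ps hy' hy0 (hy ▸ snd_mem_rng hp) (snd_mem_rng hq)]
    have := lt_iff_of_pos_iff (hcut.pos_iff_adjoin hR.pos_iff) hpair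
      (mem_adjoin.2 ⟨q, hq, c, rfl⟩)
    simp only [Prod.fst_add, Prod.snd_add, Prod.smul_fst, Prod.smul_snd] at this
    rw [← not_lt, ← not_lt, this]
  · intro q hq
    by_cases h0 : q.1 = 0
    · rw [h0, (hR.eq_zero_iff hq).1 h0, sub_zero, sub_zero]
      exact hpair
    · rw [hps q hq h0, hps' q hq ((hR.eq_zero_iff hq).not.1 h0)]
      exact le_adjoin (hR.ps_mem q hq)

end PartialIso
end HTriple

/-! ### Extensions over a domain with asymptotic integration -/

namespace HTriple

section Extension

variable {k : Type u} [Field k] [LinearOrder k] [IsStrictOrderedRing k]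
  {Γ : Type*} [AddCommGroup Γ] [LinearOrder Γ] [IsOrderedAddMonoid Γ]
  [Module k Γ] [PosSMulStrictMono k Γ]
  {Δ : Type*} [AddCommGroup Δ] [LinearOrder Δ] [IsOrderedAddMonoid Δ]
  [Module k Δ] [PosSMulStrictMono k Δ]

/-- Asymptotic integration in a subspace. -/
def Integ (H : HTriple k Γ) (A : Submodule k Γ) : Prop :=
  ∀ x ∈ A, ∃ z ∈ A, z ≠ 0 ∧ z + H.ps z = x

/-- Solve `w + ps w = ps z`. The axiom excludes `w > 0`, so `ps w = ps z - w` exceeds `ps z`; thus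
the values of `ps` on `A` have no maximum. -/
theorem Integ.exists_ps_lt {H : HTriple k Γ} {A : Submodule k Γ} (hI : H.Integ A)
    (hA : ∀ x ∈ A, H.ps x ∈ A) {z : Γ} (hz : z ∈ A) (h0 : z ≠ 0) :
    ∃ w ∈ A, 0 < w ∧ H.ps z < H.ps w := by
  obtain ⟨w, hw, hw0, h⟩ := hI _ (hA z hz)
  rcases lt_or_gt_of_ne hw0 with h1 | h1
  · refine ⟨-w, A.neg_mem hw, neg_pos.2 h1, ?_⟩
    rw [ps_neg]
    grind
  · exact absurd h (H.ps_lt_add h1 h0).ne'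

/-- If there is no gap over `A`, there are no infinitesimals over `A`. -/
theorem Integ.exists_lt {H : HTriple k Γ} {A : Submodule k Γ} (hI : H.Integ A)
    (hA : ∀ x ∈ A, H.ps x ∈ A) (hG : ∀ x, ¬ H.IsGap A x) {x : Γ} (hx : 0 < x) :
    ∃ γ ∈ A, 0 < γ ∧ γ < x := by
  by_contra! h
  -- An `x` smaller than every positive element of `A` would make `ps x` a gap.
  refine hG (H.ps x) ⟨fun z hz h0 => ?_, fun z _ h0 => H.ps_lt_add h0 hx.ne'⟩
  obtain ⟨w, hw, hw0, h1⟩ := hI.exists_ps_lt hA hz h0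
  exact h1.trans_le (H.ps_anti_of_pos hx (h w hw hw0))

variable {H : HTriple k Γ} {K : HTriple k Δ} {R : Submodule k (Γ × Δ)} {b : Γ} {y : Δ}

theorem lt_iff_ps_lt {a b : Γ} (ha : 0 < a) (hb : 0 < b) (h : H.ps a ≠ H.ps b) :
    a < b ↔ H.ps b < H.ps a := by
  constructor
  · intro h1
    exact lt_of_le_of_ne (H.ps_anti_of_pos ha h1.le) h.symm
  · intro h1
    by_contra! h2
    exact absurd (H.ps_anti_of_pos hb h2) h1.not_ge

theorem IsPartialIso.exists_integ (hR : IsPartialIso H K R) (hI : H.Integ (dom R))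
    {p : Γ × Δ} (hp : p ∈ R) :
    ∃ z ∈ R, z.1 ≠ 0 ∧ z.2 ≠ 0 ∧ z.1 + H.ps z.1 = p.1 ∧ z.2 + K.ps z.2 = p.2 := by
  obtain ⟨z, hz, h0, h⟩ := hI _ (fst_mem_dom hp)
  obtain ⟨z', hz⟩ := mem_dom.1 hz
  exact ⟨_, hz, h0, (hR.eq_zero_iff hz).not.1 h0, h, (hR.eq_iff (hR.add_ps_mem hz) hp).1 h⟩

/-- Away from gaps, `P` is decided by lying below some `ps z`, which is in `P`, or above some `z +
ps z` with `z > 0`, which is not; such comparisons transfer. -/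
theorem IsPartialIso.mem_P_iff_of_not_isGap (hR : IsPartialIso H K R)
    {R' : Submodule k (Γ × Δ)} (hle : R ≤ R') (hpos : ∀ p ∈ R', 0 < p.1 ↔ 0 < p.2)
    {q : Γ × Δ} (hq : q ∈ R') (hG : ¬ H.IsGap (dom R) q.1) : q.1 ∈ H.P ↔ q.2 ∈ K.P := by
  simp only [IsGap, not_and_or, not_forall, not_lt] at hG
  rcases hG with ⟨z, hz, h0, h⟩ | ⟨z, hz, h0, h⟩
  · obtain ⟨z', hz⟩ := mem_dom.1 hz
    have h1 : q.2 ≤ K.ps z' := by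
      rw [← not_lt] at h ⊢
      rwa [← lt_iff_of_pos_iff hpos (hle (hR.ps_mem _ hz)) hq]
    exact iff_of_true (H.mem_P_of_le h (H.ps_mem_P h0))
      (K.mem_P_of_le h1 (K.ps_mem_P ((hR.eq_zero_iff hz).not.1 h0)))
  · obtain ⟨z', hz⟩ := mem_dom.1 hz
    have h1 : z' + K.ps z' ≤ q.2 := by
      rw [← not_lt] at h ⊢
      rwa [← lt_iff_of_pos_iff hpos hq (hle (hR.add_ps_mem hz))]
    exact iff_of_false (fun h' => H.add_ps_notMem_P h0 (H.mem_P_of_le h h'))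
      (fun h' => K.add_ps_notMem_P ((hR.pos_iff _ hz).1 h0) (K.mem_P_of_le h1 h'))

theorem IsPartialIso.adjoin_of_not_isGap (hR : IsPartialIso H K R) (h : SameCut R b y)
    (hG : ∀ p ∈ R, ∀ c : k, c ≠ 0 → ¬ H.IsGap (dom R) (p.1 + c • b))
    (hps : ∀ p ∈ R, (H.ps (b - p.1), K.ps (y - p.2)) ∈ HTriple.adjoin R b y) :
    IsPartialIso H K (HTriple.adjoin R b y) := by
  refine hR.adjoin h (fun p hp c hc => ?_) hps
  exact hR.mem_P_iff_of_not_isGap le_adjoin (h.pos_iff_adjoin hR.pos_iff)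
    (mem_adjoin.2 ⟨p, hp, c, rfl⟩) (hG p hp c hc)

/-- Adjoining a solution of `ps z = β`. -/
theorem IsPartialIso.extends_of_ps_ne (hR : IsPartialIso H K R) (hH : H.toHCouple.IsClosed)
    (hK : K.toHCouple.IsClosed) (hI : H.Integ (dom R)) {p : Γ × Δ} (hp : p ∈ R) (hP : p.1 ∈ H.P)
    (hβ : ∀ z ∈ dom R, z ≠ 0 → H.ps z ≠ p.1) : Extends H K R := by
  obtain ⟨b, hb0, hb⟩ := H.exists_ps_eq_of_mem_P hH hP
  obtain ⟨y, hy0, hy⟩ := K.exists_ps_eq_of_mem_P hK ((hR.mem_P_iff p hp).1 hP)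
  have hβ' (q) (hq : q ∈ R) (h0 : q.2 ≠ 0) : K.ps q.2 ≠ p.2 := fun h =>
    hβ _ (fst_mem_dom hq) ((hR.eq_zero_iff hq).not.2 h0) ((hR.eq_iff (hR.ps_mem q hq) hp).2 h)
  -- As `p.1` is not a `ps`-value over the domain, positive elements are compared with `b` by
  -- comparing their values.
  have hcut : SameCut R b y := by
    intro q hq
    have hpos := hR.pos_iff q hq
    rcases le_or_gt q.1 0 with h | h
    · have h' : q.2 ≤ 0 := by grind
      grind
    · have h' := hpos.1 h
      have h1 := hβ _ (fst_mem_dom hq) h.ne'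
      have h2 := hβ' _ hq h'.ne'
      have h3 := hR.lt_iff (hR.ps_mem q hq) hp
      have h4 := hR.lt_iff hp (hR.ps_mem q hq)
      rw [← hb] at h1 h3 h4
      rw [← hy] at h2 h3 h4
      rw [lt_iff_ps_lt h hb0 h1, lt_iff_ps_lt h' hy0 h2, lt_iff_ps_lt hb0 h h1.symm,
        lt_iff_ps_lt hy0 h' h2.symm]
      exact ⟨h4, h3⟩
  have hmem : b ∉ dom R := fun h => hβ b h hb0.ne' hb
  refine (hR.adjoin_of_not_isGap hcut ?_ ?_).extends hmem
  -- Were `q.1 + c • b` a gap, write `q.1 = z + ps z`: subtracting it leaves `c • b`, so `ps z = ps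
  -- b = p.1`, which was excluded.
  · intro q hq c hc hG
    obtain ⟨z, hz, h0, -, h1, -⟩ := hR.exists_integ hI hq
    have h2 := (hG.sub_ne_zero_and_ps_sub_eq (fst_mem_dom hz) h0).2
    rw [h1, add_sub_cancel_left, H.ps_smul hc, hb] at h2
    exact hβ _ (fst_mem_dom hz) h0 h2.symm
  · intro q hq
    apply le_adjoin
    by_cases h0 : q.1 = 0
    · simpa [h0, (hR.eq_zero_iff hq).1 h0, hb, hy] using hp
    · have h0' := (hR.eq_zero_iff hq).not.1 h0
      rcases lt_or_gt_of_ne (hβ _ (fst_mem_dom hq) h0) with h | h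
      · have h' := (hR.lt_iff (hR.ps_mem q hq) hp).1 h
        rw [← hb] at h
        rw [← hy] at h'
        rw [H.ps_sub_of_gt hb0.ne' h0 h, K.ps_sub_of_gt hy0.ne' h0' h']
        exact hR.ps_mem q hq
      · have h' := (hR.lt_iff hp (hR.ps_mem q hq)).1 h
        rw [← hb] at h
        rw [← hy] at h'
        rw [H.ps_sub_of_lt hb0.ne' h0 h, K.ps_sub_of_lt hy0.ne' h0' h', hb, hy]
        exact hp

/-- Adjoining a gap that belongs to `P`. -/
theorem IsPartialIso.extends_of_isGap (hR : IsPartialIso H K R)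
    (hI : H.Integ (dom R)) (hb : H.IsGap (dom R) b) (hbP : b ∈ H.P) (hyP : y ∈ K.P)
    (hy : ∀ q ∈ R, q.1 ≠ 0 → K.ps q.2 < y) : Extends H K R := by
  have hyG : K.IsGap (rng R) y := by
    constructor
    · intro z hz h0
      obtain ⟨z', hz⟩ := mem_rng.1 hz
      exact hy _ hz ((hR.eq_zero_iff hz).not.2 h0)
    · intro z _ h0
      exact K.lt_add_ps_of_mem_P hyP h0
  -- Every element of the domain is some `z + ps z`, and its side of the gap is the sign of `z`.
  have hcut : SameCut R b y := by
    intro q hq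
    obtain ⟨z, hz, h0, h0', h1, h2⟩ := hR.exists_integ hI hq
    rw [← h1, ← h2]
    have h3 := hb.1 _ (fst_mem_dom hz) h0
    have h4 := hb.2 _ (fst_mem_dom hz)
    have h5 := hyG.1 _ (snd_mem_rng hz) h0'
    have h6 := hyG.2 _ (snd_mem_rng hz)
    have h7 := hR.pos_iff _ hz
    rcases lt_or_gt_of_ne h0 with h8 | h8
    · have : z.2 < 0 := by grind
      grind
    · grind
  have hmem : b ∉ dom R := by
    intro h
    obtain ⟨z, hz, h0, h1⟩ := hI b h
    exact (hb.sub_ne_zero_and_ps_sub_eq hz h0).1 (by rw [h1, sub_self])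
  refine (hR.adjoin hcut ?_ ?_).extends hmem
  · intro q hq c hc
    by_cases h : q.1 = 0 ∧ c = 1
    · have h' := (hR.eq_zero_iff hq).1 h.1
      simp [h.1, h.2, h', hbP, hyP]
    refine hR.mem_P_iff_of_not_isGap le_adjoin (hcut.pos_iff_adjoin hR.pos_iff)
      (mem_adjoin.2 ⟨q, hq, c, rfl⟩) (fun hG => ?_)
    replace hG : H.IsGap (dom R) (q.1 + c • b) := hG
    -- A second gap `q.1 + c • b` would differ from `b` by less than every positive element of the
    -- domain. For `c = 1` the difference is in the domain; otherwise it is a multiple of `b - a`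
    -- with `a` in the domain, so it has value some `ps z`, whereas the bound forces a larger value.
    have key := fun γ hγ h0 => hG.abs_sub_lt (z := γ) hb hγ h0
    by_cases hc1 : c = 1
    · have hq0 : q.1 ≠ 0 := fun h0 => h ⟨h0, hc1⟩
      have := key |q.1| ?_ (abs_pos.2 hq0)
      · rw [hc1, one_smul, add_sub_cancel_right] at this
        exact this.false
      · rcases abs_choice q.1 with h | h <;> rw [h]
        · exact fst_mem_dom hq
        · exact (dom R).neg_mem (fst_mem_dom hq)
    · have hc1 : c - 1 ≠ 0 := sub_ne_zero.2 hc1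
      obtain ⟨z, hz, h0, -, h1, -⟩ := hR.exists_integ hI (R.neg_mem (R.smul_mem (c - 1)⁻¹ hq))
      obtain ⟨h2, h3⟩ := hb.sub_ne_zero_and_ps_sub_eq (fst_mem_dom hz) h0
      have h4 : q.1 + c • b - b = (c - 1) • (b - (z.1 + H.ps z.1)) := by
        rw [h1]
        simp only [Prod.fst_neg, Prod.smul_fst, sub_neg_eq_add, smul_add, smul_inv_smul₀ hc1,
          sub_smul, one_smul]
        abel
      obtain ⟨w, hw, hw0, h5⟩ := hI.exists_ps_lt hR.ps_mem_dom (fst_mem_dom hz) h0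
      have h6 := key w hw hw0
      rw [h4] at h6
      have h7 := H.ps_anti (smul_ne_zero hc1 h2) (h6.le.trans (le_abs_self w))
      rw [H.ps_smul hc1, h3] at h7
      exact h7.not_gt h5
  · intro q hq
    obtain ⟨z, hz, h0, h0', h1, h2⟩ := hR.exists_integ hI hq
    rw [← h1, ← h2, (hb.sub_ne_zero_and_ps_sub_eq (fst_mem_dom hz) h0).2,
      (hyG.sub_ne_zero_and_ps_sub_eq (snd_mem_rng hz) h0').2]
    exact le_adjoin (hR.ps_mem z hz)

/-- Adjoining an element whose differences with elements of the domain have their values of `ps`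
in the domain. -/
theorem IsPartialIso.extends_of_ps_sub_mem (hR : IsPartialIso H K R)
    (hG : ∀ x, ¬ H.IsGap (dom R) x) (hb : b ∉ dom R) (hcut : SameCut R b y)
    (hps : ∀ p ∈ R, (H.ps (b - p.1), K.ps (y - p.2)) ∈ R) : Extends H K R :=
  (hR.adjoin_of_not_isGap hcut (fun _ _ _ _ => hG _) fun p hp => le_adjoin (hps p hp)).extends hb

/-! ### Iterating `ps` on an element with new values -/

section Transcendental

variable (hR : IsPartialIso H K R) (hI : H.Integ (dom R)) (hG : ∀ x, ¬ H.IsGap (dom R) x)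
  (hP : ∀ x ∈ dom R, x ∈ H.P → ∃ z ∈ dom R, z ≠ 0 ∧ H.ps z = x)

-- `ps` is decreasing on positive elements and, by `hP`, attains over the domain each of its
-- elements in `P`. Hence the cut of `b` determines the cut of `ps b`.
include hR hI hG hP in
theorem SameCut.ps_of_pos (h : SameCut R b y) (hb : 0 < b) (hps : H.ps b ∉ dom R) :
    SameCut R (H.ps b) (K.ps y) := by
  have hy : 0 < y := h.pos_iff.1 hb
  have hP' (p) (hp : p ∈ R) (h1 : p.1 ∈ H.P) :
      ∃ z ∈ R, 0 < z.1 ∧ 0 < z.2 ∧ H.ps z.1 = p.1 ∧ K.ps z.2 = p.2 := by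
    obtain ⟨z, hz, h0, h2⟩ := hP _ (fst_mem_dom hp) h1
    have : |z| ∈ dom R := by
      rcases abs_choice z with h | h <;> rw [h]
      · exact hz
      · exact (dom R).neg_mem hz
    obtain ⟨z', hz'⟩ := mem_dom.1 this
    have h3 : H.ps |z| = p.1 := by rw [ps_abs, h2]
    exact ⟨_, hz', abs_pos.2 h0, (hR.pos_iff _ hz').1 (abs_pos.2 h0), h3,
      (hR.eq_iff (hR.ps_mem _ hz') hp).1 h3⟩
  have hlow (p) (hp : p ∈ R) (h1 : p.1 < H.ps b) : p.2 < K.ps y := by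
    -- The margin `γ` restores the strictness lost because `ps` is only weakly decreasing.
    obtain ⟨γ, hγ, h0, h2⟩ := hI.exists_lt hR.ps_mem_dom hG (sub_pos.2 h1)
    obtain ⟨γ', hγ⟩ := mem_dom.1 hγ
    have h3 : p.1 + γ < H.ps b := by grind
    have hpγ := R.add_mem hp hγ
    obtain ⟨z, hz, hz0, hz0', h4, h5⟩ := hP' _ hpγ (H.mem_P_of_le h3.le (H.ps_mem_P hb.ne'))
    have h6 : b < z.1 := by
      by_contra! h7
      have := H.ps_anti_of_pos hz0 h7
      rw [h4] at this
      exact this.not_gt h3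
    have h7 := K.ps_anti_of_pos hy ((h z hz).2.1 h6).le
    have h8 := (hR.pos_iff _ hγ).1 h0
    rw [h5] at h7
    simp only [Prod.snd_add] at h7 h8
    grind
  have hupp (p) (hp : p ∈ R) (h1 : H.ps b < p.1) : K.ps y < p.2 := by
    -- Since `ps b` is not a gap, some `ps z` over the domain lies above it; this keeps elements
    -- slightly above `ps b` inside `P`, where they are again `ps`-values.
    have hn := hG (H.ps b)
    simp only [IsGap, not_and_or, not_forall, not_lt] at hn
    rcases hn with ⟨z, hz, h0, h2⟩ | ⟨z, hz, h0, h2⟩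
    swap
    · exact absurd (H.ps_lt_add h0 hb.ne') h2.not_gt
    have h2 : H.ps b < H.ps z :=
      lt_of_le_of_ne h2 (fun h => hps (h ▸ hR.ps_mem_dom z hz))
    obtain ⟨z', hz⟩ := mem_dom.1 hz
    obtain ⟨γ, hγ, hγ0, h3⟩ := hI.exists_lt hR.ps_mem_dom hG (sub_pos.2 (lt_min h1 h2))
    obtain ⟨γ', hγ⟩ := mem_dom.1 hγ
    have hzP := H.ps_mem_P h0
    have hq := R.sub_mem hp hγ
    have hr := R.sub_mem (hR.ps_mem _ hz) hγ
    have key (q) (hq : q ∈ R) (hq1 : H.ps b < q.1) (hqP : q.1 ∈ H.P) : K.ps y ≤ q.2 := by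
      obtain ⟨t, ht, ht0, ht0', h4, h5⟩ := hP' _ hq hqP
      rw [← h5]
      refine K.ps_anti_of_pos ht0' ((h t ht).1.1 ?_).le
      rwa [lt_iff_ps_lt ht0 hb (by rw [h4]; exact hq1.ne'), h4]
    have h8 := (hR.pos_iff _ hγ).1 hγ0
    simp only at h8
    rcases le_total p.1 (H.ps z) with h4 | h4
    · have := key _ hq (by simp only [Prod.fst_sub]; grind)
        (H.mem_P_of_le (by simp only [Prod.fst_sub]; grind) hzP)
      simp only [Prod.snd_sub] at this
      grind
    · have := key _ hr (by simp only [Prod.fst_sub]; grind)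
        (H.mem_P_of_le (by simp only [Prod.fst_sub]; grind) hzP)
      have h5 := (hR.le_iff (hR.ps_mem _ hz) hp).1 h4
      simp only [Prod.snd_sub] at this h5
      grind
  intro p hp
  have hne : p.1 ≠ H.ps b := fun h' => hps (h' ▸ fst_mem_dom hp)
  have h1 := hlow p hp
  have h2 := hupp p hp
  grind

include hR hI hG hP in
theorem SameCut.ps (h : SameCut R b y) (hps : H.ps b ∉ dom R) :
    SameCut R (H.ps b) (K.ps y) := by
  have hb : b ≠ 0 := by
    rintro rfl
    simp at hps
  rcases lt_or_gt_of_ne hb with hb | hb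
  · rw [← H.ps_neg, ← K.ps_neg]
    exact h.neg.ps_of_pos hR hI hG hP (neg_pos.2 hb) (by rwa [ps_neg])
  · exact h.ps_of_pos hR hI hG hP hb hps

/-- By `ps_lt_ps_sub` the difference has value above `ps b`; without cancellation, `b' + a` has
value at most `ps b'`. This makes the values along the sequence below strictly increasing. -/
theorem ps_lt_of_ps_sub_eq (H : HTriple k Γ) {b b' z a : Γ} (hz : z ≠ 0) (hb' : b' ≠ 0)
    (h : H.ps b < H.ps z) (h1 : H.ps b - H.ps z = b' + a) (h2 : H.ps a ≠ H.ps b') :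
    H.ps b < H.ps b' := by
  have h3 := H.ps_lt_ps_sub hz h
  rw [ps_sub_comm, h1] at h3
  by_cases ha0 : a = 0
  · simpa [ha0] using h3
  · rcases lt_or_gt_of_ne h2 with h4 | h4
    · rw [H.ps_add_of_gt hb' ha0 h4] at h3
      exact h3.trans h4
    · rwa [H.ps_add_of_lt hb' ha0 h4] at h3

/-- The chain of relations obtained by adjoining a sequence of pairs. -/
def adjoinSeq (R : Submodule k (Γ × Δ)) (s : ℕ → Γ × Δ) : ℕ → Submodule k (Γ × Δ)
  | 0 => R
  | n + 1 => adjoin (adjoinSeq R s n) (s n).1 (s n).2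

theorem monotone_adjoinSeq (R : Submodule k (Γ × Δ)) (s : ℕ → Γ × Δ) :
    Monotone (adjoinSeq R s) :=
  monotone_nat_of_le_succ fun _ => le_adjoin

theorem mem_adjoinSeq (R : Submodule k (Γ × Δ)) (s : ℕ → Γ × Δ) {m n : ℕ} (h : m < n) :
    s m ∈ adjoinSeq R s n :=
  monotone_adjoinSeq R s (Nat.succ_le_of_lt h) mk_mem_adjoin

/-- `q` and `l` have the same sign and the same value of `ps`, in both coordinates. -/
def SameLead (H : HTriple k Γ) (K : HTriple k Δ) (q l : Γ × Δ) : Prop :=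
  q.1 ≠ 0 ∧ q.2 ≠ 0 ∧ (0 < q.1 ↔ 0 < q.2) ∧ H.ps q.1 = H.ps l.1 ∧ K.ps q.2 = K.ps l.2

theorem SameLead.add_of_lt {q l r : Γ × Δ} (h : SameLead H K q l)
    (h1 : r.1 ≠ 0) (h2 : r.2 ≠ 0) (h3 : H.ps q.1 < H.ps r.1) (h4 : K.ps q.2 < K.ps r.2) :
    SameLead H K (q + r) l := by
  obtain ⟨a, b, c, d, e⟩ := h
  refine ⟨H.add_ne_zero_of_ps_lt h3, K.add_ne_zero_of_ps_lt h4, ?_, ?_, ?_⟩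
  · simp only [Prod.fst_add, Prod.snd_add, H.pos_add_iff_of_ps_lt a h3,
      K.pos_add_iff_of_ps_lt b h4, c]
  · rw [← d]; exact H.ps_add_of_lt a h1 h3
  · rw [← e]; exact K.ps_add_of_lt b h2 h4

theorem SameCut.sameLead (h : SameCut R b y) (hb : b ≠ 0) {c : k} (hc : c ≠ 0) :
    SameLead H K (c • (b, y)) (b, y) := by
  refine ⟨smul_ne_zero hc hb, smul_ne_zero hc (h.ne_zero_iff.1 hb), ?_, H.ps_smul hc _,
    K.ps_smul hc _⟩
  have h1 := h.neg_iff
  have h2 := h.pos_iff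
  simp only [Prod.smul_fst, Prod.smul_snd]
  rcases lt_or_gt_of_ne hc with hc | hc
  · simp [smul_pos_iff_of_neg_left hc, h1]
  · simp [smul_pos_iff_of_pos_left hc, h2]

-- The values of the `s n` are distinct and lie outside the domain. So the terms of a combination
-- have distinct values, and the one of least value decides sign and `ps`, in both coordinates
-- alike.
include hR in
theorem sameLead_of_mem_adjoinSeq {s : ℕ → Γ × Δ} (h0 : ∀ n, (s n).1 ≠ 0)
    (hs : ∀ n, SameCut R (s n).1 (s n).2)
    (hps : ∀ n, SameCut R (H.ps (s n).1) (K.ps (s n).2))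
    (hmem : ∀ n, H.ps (s n).1 ∉ dom R) (hmono : StrictMono fun n => H.ps (s n).1)
    (hmono' : StrictMono fun n => K.ps (s n).2) (n : ℕ) :
    ∀ q ∈ adjoinSeq R s n, q = 0 ∨
      ∃ l, ((l ∈ R ∧ l.1 ≠ 0) ∨ ∃ i < n, l = s i) ∧ SameLead H K q l := by
  induction n with
  | zero =>
    intro q hq
    by_cases hq0 : q.1 = 0
    · exact Or.inl (Prod.ext hq0 ((hR.eq_zero_iff hq).1 hq0))
    · exact Or.inr ⟨q, Or.inl ⟨hq, hq0⟩, hq0, (hR.eq_zero_iff hq).not.1 hq0, hR.pos_iff q hq,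
        rfl, rfl⟩
  | succ n ih =>
    intro q hq
    obtain ⟨p, hp, c, rfl⟩ := mem_adjoin.1 hq
    have hlift {l : Γ × Δ} (h : (l ∈ R ∧ l.1 ≠ 0) ∨ ∃ i < n, l = s i) :
        (l ∈ R ∧ l.1 ≠ 0) ∨ ∃ i < n + 1, l = s i := by
      rcases h with h | ⟨i, hi, h⟩
      · exact Or.inl h
      · exact Or.inr ⟨i, by omega, h⟩
    by_cases hc : c = 0
    · rcases ih p hp with h | ⟨l, hl, h⟩
      · left; simp [hc, h]
      · exact Or.inr ⟨l, hlift hl, by simpa [hc] using h⟩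
    have hL : SameLead H K (c • s n) (s n) := (hs n).sameLead (h0 n) hc
    rcases ih p hp with rfl | ⟨l, hl, h⟩
    · exact Or.inr ⟨s n, Or.inr ⟨n, by omega, rfl⟩, by simpa using hL⟩
    have hdich : (H.ps l.1 < H.ps (s n).1 ∧ K.ps l.2 < K.ps (s n).2) ∨
        (H.ps (s n).1 < H.ps l.1 ∧ K.ps (s n).2 < K.ps l.2) := by
      rcases hl with ⟨hl, -⟩ | ⟨i, hi, rfl⟩
      · have h1 := hR.ps_mem l hl
        have h2 := hps n _ h1
        rcases lt_trichotomy (H.ps l.1) (H.ps (s n).1) with h3 | h3 | h3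
        · exact Or.inl ⟨h3, h2.1.1 h3⟩
        · exact absurd (h3 ▸ fst_mem_dom h1) (hmem n)
        · exact Or.inr ⟨h3, h2.2.1 h3⟩
      · exact Or.inl ⟨hmono hi, hmono' hi⟩
    obtain ⟨e1, e2, e3, e4, e5⟩ := h
    obtain ⟨f1, f2, f3, f4, f5⟩ := hL
    rcases hdich with ⟨h1, h2⟩ | ⟨h1, h2⟩
    · exact Or.inr ⟨l, hlift hl, SameLead.add_of_lt ⟨e1, e2, e3, e4, e5⟩ f1 f2
        (by rwa [e4, f4]) (by rwa [e5, f5])⟩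
    · refine Or.inr ⟨s n, Or.inr ⟨n, by omega, rfl⟩, ?_⟩
      rw [add_comm]
      exact SameLead.add_of_lt ⟨f1, f2, f3, f4, f5⟩ e1 e2 (by rwa [e4, f4]) (by rwa [e5, f5])

include hR hI hG hP in
/-- Adjoining an element `b` such that no `ps`-value of a difference is in the domain. -/
theorem IsPartialIso.extends_of_ps_notMem
    (hN : ∀ x ∉ dom R, ∃ a ∈ dom R, H.ps (x - a) ∉ dom R)
    (hb : H.ps b ∉ dom R) (hcut : SameCut R b y) : Extends H K R := by
  have hN' : ∀ x, ∃ p ∈ R, x ∉ dom R → H.ps (x - p.1) ∉ dom R := by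
    intro x
    by_cases hx : x ∈ dom R
    · exact ⟨0, R.zero_mem, fun h => absurd hx h⟩
    · obtain ⟨a, ha, h⟩ := hN x hx
      obtain ⟨a', ha⟩ := mem_dom.1 ha
      exact ⟨_, ha, fun _ => h⟩
  choose g hgR hg using hN'
  -- Closure under `ps` forces `ps b` to be adjoined, then its own values, and so on. Subtracting
  -- the chosen element of `R` each time keeps the next value outside the domain.
  let s : ℕ → Γ × Δ := fun n => Nat.rec (b, y)
    (fun _ t => (H.ps t.1, K.ps t.2) - g (H.ps t.1)) n
  have hs_succ (n) : s (n + 1) = (H.ps (s n).1, K.ps (s n).2) - g (H.ps (s n).1) := rfl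
  have hinv (n) : SameCut R (s n).1 (s n).2 ∧ H.ps (s n).1 ∉ dom R := by
    induction n with
    | zero => exact ⟨hcut, hb⟩
    | succ n ih =>
      rw [hs_succ]
      exact ⟨(ih.1.ps hR hI hG hP ih.2).sub (hgR _), hg _ ih.2⟩
  have hps (n) : SameCut R (H.ps (s n).1) (K.ps (s n).2) := (hinv n).1.ps hR hI hG hP (hinv n).2
  have h0 (n) : (s n).1 ≠ 0 := by
    intro h
    have := (hinv n).2
    simp [h] at this
  have hz (n) : ∃ z ∈ R, z.1 ≠ 0 ∧ H.ps (s n).1 < H.ps z.1 := by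
    have hn := hG (H.ps (s n).1)
    simp only [IsGap, not_and_or, not_forall, not_lt] at hn
    rcases hn with ⟨z, hz, hz0, h2⟩ | ⟨z, hz, hz0, h2⟩
    · obtain ⟨z', hz'⟩ := mem_dom.1 hz
      exact ⟨_, hz', hz0, lt_of_le_of_ne h2 (fun h => (hinv n).2 (h ▸ hR.ps_mem_dom z hz))⟩
    · exact absurd (H.ps_lt_add hz0 (h0 n)) h2.not_gt
  have hstep (n) : H.ps (s n).1 < H.ps (s (n + 1)).1 := by
    obtain ⟨z, hz, hz0, h2⟩ := hz n
    have ha := R.sub_mem (hgR (H.ps (s n).1)) (hR.ps_mem z hz)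
    refine H.ps_lt_of_ps_sub_eq hz0 (h0 (n + 1)) h2 (a := (g (H.ps (s n).1) - (H.ps z.1, K.ps z.2)).1)
      (by rw [hs_succ]; simp) (fun h => (hinv (n + 1)).2 ?_)
    exact h ▸ fst_mem_dom (hR.ps_mem _ ha)
  have hstep' (n) : K.ps (s n).2 < K.ps (s (n + 1)).2 := by
    obtain ⟨z, hz, hz0, h2⟩ := hz n
    have ha := R.sub_mem (hgR (H.ps (s n).1)) (hR.ps_mem z hz)
    refine K.ps_lt_of_ps_sub_eq ((hR.eq_zero_iff hz).not.1 hz0)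
      ((hinv (n + 1)).1.ne_zero_iff.1 (h0 (n + 1))) ((hps n _ (hR.ps_mem z hz)).2.1 h2)
      (a := (g (H.ps (s n).1) - (H.ps z.1, K.ps z.2)).2)
      (by rw [hs_succ]; simp) (fun h => (hinv (n + 1)).2 ?_)
    have h3 := hps (n + 1) _ (hR.ps_mem _ ha)
    have h4 : H.ps (g (H.ps (s n).1) - (H.ps z.1, K.ps z.2)).1 = H.ps (s (n + 1)).1 := by
      grind
    exact h4 ▸ fst_mem_dom (hR.ps_mem _ ha)
  have hlead := sameLead_of_mem_adjoinSeq hR h0 (fun n => (hinv n).1) hps (fun n => (hinv n).2)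
    (strictMono_nat_of_lt_succ hstep) (strictMono_nat_of_lt_succ hstep')
  have hdir := (monotone_adjoinSeq R s).directed_le
  have hmem_iff {q} : q ∈ (⨆ n, adjoinSeq R s n) ↔ ∃ n, q ∈ adjoinSeq R s n :=
    Submodule.mem_iSup_of_directed _ hdir
  have hle : R ≤ ⨆ n, adjoinSeq R s n := le_iSup (adjoinSeq R s) 0
  have hpos : ∀ q ∈ ⨆ n, adjoinSeq R s n, 0 < q.1 ↔ 0 < q.2 := by
    intro q hq
    obtain ⟨n, hq⟩ := hmem_iff.1 hq
    rcases hlead n q hq with rfl | ⟨l, -, h⟩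
    · simp
    · exact h.2.2.1
  refine ⟨_, hle, ⟨hpos, ?_, ?_⟩, b, fst_mem_dom (hmem_iff.2 ⟨1, mk_mem_adjoin⟩), ?_⟩
  · intro q hq
    exact hR.mem_P_iff_of_not_isGap hle hpos hq (hG _)
  · intro q hq
    obtain ⟨n, hq⟩ := hmem_iff.1 hq
    rcases hlead n q hq with rfl | ⟨l, hl, -, -, -, h1, h2⟩
    · simp only [Prod.fst_zero, Prod.snd_zero, ps_zero]
      exact Submodule.zero_mem _
    · rw [h1, h2]
      rcases hl with ⟨hl, -⟩ | ⟨i, -, rfl⟩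
      · exact hle (hR.ps_mem l hl)
      -- By this recursion the union of the chain is closed under `ps`.
      · have : (H.ps (s i).1, K.ps (s i).2) = s (i + 1) + g (H.ps (s i).1) := by
          rw [hs_succ, sub_add_cancel]
        rw [this]
        exact Submodule.add_mem _ (hmem_iff.2 ⟨i + 2, mem_adjoinSeq R s (m := i + 1) (by omega)⟩)
          (hle (hgR _))
  · exact fun h => hb (hR.ps_mem_dom b h)

end Transcendental

end Extension
end HTriple

/-! ### Terms, formulas and first-order axioms -/

namespace HTripleLanguage

open FirstOrder FirstOrder.Language

section Symbols

variable {k : Type u} {α : Type*} {n : ℕ}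

/-- The constant `0`. -/
def tZero : (HTripleLanguage k).Term α := .func (l := 0) HTripleFunctions.zero ![]

/-- The constant `∞`. -/
def tInf : (HTripleLanguage k).Term α := .func (l := 0) HTripleFunctions.infty ![]

/-- The term `-t`. -/
def tNeg (t : (HTripleLanguage k).Term α) : (HTripleLanguage k).Term α :=
  .func (l := 1) HTripleFunctions.neg ![t]

/-- The term `c • t`. -/
def tSmul (c : k) (t : (HTripleLanguage k).Term α) : (HTripleLanguage k).Term α :=
  .func (l := 1) (HTripleFunctions.smul c) ![t]

/-- The term `psi t`. -/
def tPsi (t : (HTripleLanguage k).Term α) : (HTripleLanguage k).Term α :=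
  .func (l := 1) HTripleFunctions.psi ![t]

/-- The term `t + s`. -/
def tAdd (t s : (HTripleLanguage k).Term α) : (HTripleLanguage k).Term α :=
  .func (l := 2) HTripleFunctions.add ![t, s]

/-- The formula `t < s`. -/
def fLt (t s : (HTripleLanguage k).Term (α ⊕ Fin n)) : (HTripleLanguage k).BoundedFormula α n :=
  Relations.boundedFormula (n := 2) (HTripleRelations.lt) ![t, s]

/-- The formula `P t`. -/
def fP (t : (HTripleLanguage k).Term (α ⊕ Fin n)) : (HTripleLanguage k).BoundedFormula α n :=
  Relations.boundedFormula (n := 1) (HTripleRelations.P) ![t]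

variable (k) {M : Type*} [(HTripleLanguage k).Structure M]

/-- The interpretation of `0`. -/
def oZero : M := Structure.funMap (L := HTripleLanguage k) (n := 0) HTripleFunctions.zero ![]

/-- The interpretation of `∞`. -/
def oInf : M := Structure.funMap (L := HTripleLanguage k) (n := 0) HTripleFunctions.infty ![]

/-- The interpretation of `-`. -/
def oNeg (x : M) : M :=
  Structure.funMap (L := HTripleLanguage k) (n := 1) HTripleFunctions.neg ![x]

variable {k} in
/-- The interpretation of scalar multiplication. -/
def oSmul (c : k) (x : M) : M :=
  Structure.funMap (L := HTripleLanguage k) (n := 1) (HTripleFunctions.smul c) ![x]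

/-- The interpretation of `psi`. -/
def oPsi (x : M) : M :=
  Structure.funMap (L := HTripleLanguage k) (n := 1) HTripleFunctions.psi ![x]

/-- The interpretation of `+`. -/
def oAdd (x y : M) : M :=
  Structure.funMap (L := HTripleLanguage k) (n := 2) HTripleFunctions.add ![x, y]

/-- The interpretation of `<`. -/
def rLt (x y : M) : Prop :=
  Structure.RelMap (L := HTripleLanguage k) (n := 2) HTripleRelations.lt ![x, y]

/-- The interpretation of `P`. -/
def rP (x : M) : Prop :=
  Structure.RelMap (L := HTripleLanguage k) (n := 1) HTripleRelations.P ![x]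

variable {k} (v : α → M)

@[simp] theorem realize_tZero : (tZero : (HTripleLanguage k).Term α).realize v = oZero k := by
  simp only [tZero, Term.realize, oZero]
  congr 1; ext i; exact i.elim0

@[simp] theorem realize_tInf : (tInf : (HTripleLanguage k).Term α).realize v = oInf k := by
  simp only [tInf, Term.realize, oInf]
  congr 1; ext i; exact i.elim0

@[simp] theorem realize_tNeg (t : (HTripleLanguage k).Term α) :
    (tNeg t).realize v = oNeg k (t.realize v) := by
  simp only [tNeg, Term.realize, oNeg]
  congr 1; ext i; fin_cases i; rfl

@[simp] theorem realize_tSmul (c : k) (t : (HTripleLanguage k).Term α) :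
    (tSmul c t).realize v = oSmul c (t.realize v) := by
  simp only [tSmul, Term.realize, oSmul]
  congr 1; ext i; fin_cases i; rfl

@[simp] theorem realize_tPsi (t : (HTripleLanguage k).Term α) :
    (tPsi t).realize v = oPsi k (t.realize v) := by
  simp only [tPsi, Term.realize, oPsi]
  congr 1; ext i; fin_cases i; rfl

@[simp] theorem realize_tAdd (t s : (HTripleLanguage k).Term α) :
    (tAdd t s).realize v = oAdd k (t.realize v) (s.realize v) := by
  simp only [tAdd, Term.realize, oAdd]
  congr 1; ext i; fin_cases i <;> rfl

variable (xs : Fin n → M)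

@[simp] theorem realize_fLt (t s : (HTripleLanguage k).Term (α ⊕ Fin n)) :
    (fLt t s).Realize v xs ↔ rLt k (t.realize (Sum.elim v xs)) (s.realize (Sum.elim v xs)) := by
  change Structure.RelMap (L := HTripleLanguage k) (n := 2) HTripleRelations.lt
    (fun i => (![t, s] i).realize (Sum.elim v xs)) ↔ _
  rw [rLt]
  congr! 1; ext i; fin_cases i <;> rfl

@[simp] theorem realize_fP (t : (HTripleLanguage k).Term (α ⊕ Fin n)) :
    (fP t).Realize v xs ↔ rP k (t.realize (Sum.elim v xs)) := by
  change Structure.RelMap (L := HTripleLanguage k) (n := 1) HTripleRelations.P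
    (fun i => (![t] i).realize (Sum.elim v xs)) ↔ _
  rw [rP]
  congr! 1; ext i; fin_cases i; rfl

end Symbols

/-- Names for the axioms of closed `H`-triples over `k`. -/
inductive Ax (k : Type u) : Type u
  | add_comm | add_assoc | zero_add | add_neg | add_inf | add_ne_inf | zero_ne_inf
  | neg_ne_inf | neg_inf
  | lt_irrefl | lt_trans | lt_total | lt_inf | add_lt_add
  | smul_add (c : k) | add_smul (c d : k) | mul_smul (c d : k) | one_smul | smul_inf (c : k)
  | smul_ne_inf (c : k) | smul_lt_smul (c : k) | psi_smul (c : k)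
  | psi_zero | psi_inf | psi_ne_inf | psi_add | psi_lt | psi_anti
  | not_P_inf | P_lower | P_psi | P_lt
  | psi_lower | integ

namespace Ax

variable {k : Type u} [Field k] [LinearOrder k] [IsStrictOrderedRing k]

/-- The meaning of an axiom in a structure. -/
def Holds (M : Type*) [(HTripleLanguage k).Structure M] : Ax k → Prop
  | add_comm => ∀ x y : M, oAdd k x y = oAdd k y x
  | add_assoc => ∀ x y z : M, oAdd k (oAdd k x y) z = oAdd k x (oAdd k y z)
  | zero_add => ∀ x : M, oAdd k (oZero k) x = x
  | add_neg => ∀ x : M, ¬ x = oInf k → oAdd k x (oNeg k x) = oZero k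
  | add_inf => ∀ x : M, oAdd k x (oInf k) = oInf k
  | add_ne_inf => ∀ x y : M, ¬ x = oInf k → ¬ y = oInf k → ¬ oAdd k x y = oInf k
  | zero_ne_inf => ¬ (oZero k : M) = oInf k
  | neg_ne_inf => ∀ x : M, ¬ x = oInf k → ¬ oNeg k x = oInf k
  | neg_inf => oNeg k (oInf k : M) = oInf k
  | lt_irrefl => ∀ x : M, ¬ rLt k x x
  | lt_trans => ∀ x y z : M, rLt k x y → rLt k y z → rLt k x z
  | lt_total => ∀ x y : M, rLt k x y ∨ x = y ∨ rLt k y x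
  | lt_inf => ∀ x : M, ¬ x = oInf k → rLt k x (oInf k)
  | add_lt_add => ∀ x y z : M, ¬ z = oInf k → rLt k x y → rLt k (oAdd k z x) (oAdd k z y)
  | smul_add c => ∀ x y : M, oSmul c (oAdd k x y) = oAdd k (oSmul c x) (oSmul c y)
  | add_smul c d => ∀ x : M, oSmul (c + d) x = oAdd k (oSmul c x) (oSmul d x)
  | mul_smul c d => ∀ x : M, oSmul (c * d) x = oSmul c (oSmul d x)
  | one_smul => ∀ x : M, oSmul (1 : k) x = x
  | smul_inf c => oSmul c (oInf k : M) = oInf k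
  | smul_ne_inf c => ∀ x : M, ¬ x = oInf k → ¬ oSmul c x = oInf k
  | smul_lt_smul c => 0 < c → ∀ x y : M, rLt k x y → rLt k (oSmul c x) (oSmul c y)
  | psi_smul c => c ≠ 0 → ∀ x : M, oPsi k (oSmul c x) = oPsi k x
  | psi_zero => oPsi k (oZero k : M) = oInf k
  | psi_inf => oPsi k (oInf k : M) = oInf k
  | psi_ne_inf => ∀ x : M, ¬ x = oZero k → ¬ x = oInf k → ¬ oPsi k x = oInf k
  | psi_add => ∀ x y : M, rLt k (oPsi k (oAdd k x y)) (oPsi k x) →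
      ¬ rLt k (oPsi k (oAdd k x y)) (oPsi k y)
  | psi_lt => ∀ x y : M, rLt k (oZero k) x → ¬ y = oZero k → ¬ y = oInf k →
      rLt k (oPsi k y) (oAdd k x (oPsi k x))
  | psi_anti => ∀ x y : M, rLt k (oZero k) x → rLt k x y → ¬ y = oInf k →
      ¬ rLt k (oPsi k x) (oPsi k y)
  | not_P_inf => ¬ rP k (oInf k : M)
  | P_lower => ∀ x y : M, rP k y → rLt k x y → rP k x
  | P_psi => ∀ x : M, ¬ x = oZero k → ¬ x = oInf k → rP k (oPsi k x)
  | P_lt => ∀ x y : M, rLt k (oZero k) x → rP k y → rLt k y (oAdd k x (oPsi k x))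
  | psi_lower => ∀ x y : M, ¬ x = oZero k → ¬ x = oInf k → rLt k y (oPsi k x) →
      ∃ z : M, ¬ z = oZero k ∧ ¬ z = oInf k ∧ oPsi k z = y
  | integ => ∀ x : M, ¬ x = oInf k →
      ∃ z : M, ¬ z = oZero k ∧ ¬ z = oInf k ∧ oAdd k z (oPsi k z) = x

open Classical in
/-- The sentence expressing an axiom. -/
noncomputable def sentence : Ax k → (HTripleLanguage k).Sentence
  | add_comm => ∀' ∀' (tAdd (&0) (&1) =' tAdd (&1) (&0))
  | add_assoc => ∀' ∀' ∀' (tAdd (tAdd (&0) (&1)) (&2) =' tAdd (&0) (tAdd (&1) (&2)))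
  | zero_add => ∀' (tAdd tZero (&0) =' &0)
  | add_neg => ∀' (∼(&0 =' tInf) ⟹ tAdd (&0) (tNeg (&0)) =' tZero)
  | add_inf => ∀' (tAdd (&0) tInf =' tInf)
  | add_ne_inf => ∀' ∀' (∼(&0 =' tInf) ⟹ ∼(&1 =' tInf) ⟹ ∼(tAdd (&0) (&1) =' tInf))
  | zero_ne_inf => ∼(tZero =' tInf)
  | neg_ne_inf => ∀' (∼(&0 =' tInf) ⟹ ∼(tNeg (&0) =' tInf))
  | neg_inf => tNeg tInf =' tInf
  | lt_irrefl => ∀' ∼(fLt (&0) (&0))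
  | lt_trans => ∀' ∀' ∀' (fLt (&0) (&1) ⟹ fLt (&1) (&2) ⟹ fLt (&0) (&2))
  | lt_total => ∀' ∀' (fLt (&0) (&1) ⊔ (&0 =' &1 ⊔ fLt (&1) (&0)))
  | lt_inf => ∀' (∼(&0 =' tInf) ⟹ fLt (&0) tInf)
  | add_lt_add => ∀' ∀' ∀' (∼(&2 =' tInf) ⟹ fLt (&0) (&1) ⟹
      fLt (tAdd (&2) (&0)) (tAdd (&2) (&1)))
  | smul_add c => ∀' ∀' (tSmul c (tAdd (&0) (&1)) =' tAdd (tSmul c (&0)) (tSmul c (&1)))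
  | add_smul c d => ∀' (tSmul (c + d) (&0) =' tAdd (tSmul c (&0)) (tSmul d (&0)))
  | mul_smul c d => ∀' (tSmul (c * d) (&0) =' tSmul c (tSmul d (&0)))
  | one_smul => ∀' (tSmul (1 : k) (&0) =' &0)
  | smul_inf c => tSmul c tInf =' tInf
  | smul_ne_inf c => ∀' (∼(&0 =' tInf) ⟹ ∼(tSmul c (&0) =' tInf))
  | smul_lt_smul c => if 0 < c then
      ∀' ∀' (fLt (&0) (&1) ⟹ fLt (tSmul c (&0)) (tSmul c (&1))) else ⊤
  | psi_smul c => if c ≠ 0 then ∀' (tPsi (tSmul c (&0)) =' tPsi (&0)) else ⊤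
  | psi_zero => tPsi tZero =' tInf
  | psi_inf => tPsi tInf =' tInf
  | psi_ne_inf => ∀' (∼(&0 =' tZero) ⟹ ∼(&0 =' tInf) ⟹ ∼(tPsi (&0) =' tInf))
  | psi_add => ∀' ∀' (fLt (tPsi (tAdd (&0) (&1))) (tPsi (&0)) ⟹
      ∼(fLt (tPsi (tAdd (&0) (&1))) (tPsi (&1))))
  | psi_lt => ∀' ∀' (fLt tZero (&0) ⟹ ∼(&1 =' tZero) ⟹ ∼(&1 =' tInf) ⟹
      fLt (tPsi (&1)) (tAdd (&0) (tPsi (&0))))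
  | psi_anti => ∀' ∀' (fLt tZero (&0) ⟹ fLt (&0) (&1) ⟹ ∼(&1 =' tInf) ⟹
      ∼(fLt (tPsi (&0)) (tPsi (&1))))
  | not_P_inf => ∼(fP tInf)
  | P_lower => ∀' ∀' (fP (&1) ⟹ fLt (&0) (&1) ⟹ fP (&0))
  | P_psi => ∀' (∼(&0 =' tZero) ⟹ ∼(&0 =' tInf) ⟹ fP (tPsi (&0)))
  | P_lt => ∀' ∀' (fLt tZero (&0) ⟹ fP (&1) ⟹ fLt (&1) (tAdd (&0) (tPsi (&0))))
  | psi_lower => ∀' ∀' (∼(&0 =' tZero) ⟹ ∼(&0 =' tInf) ⟹ fLt (&1) (tPsi (&0)) ⟹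
      ∃' (∼(&2 =' tZero) ⊓ (∼(&2 =' tInf) ⊓ (tPsi (&2) =' &1))))
  | integ => ∀' (∼(&0 =' tInf) ⟹
      ∃' (∼(&1 =' tZero) ⊓ (∼(&1 =' tInf) ⊓ (tAdd (&1) (tPsi (&1)) =' &0))))

/-- Conditions on scalars, such as `0 < c`, are external to the language: when one fails the
sentence is `⊤`. -/
theorem realize_sentence (M : Type*) [(HTripleLanguage k).Structure M] (a : Ax k) :
    M ⊨ a.sentence ↔ a.Holds M := by
  cases a with
  | smul_lt_smul c =>
    by_cases hc : 0 < c <;>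
      simp [sentence, Holds, Sentence.Realize, Formula.Realize, Fin.snoc, hc]
  | psi_smul c =>
    by_cases hc : c = 0 <;>
      simp [sentence, Holds, Sentence.Realize, Formula.Realize, Fin.snoc, hc]
  | _ => simp [sentence, Holds, Sentence.Realize, Formula.Realize, Fin.snoc]

end Ax
end HTripleLanguage

open FirstOrder FirstOrder.Language HTripleLanguage

/-! ### Closed triples satisfy the axioms -/

namespace HCouple

section PreCarrier

variable {k : Type u} [Field k] [LinearOrder k] [IsStrictOrderedRing k]
  {Γ : Type w} [AddCommGroup Γ] [LinearOrder Γ] [IsOrderedAddMonoid Γ]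

/-- The extension of `psi` to `Γ ∪ {∞}`. -/
noncomputable def psiTop (H : HCouple Γ) (x : WithTop Γ) : WithTop Γ :=
  WithTop.recTopCoe (C := fun _ => WithTop Γ) ⊤ H.psiExt x

@[simp] theorem psiTop_coe (H : HCouple Γ) (γ : Γ) : H.psiTop γ = H.psiExt γ := rfl

@[simp] theorem psiExt_zero (H : HCouple Γ) : H.psiExt 0 = ⊤ := by simp [psiExt]

theorem psiExt_of_ne (H : HCouple Γ) {γ : Γ} (h : γ ≠ 0) : H.psiExt γ = H.psi ⟨γ, h⟩ := by
  simp [psiExt, h]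

/-- The set `Γ ∪ {∞}`, with a family of unary operations in place of the scalar multiplications. -/
def PreCarrier (_H : HCouple Γ) (_P : Set Γ) (_s : k → Γ → Γ) : Type w := WithTop Γ

noncomputable instance (H : HCouple Γ) (P : Set Γ) (s : k → Γ → Γ) :
    (HTripleLanguage k).Structure (H.PreCarrier P s) where
  funMap {_} f := match f with
    | .zero => fun _ => ((0 : Γ) : WithTop Γ)
    | .infty => fun _ => (⊤ : WithTop Γ)
    | .neg => fun x => WithTop.map (fun γ : Γ => -γ) (x 0)
    | .smul c => fun x => WithTop.map (s c) (x 0)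
    | .psi => fun x => H.psiTop (x 0)
    | .add => fun x => (fun a b : WithTop Γ => a + b) (x 0) (x 1)
  RelMap {_} r := match r with
    | .P => fun x => ∃ γ ∈ P, x 0 = (γ : WithTop Γ)
    | .lt => fun x => (fun a b : WithTop Γ => a < b) (x 0) (x 1)

/-- The conditions on the scalar operations that are needed for an axiom. -/
def ScalarOK (H : HCouple Γ) (s : k → Γ → Γ) : Ax k → Prop
  | .smul_add c => ∀ x y, s c (x + y) = s c x + s c y
  | .add_smul c d => ∀ x, s (c + d) x = s c x + s d x
  | .mul_smul c d => ∀ x, s (c * d) x = s c (s d x)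
  | .one_smul => ∀ x, s 1 x = x
  | .smul_lt_smul c => 0 < c → ∀ x y, x < y → s c x < s c y
  | .psi_smul c => c ≠ 0 → ∀ x, H.psiExt (s c x) = H.psiExt x
  | _ => True

/-- With arbitrary scalar operations, `ScalarOK` isolates what each axiom asks of them. This serves
both genuine triples and the compactness argument, where only a countable subfield acts as it
should. -/
theorem holds_preCarrier {H : HCouple Γ} (hH : H.IsClosed) {P : Set Γ} (hP : H.IsHCut P)
    {s : k → Γ → Γ} (a : Ax k) (ha : H.ScalarOK s a) : a.Holds (H.PreCarrier P s) := by
  cases a with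
  | add_comm =>
    change ∀ x y : WithTop Γ, x + y = y + x
    exact add_comm
  | add_assoc =>
    change ∀ x y z : WithTop Γ, x + y + z = x + (y + z)
    exact add_assoc
  | zero_add =>
    change ∀ x : WithTop Γ, ((0 : Γ) : WithTop Γ) + x = x
    exact zero_add
  | add_neg =>
    change ∀ x : WithTop Γ, ¬ x = ⊤ → x + WithTop.map (fun γ : Γ => -γ) x = ((0 : Γ) : WithTop Γ)
    rintro (_ | x) hx
    · exact absurd rfl hx
    · exact congrArg _ (add_neg_cancel x)
  | add_inf =>
    change ∀ x : WithTop Γ, x + ⊤ = ⊤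
    exact fun x => WithTop.add_top x
  | add_ne_inf =>
    change ∀ x y : WithTop Γ, ¬ x = ⊤ → ¬ y = ⊤ → ¬ x + y = ⊤
    intro x y hx hy h
    rcases WithTop.add_eq_top.1 h with h | h
    · exact hx h
    · exact hy h
  | zero_ne_inf =>
    change ¬ ((0 : Γ) : WithTop Γ) = ⊤
    exact WithTop.coe_ne_top
  | neg_ne_inf =>
    change ∀ x : WithTop Γ, ¬ x = ⊤ → ¬ WithTop.map (fun γ : Γ => -γ) x = ⊤
    exact fun x hx h => hx (WithTop.map_eq_top_iff.1 h)
  | neg_inf => rfl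
  | lt_irrefl =>
    change ∀ x : WithTop Γ, ¬ x < x
    exact lt_irrefl
  | lt_trans =>
    change ∀ x y z : WithTop Γ, x < y → y < z → x < z
    exact fun _ _ _ => lt_trans
  | lt_total =>
    change ∀ x y : WithTop Γ, x < y ∨ x = y ∨ y < x
    exact lt_trichotomy
  | lt_inf =>
    change ∀ x : WithTop Γ, ¬ x = ⊤ → x < ⊤
    exact fun x => lt_top_iff_ne_top.2
  | add_lt_add =>
    change ∀ x y z : WithTop Γ, ¬ z = ⊤ → x < y → z + x < z + y
    exact fun x y z hz h => WithTop.add_lt_add_left hz h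
  | smul_add c =>
    change ∀ x y : WithTop Γ, WithTop.map (s c) (x + y) = WithTop.map (s c) x + WithTop.map (s c) y
    rintro (_ | x) (_ | y)
    · rfl
    · rfl
    · rfl
    · exact congrArg _ (ha x y)
  | add_smul c d =>
    change ∀ x : WithTop Γ, WithTop.map (s (c + d)) x = WithTop.map (s c) x + WithTop.map (s d) x
    rintro (_ | x)
    · rfl
    · exact congrArg _ (ha x)
  | mul_smul c d =>
    change ∀ x : WithTop Γ, WithTop.map (s (c * d)) x = WithTop.map (s c) (WithTop.map (s d) x)
    rintro (_ | x)
    · rfl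
    · exact congrArg _ (ha x)
  | one_smul =>
    change ∀ x : WithTop Γ, WithTop.map (s 1) x = x
    rintro (_ | x)
    · rfl
    · exact congrArg _ (ha x)
  | smul_inf c => rfl
  | smul_ne_inf c =>
    change ∀ x : WithTop Γ, ¬ x = ⊤ → ¬ WithTop.map (s c) x = ⊤
    exact fun x hx h => hx (WithTop.map_eq_top_iff.1 h)
  | smul_lt_smul c =>
    change 0 < c → ∀ x y : WithTop Γ, x < y → WithTop.map (s c) x < WithTop.map (s c) y
    intro hc x y h
    lift x to Γ using h.ne_top
    induction y with
    | top => exact WithTop.coe_lt_top _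
    | coe y => exact WithTop.coe_lt_coe.2 (ha hc x y (WithTop.coe_lt_coe.1 h))
  | psi_smul c =>
    change c ≠ 0 → ∀ x : WithTop Γ, H.psiTop (WithTop.map (s c) x) = H.psiTop x
    rintro hc (_ | x)
    · rfl
    · exact ha hc x
  | psi_zero =>
    exact H.psiExt_zero
  | psi_inf => rfl
  | psi_ne_inf =>
    change ∀ x : WithTop Γ, ¬ x = (0 : Γ) → ¬ x = ⊤ → ¬ H.psiTop x = ⊤
    intro x h0 hx
    lift x to Γ using hx
    rw [WithTop.coe_inj] at h0
    simp [H.psiExt_of_ne h0]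
  | psi_add =>
    change ∀ x y : WithTop Γ, H.psiTop (x + y) < H.psiTop x → ¬ H.psiTop (x + y) < H.psiTop y
    intro x y h1 h2
    induction x with
    | top => simp at h1
    | coe x =>
    induction y with
    | top => simp at h2
    | coe y =>
    rw [← WithTop.coe_add, psiTop_coe, psiTop_coe] at h1 h2
    by_cases hxy : x + y = 0
    · simp [hxy] at h1
    by_cases hx : x = 0
    · simp [hx] at h2
    by_cases hy : y = 0
    · simp [hy] at h1
    rw [H.psiExt_of_ne hxy, H.psiExt_of_ne hx, WithTop.coe_lt_coe] at h1
    rw [H.psiExt_of_ne hxy, H.psiExt_of_ne hy, WithTop.coe_lt_coe] at h2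
    exact (lt_min h1 h2).not_ge (H.ac1 ⟨x, hx⟩ ⟨y, hy⟩ hxy)
  | psi_lt =>
    change ∀ x y : WithTop Γ, (0 : Γ) < x → ¬ y = (0 : Γ) → ¬ y = ⊤ →
      H.psiTop y < x + H.psiTop x
    intro x y hx hy0 hy
    lift y to Γ using hy
    rw [WithTop.coe_inj] at hy0
    rw [psiTop_coe, H.psiExt_of_ne hy0]
    induction x with
    | top => simp
    | coe x =>
    rw [WithTop.coe_lt_coe] at hx
    rw [psiTop_coe, H.psiExt_of_ne hx.ne', ← WithTop.coe_add, WithTop.coe_lt_coe]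
    exact H.ac3 ⟨x, hx.ne'⟩ ⟨y, hy0⟩ hx
  | psi_anti =>
    change ∀ x y : WithTop Γ, (0 : Γ) < x → x < y → ¬ y = ⊤ → ¬ H.psiTop x < H.psiTop y
    intro x y hx hxy hy
    lift y to Γ using hy
    lift x to Γ using hxy.ne_top
    rw [WithTop.coe_lt_coe] at hx hxy
    have hy := hx.trans hxy
    rw [psiTop_coe, psiTop_coe, H.psiExt_of_ne hx.ne', H.psiExt_of_ne hy.ne', WithTop.coe_lt_coe,
      not_lt]
    exact H.hc ⟨x, hx.ne'⟩ ⟨y, hy.ne'⟩ hx hxy.le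
  | not_P_inf =>
    change ¬ ∃ γ ∈ P, (⊤ : WithTop Γ) = γ
    rintro ⟨γ, -, h⟩
    exact WithTop.top_ne_coe h
  | P_lower =>
    change ∀ x y : WithTop Γ, (∃ γ ∈ P, y = (γ : WithTop Γ)) → x < y →
      ∃ γ ∈ P, x = (γ : WithTop Γ)
    rintro x _ ⟨γ, hγ, rfl⟩ h
    lift x to Γ using h.ne_top
    exact ⟨x, hP.lower (WithTop.coe_lt_coe.1 h).le hγ, rfl⟩
  | P_psi =>
    change ∀ x : WithTop Γ, ¬ x = (0 : Γ) → ¬ x = ⊤ → ∃ γ ∈ P, H.psiTop x = (γ : WithTop Γ)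
    intro x h0 hx
    lift x to Γ using hx
    rw [WithTop.coe_inj] at h0
    exact ⟨_, hP.psi_subset ⟨⟨x, h0⟩, rfl⟩, H.psiExt_of_ne h0⟩
  | P_lt =>
    change ∀ x y : WithTop Γ, (0 : Γ) < x → (∃ γ ∈ P, y = (γ : WithTop Γ)) → y < x + H.psiTop x
    rintro x _ hx ⟨γ, hγ, rfl⟩
    induction x with
    | top => simp
    | coe x =>
    rw [WithTop.coe_lt_coe] at hx
    rw [psiTop_coe, H.psiExt_of_ne hx.ne', ← WithTop.coe_add, WithTop.coe_lt_coe]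
    exact hP.lt_deriv γ hγ ⟨x, hx.ne'⟩ hx
  | psi_lower =>
    change ∀ x y : WithTop Γ, ¬ x = (0 : Γ) → ¬ x = ⊤ → y < H.psiTop x →
      ∃ z : WithTop Γ, ¬ z = (0 : Γ) ∧ ¬ z = ⊤ ∧ H.psiTop z = y
    intro x y h0 hx hy
    lift x to Γ using hx
    lift y to Γ using hy.ne_top
    rw [WithTop.coe_inj] at h0
    rw [psiTop_coe, H.psiExt_of_ne h0, WithTop.coe_lt_coe] at hy
    obtain ⟨⟨z, hz⟩, h⟩ := hH.psi_lower hy.le ⟨_, rfl⟩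
    refine ⟨z, by rwa [WithTop.coe_inj], WithTop.coe_ne_top, ?_⟩
    rw [psiTop_coe, H.psiExt_of_ne hz, h]
  | integ =>
    change ∀ x : WithTop Γ, ¬ x = ⊤ →
      ∃ z : WithTop Γ, ¬ z = (0 : Γ) ∧ ¬ z = ⊤ ∧ z + H.psiTop z = x
    intro x hx
    lift x to Γ using hx
    obtain ⟨⟨z, hz⟩, h⟩ := hH.integration x
    refine ⟨z, by rwa [WithTop.coe_inj], WithTop.coe_ne_top, ?_⟩
    rw [psiTop_coe, H.psiExt_of_ne hz, ← WithTop.coe_add, ← h]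
    rfl

end PreCarrier

end HCouple

namespace HTriple

variable {k : Type u} [Field k] [LinearOrder k] [IsStrictOrderedRing k]
  {Γ : Type w} [AddCommGroup Γ] [LinearOrder Γ] [IsOrderedAddMonoid Γ]
  [Module k Γ] [PosSMulStrictMono k Γ]

theorem psiExt_smul (H : HTriple k Γ) {c : k} (hc : c ≠ 0) (x : Γ) :
    H.psiExt (c • x) = H.psiExt x := by
  by_cases hx : x = 0
  · simp [hx]
  · have h := smul_ne_zero hc hx
    rw [H.psiExt_of_ne hx, H.psiExt_of_ne h, H.psi_smul c hc ⟨x, hx⟩ h]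

theorem holds_carrier (H : HTriple k Γ) (hH : H.toHCouple.IsClosed) (a : Ax k) :
    a.Holds H.Carrier := by
  refine HCouple.holds_preCarrier (s := fun (c : k) (x : Γ) => c • x) hH H.isHCut a ?_
  cases a with
  | smul_add c => exact smul_add c
  | add_smul c d => exact add_smul c d
  | mul_smul c d => exact mul_smul c d
  | one_smul => exact one_smul k
  | smul_lt_smul c => exact fun hc x y h => smul_lt_smul_of_pos_left h hc
  | psi_smul c => exact fun hc x => H.psiExt_smul hc x
  | _ => trivial

end HTriple

/-! ### Reconstructing a closed triple from a model of the axioms -/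

namespace HTripleLanguage

section Reconstruction

variable {k : Type u} [Field k] [LinearOrder k] [IsStrictOrderedRing k]
  {M : Type w} [(HTripleLanguage k).Structure M]

variable (k M) in
/-- The elements of a structure other than `∞`. -/
def FinitePart : Type w := {x : M // ¬ x = oInf k}

variable (h : ∀ a : Ax k, a.Holds M)
include h

/-- The group structure on the elements other than `∞` of a model. -/
abbrev addCommGroup : AddCommGroup (FinitePart k M) :=
  have h0 (x : FinitePart k M) : oAdd k (oZero k) x.1 = x.1 := h .zero_add x.1
  have hn (x : FinitePart k M) : oAdd k (oNeg k x.1) x.1 = oZero k :=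
    (h .add_comm _ _).trans (h .add_neg x.1 x.2)
  letI : Add (FinitePart k M) := ⟨fun x y => ⟨oAdd k x.1 y.1, h .add_ne_inf x.1 y.1 x.2 y.2⟩⟩
  letI : Zero (FinitePart k M) := ⟨⟨oZero k, h .zero_ne_inf⟩⟩
  letI : Neg (FinitePart k M) := ⟨fun x => ⟨oNeg k x.1, h .neg_ne_inf x.1 x.2⟩⟩
  { @AddGroup.ofLeftAxioms (FinitePart k M) _ _ _
      (fun x y z => Subtype.ext (h .add_assoc x.1 y.1 z.1))
      (fun x => Subtype.ext (h0 x)) (fun x => Subtype.ext (hn x)) with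
    add_comm := fun x y => Subtype.ext (h .add_comm x.1 y.1) }

open Classical in
/-- The order on the elements other than `∞` of a model. -/
noncomputable abbrev linearOrder : LinearOrder (FinitePart k M) where
  lt x y := rLt k x.1 y.1
  le x y := rLt k x.1 y.1 ∨ x = y
  le_refl x := Or.inr rfl
  le_trans := by
    rintro x y z (hxy | rfl) (hyz | rfl)
    · exact Or.inl (h .lt_trans _ _ _ hxy hyz)
    · exact Or.inl hxy
    · exact Or.inl hyz
    · exact Or.inr rfl
  le_antisymm := by
    rintro x y (hxy | rfl) (hyx | hyx)
    · exact absurd (h .lt_trans _ _ _ hxy hyx) (h .lt_irrefl _)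
    · exact hyx.symm
    · rfl
    · rfl
  lt_iff_le_not_ge := by
    intro x y
    constructor
    · intro hxy
      refine ⟨Or.inl hxy, ?_⟩
      rintro (hyx | rfl)
      · exact h .lt_irrefl _ (h .lt_trans _ _ _ hxy hyx)
      · exact h .lt_irrefl _ hxy
    · rintro ⟨hxy | rfl, hn⟩
      · exact hxy
      · exact absurd (Or.inr rfl) hn
  le_total := by
    intro x y
    rcases h .lt_total x.1 y.1 with h1 | h1 | h1
    · exact Or.inl (Or.inl h1)
    · exact Or.inl (Or.inr (Subtype.ext h1))
    · exact Or.inr (Or.inl h1)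
  toDecidableLE := Classical.decRel _

/-- The elements other than `∞` form a closed triple, and the axioms prescribe all operations at
`∞`, so restoring a top element recovers `M`. Divisibility and invariance under integer multiples
come from the scalars in `k`. -/
theorem exists_closedHTriple :
    ∃ H : ClosedHTriple.{u, w} k, Nonempty (M ≃[HTripleLanguage k] H.triple.Carrier) := by
  let := addCommGroup h
  let := linearOrder h
  have val_add (x y : FinitePart k M) : (x + y).1 = oAdd k x.1 y.1 := rfl
  have val_zero : (0 : FinitePart k M).1 = oZero k := rfl
  have lt_def {x y : FinitePart k M} : x < y ↔ rLt k x.1 y.1 := Iff.rfl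
  have hz {x : FinitePart k M} : x ≠ 0 → ¬ x.1 = oZero k := fun hx h' => hx (Subtype.ext h')
  have hadd (x y z : FinitePart k M) (hxy : x < y) : z + x < z + y :=
    h .add_lt_add x.1 y.1 z.1 z.2 hxy
  have : IsOrderedAddMonoid (FinitePart k M) :=
    { add_le_add_left := fun x y hxy z => by
        rcases hxy.eq_or_lt with rfl | hxy
        · exact le_rfl
        · rw [add_comm x, add_comm y]
          exact (hadd x y z hxy).le }
  let sm (c : k) (x : FinitePart k M) : FinitePart k M := ⟨oSmul c x.1, h (.smul_ne_inf c) x.1 x.2⟩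
  have sm_add (c : k) (x y) : sm c (x + y) = sm c x + sm c y :=
    Subtype.ext (h (.smul_add c) x.1 y.1)
  have add_sm (c d : k) (x) : sm (c + d) x = sm c x + sm d x :=
    Subtype.ext (h (.add_smul c d) x.1)
  let : Module k (FinitePart k M) :=
    { smul := sm
      one_smul := fun x => Subtype.ext (h .one_smul x.1)
      mul_smul := fun c d x => Subtype.ext (h (.mul_smul c d) x.1)
      smul_zero := fun c => by
        have := sm_add c 0 0
        rwa [add_zero, left_eq_add] at this
      smul_add := sm_add
      add_smul := add_sm
      zero_smul := fun x => by
        have := add_sm 0 0 x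
        rwa [add_zero, left_eq_add] at this }
  have val_smul (c : k) (x : FinitePart k M) : (c • x).1 = oSmul c x.1 := rfl
  have : PosSMulStrictMono k (FinitePart k M) :=
    ⟨fun c hc x y hxy => h (.smul_lt_smul c) hc x.1 y.1 hxy⟩
  let psi (x : {x : FinitePart k M // x ≠ 0}) : FinitePart k M :=
    ⟨oPsi k x.1.1, h .psi_ne_inf x.1.1 (hz x.2) x.1.2⟩
  have hsmul (c : k) (hc : c ≠ 0) (x : {x : FinitePart k M // x ≠ 0}) (hx : c • x.1 ≠ 0) :
      psi ⟨c • x.1, hx⟩ = psi x := Subtype.ext (h (.psi_smul c) hc x.1.1)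
  let C : HCouple (FinitePart k M) :=
    { psi := psi
      ac1 := fun x y hxy => by
        by_contra! h1
        obtain ⟨h2, h3⟩ := lt_min_iff.1 h1
        exact h .psi_add x.1.1 y.1.1 h2 h3
      ac2 := fun n hn x hx => by
        have h1 : n • x.1 = (n : k) • x.1 := (Int.cast_smul_eq_zsmul k n x.1).symm
        have h2 := hsmul n (Int.cast_ne_zero.2 hn) x (by rwa [← h1])
        rw [← h2]
        congr 1
        exact Subtype.ext h1
      ac3 := fun x y hx => h .psi_lt x.1.1 y.1.1 hx (hz y.2) y.1.2
      hc := fun x y hx hxy => by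
        rcases hxy.eq_or_lt with h1 | h1
        · rw [Subtype.ext h1]
        · exact not_lt.1 (h .psi_anti x.1.1 y.1.1 hx h1 y.1.2) }
  have hC : C.IsClosed :=
    { divisible := fun n hn x => ⟨(n : k)⁻¹ • x, by
        rw [← Nat.cast_smul_eq_nsmul k, smul_inv_smul₀ (Nat.cast_ne_zero.2 hn)]⟩
      psi_lower := by
        rintro _ y hy ⟨x, rfl⟩
        rcases hy.eq_or_lt with rfl | hy
        · exact ⟨x, rfl⟩
        · obtain ⟨z, h1, h2, h3⟩ := h .psi_lower x.1.1 y.1 (hz x.2) x.1.2 hy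
          exact ⟨⟨⟨z, h2⟩, fun h' => h1 (congrArg Subtype.val h')⟩, Subtype.ext h3⟩
      integration := by
        intro x
        obtain ⟨z, h1, h2, h3⟩ := h .integ x.1 x.2
        exact ⟨⟨⟨z, h2⟩, fun h' => h1 (congrArg Subtype.val h')⟩, Subtype.ext h3⟩ }
  let T : HTriple k (FinitePart k M) :=
    { C with
      psi_smul := hsmul
      P := {x | rP k x.1}
      isHCut :=
        { lower := fun x y hxy hx => by
            rcases hxy.eq_or_lt with rfl | hxy
            · exact hx
            · exact h .P_lower y.1 x.1 hx hxy
          psi_subset := by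
            rintro _ ⟨x, rfl⟩
            exact h .P_psi x.1.1 (hz x.2) x.1.2
          lt_deriv := fun p hp x hx => h .P_lt x.1.1 p.1 hx hp } }
  let H : ClosedHTriple.{u, w} k := { Γ := FinitePart k M, triple := T, closed := hC }
  let g (x : WithTop (FinitePart k M)) : M := WithTop.recTopCoe (oInf k) Subtype.val x
  have g_top : g ⊤ = oInf k := rfl
  have g_coe (x : FinitePart k M) : g x = x.1 := rfl
  have inf_add (x : M) : oAdd k (oInf k) x = oInf k := (h .add_comm _ _).trans (h .add_inf x)
  have hg : Function.Bijective g := by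
    constructor
    · rintro (_ | x) (_ | y) hxy
      · rfl
      · exact absurd hxy.symm y.2
      · exact absurd hxy x.2
      · exact congrArg _ (Subtype.ext hxy)
    · intro x
      by_cases hx : x = oInf k
      · exact ⟨⊤, hx.symm⟩
      · exact ⟨WithTop.some ⟨x, hx⟩, rfl⟩
  have g_lt (a b : WithTop (FinitePart k M)) : rLt k (g a) (g b) ↔ a < b := by
    induction a with
    | top =>
      refine iff_of_false (fun hx => ?_) not_top_lt
      induction b with
      | top => exact h .lt_irrefl _ hx
      | coe z => exact h .lt_irrefl _ (h .lt_trans _ _ _ hx (h .lt_inf _ z.2))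
    | coe y =>
      induction b with
      | top => exact iff_of_true (h .lt_inf _ y.2) (WithTop.coe_lt_top y)
      | coe z => exact (WithTop.coe_lt_coe (a := z) (b := y)).symm
  refine ⟨H, ⟨Language.Equiv.symm (M := H.triple.Carrier)
    ⟨_root_.Equiv.ofBijective g hg, ?_, ?_⟩⟩⟩
  · intro n f x
    change g _ = _
    cases f with
    | zero =>
      change oZero k = _
      rw [oZero]
      congr 1; ext i; exact i.elim0
    | infty =>
      change oInf k = _
      rw [oInf]
      congr 1; ext i; exact i.elim0
    | neg =>
      trans oNeg k (g (x 0))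
      · change g (WithTop.map _ (x 0)) = _
        rcases x 0 with _ | y
        · exact (h .neg_inf).symm
        · rfl
      · rw [oNeg]
        congr 1; ext i; fin_cases i; rfl
    | smul c =>
      trans oSmul c (g (x 0))
      · change g (WithTop.map _ (x 0)) = _
        rcases x 0 with _ | y
        · exact (h (.smul_inf c)).symm
        · rfl
      · rw [oSmul]
        congr 1; ext i; fin_cases i; rfl
    | psi =>
      trans oPsi k (g (x 0))
      · change g (C.psiTop (x 0)) = _
        rcases x 0 with _ | y
        · exact (h .psi_inf).symm
        · change g (C.psiExt y) = oPsi k y.1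
          by_cases hy : y = 0
          · rw [hy, C.psiExt_zero]
            exact (h .psi_zero).symm
          · rw [C.psiExt_of_ne hy]
            rfl
      · rw [oPsi]
        congr 1; ext i; fin_cases i; rfl
    | add =>
      trans oAdd k (g (x 0)) (g (x 1))
      · change g ((show WithTop (FinitePart k M) from x 0) + (show WithTop (FinitePart k M) from x 1)) = _
        rcases x 0 with _ | y
        · exact (inf_add _).symm
        rcases x 1 with _ | z
        · exact (h .add_inf _).symm
        · rfl
      · rw [oAdd]
        congr 1; ext i; fin_cases i <;> rfl
  · intro n r x
    cases r with
    | P =>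
      trans rP k (g (x 0))
      · rw [rP]
        exact iff_of_eq (by congr 1; ext i; fin_cases i; rfl)
      · change _ ↔ ∃ γ : FinitePart k M, rP k γ.1 ∧ x 0 = (γ : WithTop (FinitePart k M))
        constructor
        · intro hx
          rcases hx0 : x 0 with _ | y
          · rw [hx0] at hx
            exact absurd hx (h .not_P_inf)
          · rw [hx0] at hx
            exact ⟨y, hx, rfl⟩
        · rintro ⟨γ, hγ, hx⟩
          rw [hx]
          exact hγ
    | lt =>
      trans rLt k (g (x 0)) (g (x 1))
      · rw [rLt]
        exact iff_of_eq (by congr 1; ext i; fin_cases i <;> rfl)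
      · exact g_lt (x 0) (x 1)

end Reconstruction

end HTripleLanguage

/-! ### Elementary embeddings and ultraproducts -/

namespace ClosedHTriple

variable {k : Type u} [Field k] [LinearOrder k] [IsStrictOrderedRing k]

/-- The underlying structure of a closed `H`-triple. -/
abbrev Str (N : ClosedHTriple.{u, w} k) : Type w := N.triple.Carrier

/-- The inclusion of the underlying ordered vector space. -/
def fin (N : ClosedHTriple.{u, w} k) (x : N.Γ) : N.Str := (x : WithTop N.Γ)

section Ops

variable (N : ClosedHTriple.{u, w} k) {x y : N.Γ}

theorem fin_inj : N.fin x = N.fin y ↔ x = y := WithTop.coe_inj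

theorem fin_ne_inf : N.fin x ≠ oInf k := WithTop.coe_ne_top

theorem eq_inf_or_eq_fin (z : N.Str) : z = oInf k ∨ ∃ x, z = N.fin x := by
  rcases z with _ | x
  · exact Or.inl rfl
  · exact Or.inr ⟨x, rfl⟩

theorem oAdd_fin : oAdd k (N.fin x) (N.fin y) = N.fin (x + y) := rfl

theorem oSmul_fin (c : k) : oSmul c (N.fin x) = N.fin (c • x) := rfl

theorem oPsi_fin (hx : x ≠ 0) : oPsi k (N.fin x) = N.fin (N.triple.ps x) := by
  change N.triple.toHCouple.psiExt x = _
  rw [N.triple.toHCouple.psiExt_of_ne hx, HTriple.ps_of_ne _ hx]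
  rfl

theorem rLt_fin : rLt k (N.fin x) (N.fin y) ↔ x < y := WithTop.coe_lt_coe

theorem rP_fin : rP k (N.fin x) ↔ x ∈ N.triple.P := by
  constructor
  · rintro ⟨y, hy, h⟩
    rwa [WithTop.coe_inj.1 h]
  · exact fun h => ⟨x, h, rfl⟩

end Ops

variable {N N' : ClosedHTriple.{u, w} k}

section Elementary

variable (E : N.Str ↪ₑ[HTripleLanguage k] N'.Str)

theorem map_oInf : E (oInf k) = oInf k := by
  have h := E.map_formula (Term.equal (.var 0) tInf) ![oInf k]
  simp only [Formula.realize_equal, Term.realize_var, realize_tInf] at h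
  exact h.2 rfl

theorem map_oAdd (x y : N.Str) : E (oAdd k x y) = oAdd k (E x) (E y) := by
  have h := E.map_formula (Term.equal (.var 0) (tAdd (.var 1) (.var 2))) ![oAdd k x y, x, y]
  simp only [Formula.realize_equal, Term.realize_var, realize_tAdd] at h
  exact h.2 rfl

theorem map_oSmul (c : k) (x : N.Str) : E (oSmul c x) = oSmul c (E x) := by
  have h := E.map_formula (Term.equal (.var 0) (tSmul c (.var 1))) ![oSmul c x, x]
  simp only [Formula.realize_equal, Term.realize_var, realize_tSmul] at h
  exact h.2 rfl

theorem map_oPsi (x : N.Str) : E (oPsi k x) = oPsi k (E x) := by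
  have h := E.map_formula (Term.equal (.var 0) (tPsi (.var 1))) ![oPsi k x, x]
  simp only [Formula.realize_equal, Term.realize_var, realize_tPsi] at h
  exact h.2 rfl

theorem map_rLt (x y : N.Str) : rLt k (E x) (E y) ↔ rLt k x y := by
  have h := E.map_formula (fLt (.var (.inl 0)) (.var (.inl 1))) ![x, y]
  simp only [Formula.Realize, realize_fLt, Term.realize_var, Sum.elim_inl] at h
  exact h

theorem map_rP (x : N.Str) : rP k (E x) ↔ rP k x := by
  have h := E.map_formula (fP (.var (.inl 0))) ![x]
  simp only [Formula.Realize, realize_fP, Term.realize_var, Sum.elim_inl] at h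
  exact h

/-- The linear map underlying an elementary embedding. -/
theorem exists_linearMap : ∃ e : N.Γ →ₗ[k] N'.Γ, (∀ x, E (N.fin x) = N'.fin (e x)) ∧
    (∀ x, 0 < e x ↔ 0 < x) ∧ (∀ x, e x ∈ N'.triple.P ↔ x ∈ N.triple.P) ∧
    ∀ x, N'.triple.ps (e x) = e (N.triple.ps x) := by
  have hex (x : N.Γ) : ∃ x' : N'.Γ, E (N.fin x) = N'.fin x' := by
    refine (N'.eq_inf_or_eq_fin (E (N.fin x))).resolve_left (fun h => ?_)
    rw [← map_oInf E] at h
    exact N.fin_ne_inf (E.injective h)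
  choose e he using hex
  have hadd (x y) : e (x + y) = e x + e y := by
    rw [← fin_inj, ← he, ← oAdd_fin, ← oAdd_fin, map_oAdd, he, he]
  have hsmul (c : k) (x) : e (c • x) = c • e x := by
    rw [← fin_inj, ← he, ← oSmul_fin, ← oSmul_fin, map_oSmul, he]
  let f : N.Γ →ₗ[k] N'.Γ := { toFun := e, map_add' := hadd, map_smul' := hsmul }
  have he0 : e 0 = 0 := f.map_zero
  have hlt (x y) : e x < e y ↔ x < y := by
    rw [← rLt_fin, ← rLt_fin, ← he, ← he, map_rLt]
  refine ⟨f, he, fun x => ?_, fun x => ?_, fun x => ?_⟩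
  · change 0 < e x ↔ _
    rw [← hlt 0 x, he0]
  · change e x ∈ _ ↔ _
    rw [← rP_fin, ← rP_fin, ← he, map_rP]
  · change N'.triple.ps (e x) = e (N.triple.ps x)
    by_cases hx : x = 0
    · simp [hx, he0]
    · have hx' : e x ≠ 0 := by
        rw [← he0]
        intro h
        apply hx
        have h1 := hlt x 0
        have h2 := hlt 0 x
        grind
      rw [← fin_inj, ← oPsi_fin _ hx', ← he, ← he, ← oPsi_fin _ hx, map_oPsi]

end Elementary

section Ultraproduct

variable {I : Type w} (U : Ultrafilter I) (N : I → ClosedHTriple.{u, w} k)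

/-- Ultraproducts of closed `H`-triples. -/
theorem exists_ultraproduct : ∃ (N' : ClosedHTriple.{u, w} k) (Q : (∀ i, (N i).Str) → N'.Str)
    (q : (∀ i, (N i).Γ) → N'.Γ),
    (∀ {β : Type} (φ : (HTripleLanguage k).Formula β) (x : β → ∀ i, (N i).Str),
      φ.Realize (fun b => Q (x b)) ↔ ∀ᶠ i in U, φ.Realize fun b => x b i) ∧
    (∀ x, Q (fun i => (N i).fin (x i)) = N'.fin (q x)) ∧
    (∀ x y, q (x + y) = q x + q y) ∧ (∀ (c : k) x, q (c • x) = c • q x) ∧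
    (∀ x y, q x = q y ↔ ∀ᶠ i in U, x i = y i) ∧
    (∀ x y, q x < q y ↔ ∀ᶠ i in U, x i < y i) ∧
    (∀ x, q x ∈ N'.triple.P ↔ ∀ᶠ i in U, x i ∈ (N i).triple.P) ∧
    (∀ x, N'.triple.ps (q x) = q fun i => (N i).triple.ps (x i)) := by
  have hne : ∀ i, Nonempty (N i).Str := fun i => ⟨(N i).fin 0⟩
  -- By Łoś's theorem the ultraproduct satisfies the axioms, so it is a closed triple up to
  -- isomorphism.
  have hax (a : Ax k) : a.Holds ((U : Filter I).Product fun i => (N i).Str) := by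
    rw [← Ax.realize_sentence, Ultraproduct.sentence_realize]
    exact Filter.Eventually.of_forall fun i =>
      (Ax.realize_sentence _ a).2 ((N i).triple.holds_carrier (N i).closed a)
  obtain ⟨N', ⟨F⟩⟩ := exists_closedHTriple hax
  let Q : (∀ i, (N i).Str) → N'.Str := fun x => F (x : (U : Filter I).Product fun i => (N i).Str)
  have hQ {β : Type} (φ : (HTripleLanguage k).Formula β) (x : β → ∀ i, (N i).Str) :
      φ.Realize (fun b => Q (x b)) ↔ ∀ᶠ i in U, φ.Realize fun b => x b i := by
    rw [← Ultraproduct.realize_formula_cast]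
    exact StrongHomClass.realize_formula F φ
  have Qeq (x y) : Q x = Q y ↔ ∀ᶠ i in U, x i = y i := by
    have h := hQ (Term.equal (.var 0) (.var 1)) ![x, y]
    simp only [Formula.realize_equal, Term.realize_var] at h
    exact h
  have Qlt (x y) : rLt k (Q x) (Q y) ↔ ∀ᶠ i in U, rLt k (x i) (y i) := by
    have h := hQ (fLt (.var (.inl 0)) (.var (.inl 1))) ![x, y]
    simp only [Formula.Realize, realize_fLt, Term.realize_var, Sum.elim_inl] at h
    exact h
  have QP (x) : rP k (Q x) ↔ ∀ᶠ i in U, rP k (x i) := by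
    have h := hQ (fP (.var (.inl 0))) ![x]
    simp only [Formula.Realize, realize_fP, Term.realize_var, Sum.elim_inl] at h
    exact h
  have Qinf (x) : Q x = oInf k ↔ ∀ᶠ i in U, x i = oInf k := by
    have h := hQ (Term.equal (.var 0) tInf) ![x]
    simp only [Formula.realize_equal, Term.realize_var, realize_tInf] at h
    exact h
  have Qadd (x y) : Q (fun i => oAdd k (x i) (y i)) = oAdd k (Q x) (Q y) := by
    have h := hQ (Term.equal (.var 0) (tAdd (.var 1) (.var 2)))
      ![fun i => oAdd k (x i) (y i), x, y]
    simp only [Formula.realize_equal, Term.realize_var, realize_tAdd] at h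
    exact h.2 (Filter.Eventually.of_forall fun _ => rfl)
  have Qsmul (c : k) (x) : Q (fun i => oSmul c (x i)) = oSmul c (Q x) := by
    have h := hQ (Term.equal (.var 0) (tSmul c (.var 1))) ![fun i => oSmul c (x i), x]
    simp only [Formula.realize_equal, Term.realize_var, realize_tSmul] at h
    exact h.2 (Filter.Eventually.of_forall fun _ => rfl)
  have Qpsi (x) : Q (fun i => oPsi k (x i)) = oPsi k (Q x) := by
    have h := hQ (Term.equal (.var 0) (tPsi (.var 1))) ![fun i => oPsi k (x i), x]
    simp only [Formula.realize_equal, Term.realize_var, realize_tPsi] at h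
    exact h.2 (Filter.Eventually.of_forall fun _ => rfl)
  have hex (x : ∀ i, (N i).Γ) : ∃ x' : N'.Γ, Q (fun i => (N i).fin (x i)) = N'.fin x' := by
    refine (N'.eq_inf_or_eq_fin _).resolve_left (fun h => ?_)
    obtain ⟨i, hi⟩ := ((Qinf _).1 h).exists
    exact (N i).fin_ne_inf hi
  choose q hq using hex
  have qadd (x y) : q (x + y) = q x + q y := by
    rw [← fin_inj, ← oAdd_fin, ← hq, ← hq, ← hq, ← Qadd]; rfl
  have qsmul (c : k) (x) : q (c • x) = c • q x := by
    rw [← fin_inj, ← oSmul_fin, ← hq, ← hq, ← Qsmul]; rfl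
  have qeq (x y) : q x = q y ↔ ∀ᶠ i in U, x i = y i := by
    rw [← fin_inj, ← hq, ← hq, Qeq]
    simp only [fin_inj]
  have q0 : q 0 = 0 := by
    have := qadd 0 0
    rwa [add_zero, left_eq_add] at this
  refine ⟨N', Q, q, hQ, hq, qadd, qsmul, qeq, fun x y => ?_, fun x => ?_, fun x => ?_⟩
  · rw [← rLt_fin, ← hq, ← hq, Qlt]
    simp only [rLt_fin]
  · rw [← rP_fin, ← hq, QP]
    simp only [rP_fin]
  · by_cases hx : q x = 0
    · rw [hx, HTriple.ps_zero, ← q0, qeq]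
      rw [← q0, qeq] at hx
      filter_upwards [hx] with i hi
      simp [hi]
    · rw [← fin_inj, ← oPsi_fin _ hx, ← hq, ← hq, ← Qpsi, Qeq]
      rw [← q0, qeq, ← Ultrafilter.eventually_not] at hx
      filter_upwards [hx] with i hi
      exact oPsi_fin _ hi

end Ultraproduct

end ClosedHTriple

open FirstOrder FirstOrder.Language HTripleLanguage HTriple Filter

/-! ### Elementary extensions and transport of relations -/

namespace ClosedHTriple

variable {k : Type u} [Field k] [LinearOrder k] [IsStrictOrderedRing k]

/-- An elementary extension together with the underlying linear map. -/
structure Ext (N N' : ClosedHTriple.{u, w} k) where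
  E : N.Str ↪ₑ[HTripleLanguage k] N'.Str
  e : N.Γ →ₗ[k] N'.Γ
  map_fin : ∀ x, E (N.fin x) = N'.fin (e x)
  pos_iff : ∀ x, 0 < e x ↔ 0 < x
  mem_P_iff : ∀ x, e x ∈ N'.triple.P ↔ x ∈ N.triple.P
  ps_map : ∀ x, N'.triple.ps (e x) = e (N.triple.ps x)

namespace Ext

variable {N N' N'' : ClosedHTriple.{u, w} k}

/-- The extension given by an elementary embedding. -/
noncomputable def ofElementary (E : N.Str ↪ₑ[HTripleLanguage k] N'.Str) : Ext N N' :=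
  ⟨E, (exists_linearMap E).choose, (exists_linearMap E).choose_spec.1,
    (exists_linearMap E).choose_spec.2.1, (exists_linearMap E).choose_spec.2.2.1,
    (exists_linearMap E).choose_spec.2.2.2⟩

variable (N) in
/-- The identity extension. -/
def refl : Ext N N where
  E := ElementaryEmbedding.refl _ _
  e := LinearMap.id
  map_fin _ := rfl
  pos_iff _ := Iff.rfl
  mem_P_iff _ := Iff.rfl
  ps_map _ := rfl

/-- Composition of extensions. -/
def comp (Y : Ext N' N'') (X : Ext N N') : Ext N N'' where
  E := Y.E.comp X.E
  e := Y.e.comp X.e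
  map_fin x := by simp [X.map_fin, Y.map_fin]
  pos_iff x := by simp [X.pos_iff, Y.pos_iff]
  mem_P_iff x := by simp [X.mem_P_iff, Y.mem_P_iff]
  ps_map x := by simp [X.ps_map, Y.ps_map]

end Ext

section Push

variable {M N N' N'' : ClosedHTriple.{u, w} k}

/-- The image of a relation in an extension of the second structure. -/
def push (X : Ext N N') (R : Submodule k (M.Γ × N.Γ)) : Submodule k (M.Γ × N'.Γ) :=
  R.map (LinearMap.prodMap LinearMap.id X.e)

variable {R : Submodule k (M.Γ × N.Γ)}

theorem mem_push {X : Ext N N'} {q : M.Γ × N'.Γ} :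
    q ∈ push X R ↔ ∃ p ∈ R, (p.1, X.e p.2) = q := Iff.rfl

theorem mk_mem_push (X : Ext N N') {p : M.Γ × N.Γ} (hp : p ∈ R) : (p.1, X.e p.2) ∈ push X R :=
  ⟨p, hp, rfl⟩

theorem dom_push (X : Ext N N') : dom (push X R) = dom R := by
  ext x
  rw [mem_dom, mem_dom]
  constructor
  · rintro ⟨_, p, hp, h⟩
    have h1 : p.1 = x := (Prod.ext_iff.1 h).1
    exact ⟨p.2, by rw [← h1]; exact hp⟩
  · rintro ⟨x', hx⟩
    exact ⟨_, mk_mem_push X hx⟩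

theorem push_mono (X : Ext N N') {R' : Submodule k (M.Γ × N.Γ)} (h : R ≤ R') :
    push X R ≤ push X R' := Submodule.map_mono h

theorem push_comp (Y : Ext N' N'') (X : Ext N N') : push (Y.comp X) R = push Y (push X R) := by
  ext q
  simp only [mem_push]
  constructor
  · rintro ⟨p, hp, h⟩
    exact ⟨_, ⟨p, hp, rfl⟩, h⟩
  · rintro ⟨_, ⟨p, hp, rfl⟩, h⟩
    exact ⟨p, hp, h⟩

theorem push_refl : push (Ext.refl N) R = R := Submodule.map_id R

theorem isPartialIso_push (X : Ext N N') (hR : IsPartialIso M.triple N.triple R) :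
    IsPartialIso M.triple N'.triple (push X R) where
  pos_iff := by
    rintro _ ⟨p, hp, rfl⟩
    exact (hR.pos_iff p hp).trans (X.pos_iff _).symm
  mem_P_iff := by
    rintro _ ⟨p, hp, rfl⟩
    exact (hR.mem_P_iff p hp).trans (X.mem_P_iff _).symm
  ps_mem := by
    rintro _ ⟨p, hp, rfl⟩
    have := mk_mem_push X (hR.ps_mem p hp)
    rw [← X.ps_map] at this
    exact this

end Push

/-- Realizing finitely satisfiable conditions in an elementary extension. -/
theorem exists_ext_realize (N : ClosedHTriple.{u, w} k) {I : Type w} (F : Filter I) [F.NeBot]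
    (y : I → N.Γ) : ∃ (N' : ClosedHTriple.{u, w} k) (X : Ext N N') (y' : N'.Γ),
      (∀ x, (∀ᶠ i in F, x < y i) → X.e x < y') ∧ (∀ x, (∀ᶠ i in F, y i < x) → y' < X.e x) ∧
      ((∀ᶠ i in F, y i ∈ N.triple.P) → y' ∈ N'.triple.P) ∧
      ∀ x z, (∀ᶠ i in F, N.triple.ps (y i - x) = z) → N'.triple.ps (y' - X.e x) = X.e z := by
  have hU : ∀ {p : I → Prop}, (∀ᶠ i in F, p i) → ∀ᶠ i in Ultrafilter.of F, p i :=
    fun h => h.filter_mono (Ultrafilter.of_le F)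
  -- Take an ultrapower along an ultrafilter refining `F`; the new element is the class of `y`.
  obtain ⟨N', Q, q, hQ, hq, qadd, -, qeq, qlt, qP, qps⟩ :=
    exists_ultraproduct (Ultrafilter.of F) fun _ => N
  let E : N.Str ↪ₑ[HTripleLanguage k] N'.Str := ⟨fun x => Q fun _ => x, fun n φ x => by
    change φ.Realize (fun b => Q fun _ => x b) ↔ _
    rw [hQ, eventually_const]⟩
  let X := Ext.ofElementary E
  have he (x) : X.e x = q fun _ => x := by
    rw [← fin_inj, ← hq]
    exact (X.map_fin x).symm
  refine ⟨N', X, q y, fun x h => ?_, fun x h => ?_, fun h => ?_, fun x z h => ?_⟩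
  · rw [he, qlt]
    exact hU h
  · rw [he, qlt]
    exact hU h
  · rw [qP]
    exact hU h
  · have h1 : q y - X.e x = q fun i => y i - x := by
      rw [he, sub_eq_iff_eq_add, ← qadd]
      congr 1
      ext i
      simp
    rw [h1, qps, he, qeq]
    exact hU h

/-! ### Enlarging a proper domain -/

section Step

variable {M N : ClosedHTriple.{u, w} k} {R : Submodule k (M.Γ × N.Γ)}

/-- `R` extends to a larger domain after an elementary extension of the second structure. -/
def StepExtends (M N : ClosedHTriple.{u, w} k) (R : Submodule k (M.Γ × N.Γ)) : Prop :=
  ∃ (N' : ClosedHTriple.{u, w} k) (X : Ext N N'), Extends M.triple N'.triple (push X R)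

theorem StepExtends.of_extends (h : Extends M.triple N.triple R) : StepExtends M N R :=
  ⟨N, Ext.refl N, by rwa [push_refl]⟩

theorem sameCut_push {N' : ClosedHTriple.{u, w} k} (X : Ext N N') {b : M.Γ} {y : N'.Γ}
    (hb : b ∉ dom R) (h1 : ∀ p ∈ R, p.1 < b → X.e p.2 < y) (h2 : ∀ p ∈ R, b < p.1 → y < X.e p.2) :
    SameCut (push X R) b y := by
  rintro _ ⟨p, hp, rfl⟩
  change (p.1 < b ↔ X.e p.2 < y) ∧ (b < p.1 ↔ y < X.e p.2)
  have hne : p.1 ≠ b := fun h => hb (h ▸ fst_mem_dom hp)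
  have := h1 p hp
  have := h2 p hp
  grind

/-- A gap outside `P` is `z + ps z` with `z > 0`, and `z` lies below every positive element of the
domain; then `ps z` is a gap in `P`. -/
theorem exists_isGap_mem_P (hI : M.triple.Integ (dom R))
    (hA : ∀ x ∈ dom R, M.triple.ps x ∈ dom R) {x : M.Γ} (hx : M.triple.IsGap (dom R) x) :
    ∃ b ∈ M.triple.P, M.triple.IsGap (dom R) b := by
  by_cases hxP : x ∈ M.triple.P
  · exact ⟨x, hxP, hx⟩
  obtain ⟨z, hz0, rfl⟩ := M.triple.exists_add_ps_eq M.closed x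
  rw [M.triple.add_ps_mem_P_iff hz0, not_lt] at hxP
  have hz := lt_of_le_of_ne hxP hz0.symm
  refine ⟨M.triple.ps z, M.triple.ps_mem_P hz0, fun a ha ha0 => ?_, fun a ha ha0 =>
    M.triple.ps_lt_add ha0 hz0⟩
  obtain ⟨w, hw, hw0, h⟩ := hI.exists_ps_lt hA ha ha0
  exact h.trans_le (M.triple.ps_anti_of_pos hz
    (M.triple.lt_of_add_ps_lt hz0 hw0.ne' (hx.2 w hw hw0)).le)

theorem stepExtends_of_isGap (hR : IsPartialIso M.triple N.triple R)
    (hI : M.triple.Integ (dom R)) {x : M.Γ} (hx : M.triple.IsGap (dom R) x) :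
    StepExtends M N R := by
  obtain ⟨b, hbP, hb⟩ := exists_isGap_mem_P hI hR.ps_mem_dom hx
  let I := {x : N.Γ // x ∈ rng R ∧ x ∈ N.triple.P}
  have hmem {q} (hq : q ∈ R) (h0 : q.1 ≠ 0) : N.triple.ps q.2 ∈ rng R ∧
      N.triple.ps q.2 ∈ N.triple.P :=
    ⟨snd_mem_rng (hR.ps_mem q hq), N.triple.ps_mem_P ((hR.eq_zero_iff hq).not.1 h0)⟩
  obtain ⟨z, hz, hz0, -⟩ := hR.exists_integ hI R.zero_mem
  have : Nonempty I := ⟨⟨_, hmem hz hz0⟩⟩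
  -- Climbing through the elements of the range in `P` produces `y` in `P`; it exceeds every
  -- `ps`-value over the range because these have no maximum.
  obtain ⟨N', X, y, h1, -, h3, -⟩ := N.exists_ext_realize (atTop : Filter I) Subtype.val
  refine ⟨N', X, (isPartialIso_push X hR).extends_of_isGap (y := y) ?_ ?_ hbP ?_ ?_⟩
  · rwa [dom_push]
  · rwa [dom_push]
  · exact h3 (Eventually.of_forall fun i => i.2.2)
  · rintro _ ⟨q, hq, rfl⟩ h0
    change N'.triple.ps (X.e q.2) < y
    rw [X.ps_map]
    apply h1
    obtain ⟨w, hw, hw0, h⟩ := hI.exists_ps_lt hR.ps_mem_dom (fst_mem_dom hq) h0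
    obtain ⟨w', hw⟩ := mem_dom.1 hw
    have h' := (hR.lt_iff (hR.ps_mem q hq) (hR.ps_mem _ hw)).1 h
    filter_upwards [eventually_ge_atTop (⟨_, hmem hw hw0.ne'⟩ : I)] with i hi
    exact h'.trans_le hi

/-! ### An element whose differences all have `ps`-values in the domain -/

section Immediate

variable {b : M.Γ}

/-- Lowering `ps b` by `|γ|` stays in `P`, hence gives the value of some `z` in the domain; a
smaller value means that `|z|` exceeds `b`. -/
theorem exists_lt_of_ps_mem (hI : M.triple.Integ (dom R))
    (hP : ∀ x ∈ dom R, x ∈ M.triple.P → ∃ z ∈ dom R, z ≠ 0 ∧ M.triple.ps z = x)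
    (hb0 : b ≠ 0) (hb : M.triple.ps b ∈ dom R) : ∃ u ∈ dom R, b < u := by
  by_contra! h
  obtain ⟨γ, hγ, hγ0, -⟩ := hI 0 (dom R).zero_mem
  have habs {x} (hx : x ∈ dom R) : |x| ∈ dom R := by
    rcases abs_choice x with h | h <;> rw [h]
    · exact hx
    · exact (dom R).neg_mem hx
  have hlt : M.triple.ps b - |γ| < M.triple.ps b := sub_lt_self _ (abs_pos.2 hγ0)
  obtain ⟨z, hz, hz0, hzb⟩ := hP _ ((dom R).sub_mem hb (habs hγ))
    (M.triple.mem_P_of_le hlt.le (M.triple.ps_mem_P hb0))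
  rw [← hzb, ← M.triple.ps_abs z] at hlt
  exact hlt.not_ge (M.triple.ps_anti_of_pos (abs_pos.2 hz0) (h _ (habs hz)))

/-- Of `b - l` and `v - b`, the one with larger `ps` is replaced by an `ε` in the domain of the same
value; the other then keeps the value of `v - l`. If the values agree, the midpoint works. -/
theorem exists_between_ps_eq
    (hP : ∀ x ∈ dom R, x ∈ M.triple.P → ∃ z ∈ dom R, z ≠ 0 ∧ M.triple.ps z = x)
    (hps : ∀ a ∈ dom R, M.triple.ps (b - a) ∈ dom R) {l v : M.Γ} (hl : l ∈ dom R)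
    (hv : v ∈ dom R) (hlb : l < b) (hbv : b < v) :
    ∃ a ∈ dom R, l < a ∧ a < v ∧ M.triple.ps (a - l) = M.triple.ps (b - l) ∧
      M.triple.ps (v - a) = M.triple.ps (v - b) := by
  have hbl := sub_pos.2 hlb
  have hvb := sub_pos.2 hbv
  have hvl : 0 < v - l := sub_pos.2 (hlb.trans hbv)
  have hmin := M.triple.ps_add_pos hbl hvb
  rw [show b - l + (v - b) = v - l by abel] at hmin
  have hex {x} (h1 : M.triple.ps x ∈ dom R) (h2 : 0 < x) :
      ∃ ε ∈ dom R, 0 < ε ∧ M.triple.ps ε = M.triple.ps x := by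
    obtain ⟨z, hz, hz0, h⟩ := hP _ h1 (M.triple.ps_mem_P h2.ne')
    refine ⟨|z|, ?_, abs_pos.2 hz0, by rw [ps_abs, h]⟩
    rcases abs_choice z with h | h <;> rw [h]
    · exact hz
    · exact (dom R).neg_mem hz
  rcases lt_trichotomy (M.triple.ps (b - l)) (M.triple.ps (v - b)) with h | h | h
  · rw [min_eq_left h.le] at hmin
    obtain ⟨ε, hε, hε0, h1⟩ := hex (x := v - b) (by rw [ps_sub_comm]; exact hps v hv) hvb
    have h2 : ε < v - l := by
      rw [lt_iff_ps_lt hε0 hvl (by rw [h1, hmin]; exact h.ne'), h1, hmin]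
      exact h
    refine ⟨v - ε, (dom R).sub_mem hv hε, by grind, by grind, ?_, by rw [sub_sub_cancel, h1]⟩
    rw [← hmin, show v - ε - l = v - l - ε by abel, M.triple.ps_sub_of_lt hvl.ne' hε0.ne']
    rw [h1, hmin]
    exact h
  · rw [h, min_self] at hmin
    have hw := half_smul_add_half_smul (k := k) (v - l)
    have hw0 := half_smul_pos (k := k) hvl
    have hps' : M.triple.ps ((2⁻¹ : k) • (v - l)) = M.triple.ps (v - l) :=
      M.triple.ps_smul (by simp) _
    refine ⟨l + (2⁻¹ : k) • (v - l), (dom R).add_mem hl ((dom R).smul_mem _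
      ((dom R).sub_mem hv hl)), by grind, by grind, ?_, ?_⟩
    · rw [add_sub_cancel_left, hps', hmin, h]
    · rw [show v - (l + (2⁻¹ : k) • (v - l)) = (2⁻¹ : k) • (v - l) by grind, hps', hmin]
  · rw [min_eq_right h.le] at hmin
    obtain ⟨ε, hε, hε0, h1⟩ := hex (hps l hl) hbl
    have h2 : ε < v - l := by
      rw [lt_iff_ps_lt hε0 hvl (by rw [h1, hmin]; exact h.ne'), h1, hmin]
      exact h
    refine ⟨l + ε, (dom R).add_mem hl hε, by grind, by grind, by rw [add_sub_cancel_left, h1], ?_⟩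
    rw [← hmin, show v - (l + ε) = v - l - ε by abel, M.triple.ps_sub_of_lt hvl.ne' hε0.ne']
    rw [h1, hmin]
    exact h

theorem exists_max_below (S : Set M.Γ) (F : Finset M.Γ) (hF : ∀ x ∈ F, x ∈ S) (h : ∃ l ∈ S, l < b) :
    ∃ l ∈ S, l < b ∧ ∀ x ∈ F, x < b → x ≤ l := by
  classical
  induction F using Finset.induction_on with
  | empty => simpa using h
  | insert a F _ ih =>
    obtain ⟨l, hl, hlb, h1⟩ := ih fun x hx => hF x (Finset.mem_insert_of_mem hx)
    by_cases ha : l ≤ a ∧ a < b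
    · refine ⟨a, hF a (Finset.mem_insert_self _ _), ha.2, fun x hx hxb => ?_⟩
      rcases Finset.mem_insert.1 hx with rfl | hx
      · exact le_rfl
      · exact (h1 x hx hxb).trans ha.1
    · refine ⟨l, hl, hlb, fun x hx hxb => ?_⟩
      rcases Finset.mem_insert.1 hx with rfl | hx
      · by_contra! h2
        exact ha ⟨h2.le, hxb⟩
      · exact h1 x hx hxb

theorem exists_min_above (S : Set M.Γ) (F : Finset M.Γ) (hF : ∀ x ∈ F, x ∈ S) (h : ∃ v ∈ S, b < v) :
    ∃ v ∈ S, b < v ∧ ∀ x ∈ F, b < x → v ≤ x := by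
  classical
  obtain ⟨l, hl, hlb, h1⟩ := exists_max_below (b := -b) (-S) (F.image fun x => -x)
    (by simpa using hF) (by
      obtain ⟨v, hv, hbv⟩ := h
      exact ⟨-v, by simpa using hv, by simpa using hbv⟩)
  refine ⟨-l, hl, by grind, fun x hx hbx => ?_⟩
  have := h1 (-x) (Finset.mem_image_of_mem _ hx) (by simpa using hbx)
  grind

/-- Only neighbours `l < b < v` with no point of `F` strictly closer matter: for `x` below `l`, `b -
x` is the sum of the positive elements `b - l` and `l - x`, so its value is the minimum of theirs.
The same holds for `a`, and symmetrically above `v`. -/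
theorem exists_ps_sub_eq
    (hP : ∀ x ∈ dom R, x ∈ M.triple.P → ∃ z ∈ dom R, z ≠ 0 ∧ M.triple.ps z = x)
    (hI : M.triple.Integ (dom R)) (hb : b ∉ dom R)
    (hps : ∀ a ∈ dom R, M.triple.ps (b - a) ∈ dom R) (F : Finset M.Γ) (hF : ∀ x ∈ F, x ∈ dom R) :
    ∃ a ∈ dom R, ∀ x ∈ F, (x < b → x < a) ∧ (b < x → a < x) ∧
      M.triple.ps (a - x) = M.triple.ps (b - x) := by
  have hb0 : b ≠ 0 := fun h => hb (h ▸ (dom R).zero_mem)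
  have hpsb : M.triple.ps b ∈ dom R := by simpa using hps 0 (dom R).zero_mem
  obtain ⟨v, hv, hbv, hvF⟩ := exists_min_above (dom R : Set M.Γ) F hF
    (exists_lt_of_ps_mem hI hP hb0 hpsb)
  obtain ⟨l, hl, hlb, hlF⟩ := exists_max_below (b := b) (dom R : Set M.Γ) F hF (by
    obtain ⟨v, hv, hbv⟩ := exists_lt_of_ps_mem (b := -b) hI hP (neg_ne_zero.2 hb0) (by rwa [ps_neg])
    exact ⟨-v, (dom R).neg_mem hv, by grind⟩)
  obtain ⟨a, ha, hla, hav, h1, h2⟩ := exists_between_ps_eq hP hps hl hv hlb hbv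
  refine ⟨a, ha, fun x hx => ⟨fun h => (hlF x hx h).trans_lt hla,
    fun h => hav.trans_le (hvF x hx h), ?_⟩⟩
  rcases lt_trichotomy x b with h | h | h
  · rcases (hlF x hx h).eq_or_lt with rfl | h3
    · exact h1
    · have h3 := sub_pos.2 h3
      rw [show a - x = (a - l) + (l - x) by abel, show b - x = (b - l) + (l - x) by abel,
        M.triple.ps_add_pos (sub_pos.2 hla) h3, M.triple.ps_add_pos (sub_pos.2 hlb) h3, h1]
  · exact absurd (h ▸ hF x hx) hb
  · rw [M.triple.ps_sub_comm a, M.triple.ps_sub_comm b]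
    rcases (hvF x hx h).eq_or_lt with rfl | h3
    · exact h2
    · have h3 := sub_pos.2 h3
      rw [show x - a = (v - a) + (x - v) by abel, show x - b = (v - b) + (x - v) by abel,
        M.triple.ps_add_pos (sub_pos.2 hav) h3, M.triple.ps_add_pos (sub_pos.2 hbv) h3, h2]

theorem stepExtends_of_ps_sub_mem (hR : IsPartialIso M.triple N.triple R)
    (hI : M.triple.Integ (dom R)) (hG : ∀ x, ¬ M.triple.IsGap (dom R) x)
    (hP : ∀ x ∈ dom R, x ∈ M.triple.P → ∃ z ∈ dom R, z ≠ 0 ∧ M.triple.ps z = x)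
    (hb : b ∉ dom R) (hps : ∀ a ∈ dom R, M.triple.ps (b - a) ∈ dom R) : StepExtends M N R := by
  classical
  -- The order and value conditions on `b` are finitely satisfied within the domain, so their images
  -- are finitely satisfied in `N`.
  have hex (F : Finset R) : ∃ a ∈ R, ∀ p ∈ F, (p.1.1 < b → p.1.1 < a.1) ∧ (b < p.1.1 → a.1 < p.1.1) ∧
      M.triple.ps (a.1 - p.1.1) = M.triple.ps (b - p.1.1) := by
    obtain ⟨a, ha, h⟩ := exists_ps_sub_eq hP hI hb hps (F.image fun p => p.1.1) (by
      intro x hx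
      obtain ⟨p, -, rfl⟩ := Finset.mem_image.1 hx
      exact fst_mem_dom p.2)
    obtain ⟨a', ha⟩ := mem_dom.1 ha
    exact ⟨_, ha, fun p hp => h _ (Finset.mem_image_of_mem _ hp)⟩
  choose a haR ha using hex
  obtain ⟨N', X, y, h1, h2, -, h4⟩ := N.exists_ext_realize (atTop : Filter (Finset R))
    fun F => (a F).2
  have hev (p) (hp : p ∈ R) : ∀ᶠ F : Finset R in atTop, (⟨p, hp⟩ : R) ∈ F :=
    (eventually_ge_atTop {⟨p, hp⟩}).mono fun F hF => Finset.singleton_subset_iff.1 hF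
  refine ⟨N', X, (isPartialIso_push X hR).extends_of_ps_sub_mem (b := b) (y := y) ?_ ?_ ?_ ?_⟩
  · rwa [dom_push]
  · rwa [dom_push]
  · refine sameCut_push X hb (fun p hp h => h1 _ ?_) fun p hp h => h2 _ ?_
    · filter_upwards [hev p hp] with F hF
      exact (hR.lt_iff hp (haR F)).1 ((ha F _ hF).1 h)
    · filter_upwards [hev p hp] with F hF
      exact (hR.lt_iff (haR F) hp).1 ((ha F _ hF).2.1 h)
  · rintro _ ⟨p, hp, rfl⟩
    obtain ⟨z, hz⟩ := mem_dom.1 (hps _ (fst_mem_dom hp))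
    change (M.triple.ps (b - p.1), N'.triple.ps (y - X.e p.2)) ∈ _
    rw [h4 p.2 z]
    · exact mk_mem_push X hz
    · filter_upwards [hev p hp] with F hF
      exact (hR.eq_iff (hR.ps_mem _ (R.sub_mem (haR F) hp)) hz).1 (ha F _ hF).2.2

end Immediate

theorem stepExtends_of_ps_notMem (hR : IsPartialIso M.triple N.triple R)
    (hI : M.triple.Integ (dom R)) (hG : ∀ x, ¬ M.triple.IsGap (dom R) x)
    (hP : ∀ x ∈ dom R, x ∈ M.triple.P → ∃ z ∈ dom R, z ≠ 0 ∧ M.triple.ps z = x)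
    (hN : ∀ x ∉ dom R, ∃ a ∈ dom R, M.triple.ps (x - a) ∉ dom R) (hne : dom R ≠ ⊤) :
    StepExtends M N R := by
  classical
  obtain ⟨x, hx⟩ : ∃ x, x ∉ dom R := by
    by_contra! h
    exact hne (eq_top_iff.2 fun x _ => h x)
  obtain ⟨a, ha, hb⟩ := hN x hx
  set b := x - a
  have hbd : b ∉ dom R := fun h => hb (hR.ps_mem_dom b h)
  obtain ⟨z, hz0, -⟩ := N.triple.exists_add_ps_eq N.closed 0
  have : Nontrivial N.Γ := ⟨z, 0, hz0⟩
  have : DenselyOrdered N.Γ := ⟨fun x y hxy => by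
    have hw := half_smul_add_half_smul (k := k) (y - x)
    have hw0 := half_smul_pos (k := k) (sub_pos.2 hxy)
    exact ⟨x + (2⁻¹ : k) • (y - x), by grind, by grind⟩⟩
  -- Here only the cut must be realized; it is finitely satisfiable because `N.Γ` is dense without
  -- endpoints.
  have hex (F : Finset R) : ∃ y : N.Γ, ∀ p ∈ F, (p.1.1 < b → p.1.2 < y) ∧
      (b < p.1.1 → y < p.1.2) := by
    obtain ⟨y, h1, h2⟩ := Order.exists_between_finsets
      ((F.filter fun p => p.1.1 < b).image fun p => p.1.2)
      ((F.filter fun p => b < p.1.1).image fun p => p.1.2) (by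
        simp only [Finset.mem_image, Finset.mem_filter]
        rintro _ ⟨p, ⟨-, hp⟩, rfl⟩ _ ⟨q, ⟨-, hq⟩, rfl⟩
        exact (hR.lt_iff p.2 q.2).1 (hp.trans hq))
    exact ⟨y, fun p hp => ⟨fun h => h1 _ (Finset.mem_image_of_mem _ (by simp [hp, h])),
      fun h => h2 _ (Finset.mem_image_of_mem _ (by simp [hp, h]))⟩⟩
  choose y hy using hex
  obtain ⟨N', X, y', h1, h2, -, -⟩ := N.exists_ext_realize (atTop : Filter (Finset R)) y
  have hev (p) (hp : p ∈ R) : ∀ᶠ F : Finset R in atTop, (⟨p, hp⟩ : R) ∈ F :=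
    (eventually_ge_atTop {⟨p, hp⟩}).mono fun F hF => Finset.singleton_subset_iff.1 hF
  refine ⟨N', X, (isPartialIso_push X hR).extends_of_ps_notMem (b := b) (y := y')
    ?_ ?_ ?_ ?_ ?_ ?_⟩
  · rwa [dom_push]
  · rwa [dom_push]
  · rwa [dom_push]
  · rwa [dom_push]
  · rwa [dom_push]
  · refine sameCut_push X hbd (fun p hp h => h1 _ ?_) fun p hp h => h2 _ ?_
    · filter_upwards [hev p hp] with F hF
      exact (hy F _ hF).1 h
    · filter_upwards [hev p hp] with F hF
      exact (hy F _ hF).2 h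

/-- The order of the cases matters: each uses the failure of the earlier ones, namely integration in
the domain, then `ps`-values filling its part of `P`, then absence of gaps. -/
theorem stepExtends (hR : IsPartialIso M.triple N.triple R) (hne : dom R ≠ ⊤) :
    StepExtends M N R := by
  by_cases hI : M.triple.Integ (dom R)
  swap
  · simp only [Integ, not_forall, not_exists, not_and] at hI
    obtain ⟨x, hx, h⟩ := hI
    obtain ⟨x', hx⟩ := mem_dom.1 hx
    exact .of_extends (hR.extends_of_add_ps_ne M.closed N.closed hx h)
  by_cases hP : ∀ x ∈ dom R, x ∈ M.triple.P → ∃ z ∈ dom R, z ≠ 0 ∧ M.triple.ps z = x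
  swap
  · simp only [not_forall, not_exists, not_and] at hP
    obtain ⟨x, hx, hxP, h⟩ := hP
    obtain ⟨x', hx⟩ := mem_dom.1 hx
    exact .of_extends (hR.extends_of_ps_ne M.closed N.closed hI hx hxP h)
  by_cases hG : ∃ x, M.triple.IsGap (dom R) x
  · obtain ⟨x, hx⟩ := hG
    exact stepExtends_of_isGap hR hI hx
  rw [not_exists] at hG
  by_cases hN : ∀ x ∉ dom R, ∃ a ∈ dom R, M.triple.ps (x - a) ∉ dom R
  · exact stepExtends_of_ps_notMem hR hI hG hP hN hne
  · push Not at hN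
    obtain ⟨b, hb, h⟩ := hN
    exact stepExtends_of_ps_sub_mem hR hI hG hP hb h

end Step

end ClosedHTriple

/-! ### Extension to the whole structure by Zorn's lemma -/

namespace ClosedHTriple

variable {k : Type u} [Field k] [LinearOrder k] [IsStrictOrderedRing k]
  {M N : ClosedHTriple.{u, w} k} {R : Submodule k (M.Γ × N.Γ)}

/-- `R` extends to a partial isomorphism with domain `D` after an elementary extension of the
second structure. -/
def ExtendsTo (M N : ClosedHTriple.{u, w} k) (R : Submodule k (M.Γ × N.Γ))
    (D : Submodule k M.Γ) : Prop :=
  ∃ (N' : ClosedHTriple.{u, w} k) (X : Ext N N') (R' : Submodule k (M.Γ × N'.Γ)),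
    push X R ≤ R' ∧ IsPartialIso M.triple N'.triple R' ∧ dom R' = D

/-- The extensions witnessing different members of the chain are unrelated, so there is no union to
take. An ultraproduct along an ultrafilter containing all final segments bounds them: a pair belongs
to the limit when it does so almost everywhere. -/
theorem exists_extendsTo_of_isChain (c : Set (Submodule k M.Γ)) (hc : ∀ D ∈ c, ExtendsTo M N R D)
    (hchain : IsChain (· ≤ ·) c) (hne : c.Nonempty) :
    ∃ D, ExtendsTo M N R D ∧ ∀ D' ∈ c, D' ≤ D := by
  choose N' X R' hRR' hR' hdom using fun D : c => hc D.1 D.2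
  have : Nonempty c := hne.to_subtype
  have : IsDirected c (· ≤ ·) := ⟨fun a b => by
    rcases hchain.total a.2 b.2 with h | h
    · exact ⟨b, h, le_rfl⟩
    · exact ⟨a, le_rfl, h⟩⟩
  let U : Ultrafilter c := Ultrafilter.of atTop
  have hU : ∀ D : c, ∀ᶠ D' in U, D ≤ D' := fun D =>
    (eventually_ge_atTop D).filter_mono (Ultrafilter.of_le atTop)
  obtain ⟨L, Q, q, hQ, hq, qadd, qsmul, qeq, qlt, qP, qps⟩ := exists_ultraproduct U N'
  have q0 : q 0 = 0 := by simpa using qadd 0 0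
  let E : N.Str ↪ₑ[HTripleLanguage k] L.Str := ⟨fun x => Q fun D => (X D).E x, fun n φ x => by
    change φ.Realize (fun b => Q fun D => (X D).E (x b)) ↔ _
    rw [hQ]
    refine Iff.trans ?_ (eventually_const (f := (U : Filter c)) (p := φ.Realize x))
    exact eventually_congr (Eventually.of_forall fun D => (X D).E.map_formula φ x)⟩
  let Y := Ext.ofElementary E
  have hY (x) : Y.e x = q fun D => (X D).e x := by
    rw [← fin_inj, ← hq, ← Y.map_fin x]
    change Q _ = _
    simp only [Ext.map_fin]
  let S : Submodule k (M.Γ × L.Γ) :=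
    { carrier := {p | ∃ f, p.2 = q f ∧ ∀ᶠ D in U, (p.1, f D) ∈ R' D}
      zero_mem' := ⟨0, q0.symm, Eventually.of_forall fun D => (R' D).zero_mem⟩
      add_mem' := by
        rintro ⟨m, _⟩ ⟨m', _⟩ ⟨f, rfl, hf⟩ ⟨f', rfl, hf'⟩
        refine ⟨f + f', (qadd f f').symm, ?_⟩
        filter_upwards [hf, hf'] with D h h'
        exact (R' D).add_mem h h'
      smul_mem' := by
        rintro a ⟨m, _⟩ ⟨f, rfl, hf⟩
        refine ⟨a • f, (qsmul a f).symm, ?_⟩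
        filter_upwards [hf] with D h
        exact (R' D).smul_mem a h }
  refine ⟨dom S, ⟨L, Y, S, ?_, ⟨?_, ?_, ?_⟩, rfl⟩, fun D hD m hm => ?_⟩
  · rintro _ ⟨p, hp, rfl⟩
    exact ⟨_, hY p.2, Eventually.of_forall fun D => hRR' D (mk_mem_push (X D) hp)⟩
  · rintro ⟨m, _⟩ ⟨f, rfl, hf⟩
    change 0 < m ↔ 0 < q f
    rw [← q0, qlt, ← eventually_const (f := (U : Filter c)) (p := 0 < m)]
    refine eventually_congr (hf.mono fun D h => (hR' D).pos_iff _ h)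
  · rintro ⟨m, _⟩ ⟨f, rfl, hf⟩
    change m ∈ _ ↔ q f ∈ _
    rw [qP, ← eventually_const (f := (U : Filter c)) (p := m ∈ M.triple.P)]
    refine eventually_congr (hf.mono fun D h => (hR' D).mem_P_iff _ h)
  · rintro ⟨m, _⟩ ⟨f, rfl, hf⟩
    exact ⟨_, qps f, hf.mono fun D h => (hR' D).ps_mem _ h⟩
  -- From `D` onwards `m` always has a partner; the value `0` elsewhere is invisible to the
  -- ultrafilter.
  · have hex (D' : c) : ∃ n, D ≤ D' → (m, n) ∈ R' D' := by
      by_cases h : D ≤ D'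
      · have h1 := h hm
        rw [← hdom D', mem_dom] at h1
        exact h1.imp fun _ h _ => h
      · exact ⟨0, fun h' => absurd h' h⟩
    choose f hf using hex
    exact mem_dom.2 ⟨_, f, rfl, (hU ⟨D, hD⟩).mono fun D' h => hf D' h⟩

/-- Every partial isomorphism extends to an embedding into an elementary extension. -/
theorem extendsTo_top (hR : IsPartialIso M.triple N.triple R) : ExtendsTo M N R ⊤ := by
  obtain ⟨D, -, hD⟩ := zorn_le_nonempty₀ {D | ExtendsTo M N R D}
    (fun c hc hchain y hy => exists_extendsTo_of_isChain c hc hchain ⟨y, hy⟩) (dom R)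
    ⟨N, Ext.refl N, R, by rw [push_refl], hR, rfl⟩
  obtain ⟨N', X, R', hRR', hR', rfl⟩ := hD.prop
  by_contra hne
  have hne : dom R' ≠ ⊤ := fun h => hne ⟨N', X, R', hRR', hR', h⟩
  obtain ⟨N'', Y, h⟩ := stepExtends hR' hne
  obtain ⟨R'', hRR'', hR'', x, hx, hx'⟩ := h
  have hdom := dom_push (R := R') Y
  have hle : dom R' ≤ dom R'' := by
    rw [← hdom]
    exact Submodule.map_mono hRR''
  have h1 : ExtendsTo M N R (dom R'') := by
    refine ⟨N'', Y.comp X, R'', ?_, hR'', rfl⟩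
    rw [push_comp]
    exact (push_mono Y hRR').trans hRR''
  rw [hdom] at hx'
  exact hx' (hD.le_of_ge h1 hle hx)

end ClosedHTriple

/-! ### Partial isomorphisms preserve formulas -/

namespace ClosedHTriple

variable {k : Type u} [Field k] [LinearOrder k] [IsStrictOrderedRing k]

/-- Two elements correspond to each other under a partial isomorphism. -/
def Matches (M N : ClosedHTriple.{u, w} k) (R : Submodule k (M.Γ × N.Γ)) (a : M.Str)
    (b : N.Str) : Prop :=
  (a = oInf k ∧ b = oInf k) ∨ ∃ x y, (x, y) ∈ R ∧ a = M.fin x ∧ b = N.fin y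

namespace Matches

variable {M N N' : ClosedHTriple.{u, w} k} {R : Submodule k (M.Γ × N.Γ)} {a a' : M.Str} {b b' : N.Str}

theorem swap (h : Matches M N R a b) :
    Matches N M (R.map (LinearEquiv.prodComm k M.Γ N.Γ).toLinearMap) b a := by
  rcases h with ⟨rfl, rfl⟩ | ⟨x, y, h, rfl, rfl⟩
  · exact Or.inl ⟨rfl, rfl⟩
  · exact Or.inr ⟨_, _, ⟨_, h, rfl⟩, rfl, rfl⟩

theorem push (X : Ext N N') {R' : Submodule k (M.Γ × N'.Γ)} (hR : push X R ≤ R')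
    (h : Matches M N R a b) : Matches M N' R' a (X.E b) := by
  rcases h with ⟨rfl, rfl⟩ | ⟨x, y, h, rfl, rfl⟩
  · exact Or.inl ⟨rfl, map_oInf _⟩
  · exact Or.inr ⟨_, _, hR (mk_mem_push X h), rfl, X.map_fin _⟩

theorem neg (h : Matches M N R a b) : Matches M N R (oNeg k a) (oNeg k b) := by
  rcases h with ⟨rfl, rfl⟩ | ⟨x, y, h, rfl, rfl⟩
  · exact Or.inl ⟨rfl, rfl⟩
  · exact Or.inr ⟨_, _, R.neg_mem h, rfl, rfl⟩

theorem smul (c : k) (h : Matches M N R a b) : Matches M N R (oSmul c a) (oSmul c b) := by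
  rcases h with ⟨rfl, rfl⟩ | ⟨x, y, h, rfl, rfl⟩
  · exact Or.inl ⟨rfl, rfl⟩
  · exact Or.inr ⟨_, _, R.smul_mem c h, rfl, rfl⟩

theorem add (h : Matches M N R a b) (h' : Matches M N R a' b') :
    Matches M N R (oAdd k a a') (oAdd k b b') := by
  rcases h with ⟨rfl, rfl⟩ | ⟨x, y, h, rfl, rfl⟩
  · exact Or.inl ⟨rfl, rfl⟩
  rcases h' with ⟨rfl, rfl⟩ | ⟨x', y', h', rfl, rfl⟩
  · exact Or.inl ⟨rfl, rfl⟩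
  · exact Or.inr ⟨_, _, R.add_mem h h', rfl, rfl⟩

theorem zero : Matches M N R (oZero k) (oZero k) := Or.inr ⟨_, _, R.zero_mem, rfl, rfl⟩

theorem inf : Matches M N R (oInf k) (oInf k) := Or.inl ⟨rfl, rfl⟩

variable (hR : IsPartialIso M.triple N.triple R)
include hR

theorem psi (h : Matches M N R a b) : Matches M N R (oPsi k a) (oPsi k b) := by
  rcases h with ⟨rfl, rfl⟩ | ⟨x, y, h, rfl, rfl⟩
  · exact Or.inl ⟨rfl, rfl⟩
  by_cases hx : x = 0
  · have hy : y = 0 := (hR.eq_zero_iff h).1 hx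
    subst hx hy
    refine Or.inl ⟨?_, ?_⟩
    · exact M.triple.toHCouple.psiExt_zero
    · exact N.triple.toHCouple.psiExt_zero
  · rw [oPsi_fin _ hx, oPsi_fin _ ((hR.eq_zero_iff h).not.1 hx)]
    exact Or.inr ⟨_, _, hR.ps_mem _ h, rfl, rfl⟩

theorem eq_iff (h : Matches M N R a b) (h' : Matches M N R a' b') : a = a' ↔ b = b' := by
  rcases h with ⟨rfl, rfl⟩ | ⟨x, y, h, rfl, rfl⟩ <;>
    rcases h' with ⟨rfl, rfl⟩ | ⟨x', y', h', rfl, rfl⟩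
  · simp
  · exact iff_of_false (fin_ne_inf _).symm (fin_ne_inf _).symm
  · exact iff_of_false (fin_ne_inf _) (fin_ne_inf _)
  · rw [fin_inj, fin_inj]
    exact hR.eq_iff h h'

theorem lt_iff (h : Matches M N R a b) (h' : Matches M N R a' b') :
    rLt k a a' ↔ rLt k b b' := by
  rcases h with ⟨rfl, rfl⟩ | ⟨x, y, h, rfl, rfl⟩
  · refine iff_of_false (fun h => ?_) (fun h => ?_)
    · exact not_top_lt (α := WithTop M.Γ) h
    · exact not_top_lt (α := WithTop N.Γ) h
  rcases h' with ⟨rfl, rfl⟩ | ⟨x', y', h', rfl, rfl⟩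
  · exact iff_of_true (WithTop.coe_lt_top x) (WithTop.coe_lt_top y)
  · rw [rLt_fin, rLt_fin]
    exact hR.lt_iff h h'

theorem mem_P_iff (h : Matches M N R a b) : rP k a ↔ rP k b := by
  rcases h with ⟨rfl, rfl⟩ | ⟨x, y, h, rfl, rfl⟩
  · refine iff_of_false (fun h => ?_) (fun h => ?_)
    · obtain ⟨_, -, h⟩ := h
      exact WithTop.top_ne_coe h
    · obtain ⟨_, -, h⟩ := h
      exact WithTop.top_ne_coe h
  · rw [rP_fin, rP_fin]
    exact hR.mem_P_iff _ h

theorem realize {α : Type*} {v : α → M.Str} {v' : α → N.Str} (h : ∀ i, Matches M N R (v i) (v' i))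
    (t : (HTripleLanguage k).Term α) : Matches M N R (t.realize v) (t.realize v') := by
  induction t with
  | var i => exact h i
  | func f ts ih =>
    cases f with
    | zero => exact zero
    | infty => exact inf
    | neg => exact (ih 0).neg
    | smul c => exact (ih 0).smul c
    | psi => exact (ih 0).psi hR
    | add => exact (ih 0).add (ih 1)

end Matches

/-- Partial isomorphisms preserve all formulas. -/
theorem realize_iff {α : Type*} {n : ℕ} (φ : (HTripleLanguage k).BoundedFormula α n) :
    ∀ {M N : ClosedHTriple.{u, w} k} {R : Submodule k (M.Γ × N.Γ)},
      IsPartialIso M.triple N.triple R → ∀ {v : α → M.Str} {v' : α → N.Str} {x : Fin n → M.Str}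
      {x' : Fin n → N.Str}, (∀ i, Matches M N R (v i) (v' i)) → (∀ i, Matches M N R (x i) (x' i)) →
      (φ.Realize v x ↔ φ.Realize v' x') := by
  induction φ with
  | falsum => exact fun _ _ _ _ _ _ _ => Iff.rfl
  | equal t s =>
    intro M N R hR v v' x x' hv hx
    have h : ∀ i, Matches M N R (Sum.elim v x i) (Sum.elim v' x' i) := Sum.rec hv hx
    exact (Matches.realize hR h t).eq_iff hR (Matches.realize hR h s)
  | rel r ts =>
    intro M N R hR v v' x x' hv hx
    have h : ∀ i, Matches M N R (Sum.elim v x i) (Sum.elim v' x' i) := Sum.rec hv hx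
    cases r with
    | P => exact (Matches.realize hR h (ts 0)).mem_P_iff hR
    | lt => exact (Matches.realize hR h (ts 0)).lt_iff hR (Matches.realize hR h (ts 1))
  | imp φ ψ ih1 ih2 =>
    intro M N R hR v v' x x' hv hx
    exact imp_congr (ih1 hR hv hx) (ih2 hR hv hx)
  | all φ ih =>
    -- An arbitrary `a` gets a partner in an elementary extension of `N`, where the universal
    -- statement still holds. One implication suffices, since `swap` yields the other.
    have key : ∀ {M N : ClosedHTriple.{u, w} k} {R : Submodule k (M.Γ × N.Γ)},
        IsPartialIso M.triple N.triple R → ∀ {v : α → M.Str} {v' : α → N.Str}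
        {x : Fin _ → M.Str} {x' : Fin _ → N.Str}, (∀ i, Matches M N R (v i) (v' i)) →
        (∀ i, Matches M N R (x i) (x' i)) → φ.all.Realize v' x' → φ.all.Realize v x := by
      intro M N R hR v v' x x' hv hx h a
      obtain ⟨N', X, R', hRR', hR', hdom⟩ := extendsTo_top hR
      rw [← X.E.map_boundedFormula] at h
      obtain ⟨b, hb⟩ : ∃ b, Matches M N' R' a b := by
        rcases M.eq_inf_or_eq_fin a with rfl | ⟨m, rfl⟩
        · exact ⟨_, .inf⟩
        · obtain ⟨m', hm⟩ := mem_dom.1 (hdom ▸ Submodule.mem_top : m ∈ dom R')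
          exact ⟨_, Or.inr ⟨_, _, hm, rfl, rfl⟩⟩
      refine (ih hR' (fun i => (hv i).push X hRR') fun i => ?_).2 (h b)
      induction i using Fin.lastCases with
      | last => simpa using hb
      | cast i => simpa using (hx i).push X hRR'
    intro M N R hR v v' x x' hv hx
    exact ⟨key hR.swap (fun i => (hv i).swap) (fun i => (hx i).swap), key hR hv hx⟩

/-- Closed `H`-triples in the same universe that agree about `0 ∈ P` are elementarily
equivalent. -/
theorem sentence_iff {M N : ClosedHTriple.{u, w} k}
    (h : (0 : M.Γ) ∈ M.triple.P ↔ (0 : N.Γ) ∈ N.triple.P) (φ : (HTripleLanguage k).Sentence) :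
    M.Str ⊨ φ ↔ N.Str ⊨ φ := by
  -- For the zero subspaces the only nontrivial condition is agreement about `0 ∈ P`.
  refine realize_iff φ (R := ⊥) ⟨?_, ?_, ?_⟩ (fun i => i.elim) fun i => i.elim0
  · rintro p rfl
    simp
  · rintro p rfl
    exact h
  · rintro p rfl
    simp

end ClosedHTriple

/-! ### Lexicographic spaces, where smaller indices dominate -/

/-- The space of finitely supported functions, ordered lexicographically. -/
def LexSpace (S : Type*) (K : Type u) [Zero K] := Lex (S →₀ K)

namespace LexSpace

variable {S : Type*} [LinearOrder S] {K : Type u} [Field K] [LinearOrder K] [IsStrictOrderedRing K]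

noncomputable instance : AddCommGroup (LexSpace S K) := inferInstanceAs (AddCommGroup (S →₀ K))

noncomputable instance : Module K (LexSpace S K) := inferInstanceAs (Module K (S →₀ K))

noncomputable instance : LinearOrder (LexSpace S K) :=
  inferInstanceAs (LinearOrder (Lex (S →₀ K)))

instance : IsOrderedAddMonoid (LexSpace S K) where
  add_le_add_left := (Finsupp.Lex.isOrderedCancelAddMonoid (α := S) (N := K)).add_le_add_left

/-- The term `c • e_s`. -/
noncomputable def single (s : S) (c : K) : LexSpace S K := Finsupp.single s c

/-- The coefficients of an element of a lexicographically ordered space. -/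
def coef (x : LexSpace S K) (s : S) : K := DFunLike.coe (F := S →₀ K) x s

@[simp] theorem coef_zero (s : S) : coef (0 : LexSpace S K) s = 0 := rfl

@[simp] theorem coef_add (x y : LexSpace S K) (s : S) : coef (x + y) s = coef x s + coef y s := rfl

@[simp] theorem coef_neg (x : LexSpace S K) (s : S) : coef (-x) s = -coef x s := rfl

@[simp] theorem coef_sub (x y : LexSpace S K) (s : S) : coef (x - y) s = coef x s - coef y s := rfl

@[simp] theorem coef_smul (c : K) (x : LexSpace S K) (s : S) : coef (c • x) s = c * coef x s := rfl

theorem ext_coef {x y : LexSpace S K} (h : ∀ s, coef x s = coef y s) : x = y :=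
  Finsupp.ext h

/-- `s` is the index of the leading term of `x`. -/
def IsLead (x : LexSpace S K) (s : S) : Prop := coef x s ≠ 0 ∧ ∀ t < s, coef x t = 0

variable {x y : LexSpace S K} {s t r : S}

theorem exists_isLead (hx : x ≠ 0) : ∃ s, IsLead x s := by
  let z : S →₀ K := x
  have h : z.support.Nonempty := Finsupp.support_nonempty_iff.2 hx
  refine ⟨z.support.min' h, Finsupp.mem_support_iff.1 (Finset.min'_mem _ h), fun t ht => ?_⟩
  by_contra h0
  exact (Finset.min'_le _ t (Finsupp.mem_support_iff.2 h0)).not_gt ht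

theorem IsLead.ne_zero (h : IsLead x s) : x ≠ 0 := fun h0 => h.1 (h0 ▸ rfl)

theorem IsLead.unique (h : IsLead x s) (h' : IsLead x t) : s = t := by
  rcases lt_trichotomy s t with hst | hst | hst
  · exact absurd (h'.2 _ hst) h.1
  · exact hst
  · exact absurd (h.2 _ hst) h'.1

theorem IsLead.pos (h : IsLead x s) (hs : 0 < coef x s) : 0 < x :=
  ⟨s, fun t ht => (h.2 t ht).symm, hs⟩

theorem IsLead.smul (h : IsLead x s) {c : K} (hc : c ≠ 0) : IsLead (c • x) s :=
  ⟨mul_ne_zero hc h.1, fun t ht => by simp [h.2 t ht]⟩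

theorem IsLead.neg (h : IsLead x s) : IsLead (-x) s :=
  ⟨neg_ne_zero.2 h.1, fun t ht => by simp [h.2 t ht]⟩

theorem IsLead.pos_iff (h : IsLead x s) : 0 < x ↔ 0 < coef x s := by
  refine ⟨fun hx => ?_, h.pos⟩
  by_contra h0
  have h1 : 0 < coef (-x) s := by
    rw [coef_neg]
    exact neg_pos.2 (lt_of_le_of_ne (not_lt.1 h0) h.1)
  exact (neg_pos.1 (h.neg.pos h1)).not_gt hx

theorem IsLead.min_le_add (hx : IsLead x s) (hy : IsLead y t) (h : IsLead (x + y) r) :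
    min s t ≤ r := by
  by_contra! h0
  rw [lt_min_iff] at h0
  exact h.1 (by simp [hx.2 r h0.1, hy.2 r h0.2])

/-- Elements of smaller order of magnitude do not affect leading terms. -/
theorem IsLead.sub (hx : IsLead x s) (hy : ∀ t ≤ s, coef y t = 0) : IsLead (x - y) s :=
  ⟨by simpa [hy s le_rfl] using hx.1, fun t ht => by simp [hx.2 t ht, hy t ht.le]⟩

theorem IsLead.lt_of_forall_eq_zero (hx : IsLead x s) (h0 : 0 < x) (hy : ∀ t ≤ s, coef y t = 0) :
    y < x := by
  rw [← sub_pos]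
  refine (hx.sub hy).pos ?_
  rw [coef_sub, hy s le_rfl, sub_zero]
  exact hx.pos_iff.1 h0

theorem IsLead.le_of_le (hx : IsLead x s) (hy : IsLead y t) (h0 : 0 < x) (h : x ≤ y) : t ≤ s := by
  by_contra! h1
  exact (hx.lt_of_forall_eq_zero h0 fun r hr => hy.2 r (hr.trans_lt h1)).not_ge h

theorem coef_single_self (s : S) (c : K) : coef (single s c) s = c := Finsupp.single_eq_same

theorem coef_single_of_ne (h : t ≠ s) (c : K) : coef (single s c) t = 0 :=
  Finsupp.single_eq_of_ne h

theorem isLead_single (s : S) {c : K} (hc : c ≠ 0) : IsLead (single s c) s :=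
  ⟨by rwa [coef_single_self], fun t ht => coef_single_of_ne ht.ne c⟩

theorem single_pos (s : S) {c : K} (hc : 0 < c) : 0 < single s c :=
  (isLead_single s hc.ne').pos (by rwa [coef_single_self])

instance : PosSMulStrictMono K (LexSpace S K) where
  smul_lt_smul_of_pos_left c hc x y h := by
    rw [← sub_pos] at h ⊢
    rw [← smul_sub]
    obtain ⟨s, hs⟩ := exists_isLead h.ne'
    exact (hs.smul hc.ne').pos (mul_pos hc (hs.pos_iff.1 h))

instance : DenselyOrdered (LexSpace S K) := ⟨fun x y hxy => by
  have hw := HTriple.half_smul_add_half_smul (k := K) (y - x)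
  have hw0 := HTriple.half_smul_pos (k := K) (sub_pos.2 hxy)
  exact ⟨x + (2⁻¹ : K) • (y - x), by grind, by grind⟩⟩

instance [Countable S] [Countable K] : Countable (LexSpace S K) :=
  inferInstanceAs (Countable (S →₀ K))

/-- The leading index of a nonzero element. -/
noncomputable def lead (x : {x : LexSpace S K // x ≠ 0}) : S := (exists_isLead x.2).choose

theorem isLead_lead (x : {x : LexSpace S K // x ≠ 0}) : IsLead x.1 (lead x) :=
  (exists_isLead x.2).choose_spec

theorem lead_eq (hx : x ≠ 0) (h : IsLead x s) : lead ⟨x, hx⟩ = s := (isLead_lead _).unique h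

section Triple

variable (σ : S → LexSpace S K) (hσ : Monotone σ)
  (hlt : ∀ s t, s < t → ∀ x, 0 < x → IsLead x s → σ t < x + σ s)
  (hlow : IsLowerSet (Set.range σ))

/-- The `H`-triple obtained from a suitable map from indices to elements. -/
noncomputable def triple : HTriple K (LexSpace S K) where
  psi x := σ (lead x)
  ac1 x y h := by
    rw [← hσ.map_min]
    exact hσ ((isLead_lead x).min_le_add (isLead_lead y) (isLead_lead ⟨x.1 + y.1, h⟩))
  ac2 n hn x h := by
    rw [lead_eq h (s := lead x)]
    rw [← Int.cast_smul_eq_zsmul K]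
    exact (isLead_lead x).smul (by exact_mod_cast hn)
  ac3 x y hx := by
    rcases lt_or_ge (lead x) (lead y) with h | h
    · exact hlt _ _ h _ hx (isLead_lead x)
    · exact (hσ h).trans_lt (lt_add_of_pos_left _ hx)
  hc x y hx h := hσ ((isLead_lead x).le_of_le (isLead_lead y) hx h)
  psi_smul c hc x h := by
    rw [lead_eq h ((isLead_lead x).smul hc)]
  P := Set.range σ
  isHCut := by
    refine ⟨hlow, ?_, ?_⟩
    · rintro _ ⟨x, rfl⟩
      exact ⟨_, rfl⟩
    · rintro _ ⟨t, rfl⟩ x hx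
      change σ t < x.1 + σ (lead x)
      rcases lt_or_ge (lead x) t with h | h
      · exact hlt _ _ h _ hx (isLead_lead x)
      · exact (hσ h).trans_lt (lt_add_of_pos_left _ hx)

theorem ps_triple {x : LexSpace S K} {s : S} (h : IsLead x s) :
    (triple σ hσ hlt hlow).ps x = σ s := by
  rw [HTriple.ps_of_ne _ h.ne_zero]
  exact congrArg σ (lead_eq _ h)

/-- The two alternatives in `hgap` are the hypotheses of the two solvability lemmas, applied to the
whole space. -/
theorem isClosed_triple (hgap : ∀ x, (∃ s, x < σ s) ∨ ∃ z s, 0 < z ∧ IsLead z s ∧ z + σ s ≤ x) :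
    (triple σ hσ hlt hlow).toHCouple.IsClosed where
  divisible n hn x := by
    refine ⟨(n : K)⁻¹ • x, ?_⟩
    rw [← Nat.cast_smul_eq_nsmul K, smul_inv_smul₀ (by exact_mod_cast hn)]
  psi_lower := by
    have h : (triple σ hσ hlt hlow).toHCouple.Psi = Set.range σ := by
      ext x
      constructor
      · rintro ⟨x, rfl⟩
        exact ⟨_, rfl⟩
      · rintro ⟨s, rfl⟩
        have h := isLead_single s (one_ne_zero (α := K))
        exact ⟨⟨_, h.ne_zero⟩, congrArg σ (lead_eq _ h)⟩
    rwa [h]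
  integration x := by
    obtain ⟨z, -, hz, h⟩ : ∃ z ∈ (⊤ : Submodule K (LexSpace S K)), z ≠ 0 ∧
        z + (triple σ hσ hlt hlow).ps z = x := by
      rcases hgap x with ⟨s, h⟩ | ⟨z, s, hz, hs, h⟩
      · have hs := isLead_single s (one_ne_zero (α := K))
        rw [← ps_triple σ hσ hlt hlow hs] at h
        exact (triple σ hσ hlt hlow).exists_add_ps_eq_of_lt_ps (fun _ _ => Submodule.mem_top)
          Submodule.mem_top Submodule.mem_top hs.ne_zero h
      · rw [← ps_triple σ hσ hlt hlow hs] at h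
        exact (triple σ hσ hlt hlow).exists_add_ps_eq_of_add_ps_le (fun _ _ => Submodule.mem_top)
          Submodule.mem_top Submodule.mem_top hz h
    rw [HTriple.ps_of_ne _ hz] at h
    exact ⟨⟨z, hz⟩, h⟩

end Triple

end LexSpace

/-! ### A closed triple over a countable field -/

namespace LexSpace

variable {K : Type u} [Field K] [LinearOrder K] [IsStrictOrderedRing K]

/-- Index set for a countable closed `H`-triple. -/
abbrev Index : Type := ℤ ×ₗ WithTop ℚ

/-- The last index of a block. -/
def top (n : ℤ) : Index := toLex (n, ⊤)

open Classical in
/-- The function `x n` with `x n - x (n - 1) = e_{(n, ⊤)}`. -/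
noncomputable def step (K : Type u) [Field K] (n : ℤ) : LexSpace Index K :=
  Finsupp.onFinset (Finset.image top (Finset.Icc (-|n|) |n|))
    (fun s => if (ofLex s).2 = ⊤ then
      if 0 < (ofLex s).1 ∧ (ofLex s).1 ≤ n then 1 else
      if n < (ofLex s).1 ∧ (ofLex s).1 ≤ 0 then -1 else 0 else 0) (by
    intro s hs
    split_ifs at hs with h1 h2 h3
    · refine Finset.mem_image.2 ⟨(ofLex s).1, Finset.mem_Icc.2 ⟨by grind, by grind⟩, ?_⟩
      rw [top, ← h1]
      rfl
    · refine Finset.mem_image.2 ⟨(ofLex s).1, Finset.mem_Icc.2 ⟨by grind, by grind⟩, ?_⟩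
      rw [top, ← h1]
      rfl
    · exact absurd rfl hs
    · exact absurd rfl hs)

open Classical in
theorem coef_step (n m : ℤ) (r : WithTop ℚ) : coef (step K n) (toLex (m, r)) = if r = ⊤ then
      if 0 < m ∧ m ≤ n then 1 else if n < m ∧ m ≤ 0 then -1 else 0 else 0 := rfl

theorem coef_step_sub {m n p : ℤ} {r : WithTop ℚ} (hmn : m ≤ n)
    (h : toLex (p, r) < toLex (m + 1, (⊤ : WithTop ℚ))) :
    coef (step K n - step K m) (toLex (p, r)) = 0 := by
  rw [Prod.Lex.toLex_lt_toLex] at h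
  rw [coef_sub, coef_step, coef_step]
  grind

/-- The difference telescopes to the sum of the basis vectors at `top j` for `m < j ≤ n`. -/
theorem isLead_step_sub {m n : ℤ} (hmn : m < n) : IsLead (step K n - step K m) (top (m + 1)) ∧
    0 < step K n - step K m := by
  have h1 : coef (step K n - step K m) (top (m + 1)) = 1 := by
    rw [top, coef_sub, coef_step, coef_step]
    grind
  have h2 : IsLead (step K n - step K m) (top (m + 1)) :=
    ⟨by rw [h1]; exact one_ne_zero, fun t ht => coef_step_sub (p := (ofLex t).1) hmn.le ht⟩
  exact ⟨h2, h2.pos (by rw [h1]; exact one_pos)⟩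

theorem step_strictMono : StrictMono (step K) := fun _ _ h => sub_pos.1 (isLead_step_sub h).2

theorem exists_top_gt (y : LexSpace Index K) (a : ℤ) :
    ∃ n ≤ a, ∀ s, coef y s ≠ 0 → top n < s := by
  let z : Index →₀ K := y
  obtain ⟨n, hn⟩ := (z.support.image fun s => (ofLex s).1).bddBelow
  refine ⟨min (n - 1) a, min_le_right _ _, fun s hs => ?_⟩
  have h := hn (Finset.mem_coe.2 (Finset.mem_image_of_mem _ (Finsupp.mem_support_iff.2 hs)))
  change toLex _ < toLex (ofLex s)
  rw [Prod.Lex.toLex_lt_toLex]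
  exact Or.inl (by grind)

theorem exists_coef_top_eq_zero (y : LexSpace Index K) : ∃ n > 0, coef y (top n) = 0 := by
  let z : Index →₀ K := y
  obtain ⟨n, hn⟩ := (z.support.image fun s => (ofLex s).1).bddAbove
  refine ⟨max (n + 1) 1, by grind, ?_⟩
  by_contra hs
  have h := hn (Finset.mem_coe.2 (Finset.mem_image_of_mem _ (Finsupp.mem_support_iff.2 hs)))
  change max (n + 1) 1 ≤ n at h
  grind

/-- For `n` sufficiently negative, `step K 0 - step K (n - 1)` leads at an index before the support
of `y`, hence exceeds `-y`; and `step K 0 = 0`. -/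
theorem exists_step_lt (y : LexSpace Index K) : ∃ n, step K n < y := by
  obtain ⟨n, hn, h⟩ := exists_top_gt y 0
  have h1 := isLead_step_sub (K := K) (show n - 1 < 0 by grind)
  have h0 : step K 0 = 0 := by
    apply ext_coef
    intro s
    change coef _ (toLex ((ofLex s).1, (ofLex s).2)) = 0
    rw [coef_step]
    grind
  rw [h0, sub_add_cancel] at h1
  refine ⟨n - 1, ?_⟩
  have h2 := h1.1.lt_of_forall_eq_zero h1.2 (y := -y) fun t ht => by
    by_contra h3
    exact (h t (by simpa using h3)).not_ge ht
  grind

/-- By finite support some `n > 0` has coefficient `0` in `y` but `1` in `step K n` at `top n`. If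
`y` is above all steps, then `y - step K n` is positive with leading index at most `top n`, so it
dominates a positive term there. -/
theorem step_gap (y : LexSpace Index K) : (∃ n, y < step K n) ∨
    ∃ z n, 0 < z ∧ IsLead z (top n) ∧ z + step K n ≤ y := by
  by_contra! h
  obtain ⟨n, hn, h0⟩ := exists_coef_top_eq_zero y
  have h1 := h.1 n
  have hne : coef (y - step K n) (top n) ≠ 0 := by
    rw [coef_sub, h0, top, coef_step]
    grind
  obtain ⟨s, hs⟩ := exists_isLead (x := y - step K n) fun h => hne (by rw [h]; rfl)
  have hs' : s ≤ top n := by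
    by_contra! h3
    exact hne (hs.2 _ h3)
  have hpos : 0 < y - step K n := lt_of_le_of_ne (sub_nonneg.2 h1) hs.ne_zero.symm
  have hc := hs.pos_iff.1 hpos
  rcases hs'.eq_or_lt with rfl | hs'
  · have h2 := h.2 (single (top n) (coef (y - step K n) (top n) / 2)) n
      (single_pos _ (by positivity)) (isLead_single _ (by positivity))
    have h3 : 0 < y - step K n - single (top n) (coef (y - step K n) (top n) / 2) := by
      refine IsLead.pos (s := top n) ⟨?_, fun t ht => ?_⟩ ?_
      · rw [coef_sub, coef_single_self]
        grind
      · rw [coef_sub, coef_single_of_ne ht.ne, hs.2 t ht, sub_zero]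
      · rw [coef_sub, coef_single_self]
        grind
    grind
  · have h2 := h.2 (single (top n) 1) n (single_pos _ one_pos) (isLead_single _ one_ne_zero)
    have h3 := hs.lt_of_forall_eq_zero hpos (y := single (top n) 1) fun t ht =>
      coef_single_of_ne (ht.trans_lt hs').ne _
    grind

theorem exists_orderIso [Countable K] {x y : LexSpace Index K} (h : x < y) :
    Nonempty (ℚ ≃o Set.Ioo x y) := by
  have : Nonempty (Set.Ioo x y) := by
    obtain ⟨z, h1, h2⟩ := exists_between h
    exact ⟨⟨z, h1, h2⟩⟩
  have : Countable Index := inferInstanceAs (Countable (ℤ × WithTop ℚ))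
  exact Order.iso_of_countable_dense _ _

/-- There are closed `H`-triples over any countable ordered field. -/
theorem exists_triple [Countable K] :
    ∃ H : HTriple K (LexSpace Index K), H.toHCouple.IsClosed := by
  -- Cantor's theorem, using countability of `K`, lets `σ` map block `n` of the index set, a copy of
  -- `ℚ` with a last point, onto the interval from `step K (n - 1)`, excluded, to `step K n`,
  -- included. These intervals fit together to a downward closed set.
  let f (n : ℤ) : ℚ ≃o Set.Ioo (step K (n - 1)) (step K n) :=
    (exists_orderIso (step_strictMono (sub_one_lt n))).some
  let g (n : ℤ) : WithTop ℚ → LexSpace Index K :=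
    WithTop.recTopCoe (step K n) fun q => (f n q : LexSpace Index K)
  have hle (n r) : g n r ≤ step K n := by
    induction r with
    | top => exact le_rfl
    | coe q => exact (f n q).2.2.le
  have hgt (n r) : step K (n - 1) < g n r := by
    induction r with
    | top => exact step_strictMono (sub_one_lt n)
    | coe q => exact (f n q).2.1
  have hg (n) : StrictMono (g n) := by
    intro r r' h
    induction r with
    | top => exact absurd h not_top_lt
    | coe q =>
      induction r' with
      | top => exact (f n q).2.2
      | coe q' => exact (f n).strictMono (WithTop.coe_lt_coe.1 h)
  let σ : Index → LexSpace Index K := fun s => g (ofLex s).1 (ofLex s).2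
  have hσ : StrictMono σ := by
    intro s t h
    rcases Prod.Lex.lt_iff.1 h with h | ⟨h, h'⟩
    · exact (hle _ _).trans_lt ((step_strictMono.monotone (by grind)).trans_lt (hgt _ _))
    · change g _ _ < g _ _
      rw [h]
      exact hg _ h'
  have hlt : ∀ s t, s < t → ∀ x, 0 < x → IsLead x s → σ t < x + σ s := by
    intro s t hst x hx hs
    -- Here `m` will be the block of `s` if `s` is its last point, and the preceding block
    -- otherwise, so that `step K m ≤ σ s`. The difference bounding `σ t - σ s` has no coefficient
    -- at or before `s`, so it is below `x`.
    have key {m} (hm : m ≤ (ofLex t).1) (h : s < top (m + 1)) :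
        step K (ofLex t).1 - step K m < x :=
      hs.lt_of_forall_eq_zero hx fun r hr => coef_step_sub (p := (ofLex r).1) hm (hr.trans_lt h)
    have h1 := hle (ofLex t).1 (ofLex t).2
    have hst' := Prod.Lex.lt_iff.1 hst
    rcases eq_or_ne (ofLex s).2 ⊤ with h | h
    · have h2 : σ s = step K (ofLex s).1 := by
        change g _ _ = _
        rw [h]
        rfl
      have h3 : (ofLex s).1 < (ofLex t).1 := by
        rcases hst' with h' | ⟨-, h'⟩
        · exact h'
        · rw [h] at h'
          exact absurd h' not_top_lt
      have h4 := key h3.le (Prod.Lex.lt_iff.2 (Or.inl (lt_add_one _)))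
      change g _ _ < _
      grind
    · have h3 : (ofLex s).1 - 1 ≤ (ofLex t).1 := by grind
      have h4 := key h3 (Prod.Lex.lt_iff.2 (Or.inr ⟨(sub_add_cancel _ _).symm, h.lt_top⟩))
      have h5 := hgt (ofLex s).1 (ofLex s).2
      change g _ _ < x + g _ _
      grind
  have hlow : IsLowerSet (Set.range σ) := by
    rintro _ y hy ⟨t, rfl⟩
    obtain ⟨b, hb⟩ := exists_step_lt y
    obtain ⟨n, hn, hmin⟩ := Int.exists_least_of_bdd (P := fun n => y ≤ step K n)
      ⟨b, fun z hz => (step_strictMono.lt_iff_lt.1 (hb.trans_le hz)).le⟩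
      ⟨_, hy.trans (hle _ _)⟩
    have h1 : step K (n - 1) < y := by
      by_contra! h
      have := hmin _ h
      grind
    rcases hn.eq_or_lt with h | h
    · exact ⟨top n, h.symm⟩
    · refine ⟨toLex (n, ((f n).symm ⟨y, h1, h⟩ : ℚ)), ?_⟩
      change ((f n ((f n).symm ⟨y, h1, h⟩) : Set.Ioo _ _) : LexSpace Index K) = y
      rw [OrderIso.apply_symm_apply]
  refine ⟨_, isClosed_triple σ hσ.monotone hlt hlow fun x => ?_⟩
  rcases step_gap x with ⟨n, h⟩ | ⟨z, n, h⟩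
  · exact Or.inl ⟨top n, h⟩
  · exact Or.inr ⟨z, top n, h⟩

end LexSpace

/-! ### Existence over every ordered field, and elementary equivalence across universes -/

section Existence

variable {k : Type u} [Field k] [LinearOrder k] [IsStrictOrderedRing k]

/-- The scalars occurring in an axiom. -/
def HTripleLanguage.Ax.scalars : Ax k → Set k
  | .smul_add c => {c}
  | .add_smul c d => {c, d}
  | .mul_smul c d => {c, d}
  | .smul_lt_smul c => {c}
  | .psi_smul c => {c}
  | _ => ∅

theorem HTripleLanguage.Ax.countable_scalars (a : Ax k) : a.scalars.Countable := by
  cases a <;> simp [scalars]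

open Classical in
theorem HTriple.scalarOK {L : Subfield k} {Γ : Type w} [AddCommGroup Γ] [LinearOrder Γ]
    [IsOrderedAddMonoid Γ] [Module L Γ] [PosSMulStrictMono L Γ] (H : HTriple L Γ) (a : Ax k)
    (ha : a.scalars ⊆ L) :
    H.toHCouple.ScalarOK (fun c x => if h : c ∈ L then (⟨c, h⟩ : L) • x else 0) a := by
  have h1 {c : k} (h : c ∈ a.scalars) : c ∈ L := ha h
  cases a with
  | smul_add c =>
    have hc : c ∈ L := h1 rfl
    intro x y
    simp only [hc, dite_true]
    exact smul_add _ _ _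
  | add_smul c d =>
    have hc : c ∈ L := h1 (Or.inl rfl)
    have hd : d ∈ L := h1 (Or.inr rfl)
    intro x
    simp only [hc, hd, L.add_mem hc hd, dite_true]
    exact add_smul (⟨c, hc⟩ : L) ⟨d, hd⟩ x
  | mul_smul c d =>
    have hc : c ∈ L := h1 (Or.inl rfl)
    have hd : d ∈ L := h1 (Or.inr rfl)
    intro x
    simp only [hc, hd, L.mul_mem hc hd, dite_true]
    exact mul_smul (⟨c, hc⟩ : L) ⟨d, hd⟩ x
  | one_smul =>
    intro x
    simp only [L.one_mem, dite_true]
    exact one_smul L x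
  | smul_lt_smul c =>
    have hc : c ∈ L := h1 rfl
    intro h0 x y hxy
    simp only [hc, dite_true]
    exact smul_lt_smul_of_pos_left hxy (show (0 : L) < ⟨c, hc⟩ from h0)
  | psi_smul c =>
    have hc : c ∈ L := h1 rfl
    intro h0 x
    simp only [hc, dite_true]
    exact H.psiExt_smul (c := (⟨c, hc⟩ : L)) (fun h => h0 (congrArg Subtype.val h)) x
  | _ => trivial

namespace ClosedHTriple

variable (k) in
/-- There are closed `H`-triples over any ordered field. -/
theorem nonempty : Nonempty (ClosedHTriple.{u, u} k) := by
  classical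
  -- By compactness only finitely many axioms matter at a time. Their scalars generate a countable
  -- subfield `L`, and letting scalars outside `L` act as `0` does not affect these axioms.
  have hsat : Theory.IsSatisfiable (Set.range (Ax.sentence (k := k))) := by
    rw [Theory.isSatisfiable_iff_isFinitelySatisfiable]
    intro T hT
    choose a ha using fun φ : T => hT φ.2
    let s : Set k := ⋃ φ, (a φ).scalars
    have hs : s.Countable := Set.countable_iUnion fun φ => (a φ).countable_scalars
    let L := Subfield.closure s
    have : Countable L := by
      rw [← Cardinal.mk_le_aleph0_iff]
      exact (Subfield.cardinalMk_closure_le_max s).trans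
        (max_le (Cardinal.le_aleph0_iff_set_countable.2 hs) le_rfl)
    obtain ⟨H, hH⟩ := LexSpace.exists_triple (K := L)
    let M := H.toHCouple.PreCarrier H.P
      fun (c : k) x => if h : c ∈ L then (⟨c, h⟩ : L) • x else 0
    have : M ⊨ (T : (HTripleLanguage k).Theory) := by
      refine ⟨fun φ hφ => ?_⟩
      have h := Ax.realize_sentence M (a ⟨φ, hφ⟩)
      rw [ha ⟨φ, hφ⟩] at h
      exact h.2 (HCouple.holds_preCarrier hH H.isHCut _ (H.scalarOK _
        ((Set.subset_iUnion (fun φ => (a φ).scalars) _).trans Subfield.subset_closure)))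
    have : Nonempty M := ⟨(⊤ : WithTop _)⟩
    exact Theory.Model.isSatisfiable M
  obtain ⟨M⟩ := hsat
  obtain ⟨H, -⟩ := exists_closedHTriple (k := k) (M := M) fun a =>
    (Ax.realize_sentence M a).1 (M.is_model.realize_of_mem _ ⟨a, rfl⟩)
  exact ⟨H⟩

/-- Shifting `psi` by a constant. -/
def shift (H : ClosedHTriple.{u, w} k) (c : H.Γ) : ClosedHTriple.{u, w} k where
  Γ := H.Γ
  triple :=
    { psi := fun x => H.triple.psi x + c
      ac1 := fun x y h => by
        rw [min_add_add_right]
        exact add_le_add_left (H.triple.ac1 x y h) c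
      ac2 := fun n hn x h => by rw [H.triple.ac2 n hn x h]
      ac3 := fun x y h => by
        rw [← add_assoc]
        exact add_lt_add_left (H.triple.ac3 x y h) c
      hc := fun x y h h' => add_le_add_left (H.triple.hc x y h h') c
      psi_smul := fun a ha x h => by rw [H.triple.psi_smul a ha x h]
      P := {x | x - c ∈ H.triple.P}
      isHCut :=
        { lower := fun x y h hx => H.triple.isHCut.lower (sub_le_sub_right h c) hx
          psi_subset := by
            rintro _ ⟨x, rfl⟩
            change H.triple.psi x + c - c ∈ H.triple.P
            rw [add_sub_cancel_right]
            exact H.triple.isHCut.psi_subset ⟨x, rfl⟩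
          lt_deriv := fun p hp x hx => by
            have h := H.triple.isHCut.lt_deriv _ hp x hx
            change p < x.1 + (H.triple.psi x + c)
            rw [← add_assoc]
            exact sub_lt_iff_lt_add.1 h } }
  closed :=
    { divisible := H.closed.divisible
      psi_lower := by
        rintro _ y hy ⟨x, rfl⟩
        obtain ⟨z, hz⟩ := H.closed.psi_lower (sub_le_iff_le_add.2 hy) ⟨x, rfl⟩
        exact ⟨z, (congrArg (· + c) hz).trans (sub_add_cancel y c)⟩
      integration := fun x => by
        obtain ⟨z, hz⟩ := H.closed.integration (x - c)
        refine ⟨z, ?_⟩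
        change z.1 + (H.triple.psi z + c) = x
        rw [← add_assoc]
        exact (congrArg (· + c) hz).trans (sub_add_cancel x c) }

/-- Being closed is invariant under shifting, so one closed triple yields examples of both kinds. -/
theorem zero_mem_P_shift (H : ClosedHTriple.{u, w} k) (c : H.Γ) :
    (0 : (H.shift c).Γ) ∈ (H.shift c).triple.P ↔ -c ∈ H.triple.P := by
  change (0 : H.Γ) - c ∈ H.triple.P ↔ _
  rw [zero_sub]

variable (k) in
theorem exists_zero_mem : ∃ H : ClosedHTriple.{u, u} k, (0 : H.Γ) ∈ H.triple.P := by
  obtain ⟨H⟩ := nonempty k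
  obtain ⟨z, hz, -⟩ := H.triple.exists_add_ps_eq H.closed 0
  refine ⟨H.shift (-H.triple.ps z), ?_⟩
  rw [zero_mem_P_shift, neg_neg]
  exact H.triple.ps_mem_P hz

variable (k) in
theorem exists_zero_notMem : ∃ H : ClosedHTriple.{u, u} k, (0 : H.Γ) ∉ H.triple.P := by
  obtain ⟨H⟩ := nonempty k
  obtain ⟨z, hz, -⟩ := H.triple.exists_add_ps_eq H.closed 0
  refine ⟨H.shift (-(|z| + H.triple.ps |z|)), ?_⟩
  rw [zero_mem_P_shift, neg_neg]
  exact H.triple.add_ps_notMem_P (abs_pos.2 hz)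

/-- A sentence expressing `0 ∈ P`. -/
def zeroMem (k : Type u) : (HTripleLanguage k).Sentence := fP (α := Empty) (n := 0) tZero

theorem realize_zeroMem (H : ClosedHTriple.{u, w} k) :
    H.Str ⊨ zeroMem k ↔ (0 : H.Γ) ∈ H.triple.P := by
  simp only [Sentence.Realize, Formula.Realize, zeroMem, realize_fP, realize_tZero]
  exact H.rP_fin

universe v

/-- The back-and-forth compares triples in one universe, whereas the theories are tested in `u` and
models may live elsewhere; this brings both to a common universe. -/
theorem exists_equiv (H : ClosedHTriple.{u, w} k) :
    ∃ H' : ClosedHTriple.{u, max w v} k, Nonempty (H.Str ≃[HTripleLanguage k] H'.Str) := by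
  let e : H.Str ≃ ULift.{v} H.Str := Equiv.ulift.symm
  let : (HTripleLanguage k).Structure (ULift.{v} H.Str) := Equiv.inducedStructure e
  let E : H.Str ≃[HTripleLanguage k] ULift.{v} H.Str := Equiv.inducedStructureEquiv e
  obtain ⟨H', ⟨F⟩⟩ := exists_closedHTriple (k := k) (M := ULift.{v} H.Str) fun a => by
    rw [← Ax.realize_sentence, ← StrongHomClass.realize_sentence E, Ax.realize_sentence]
    exact H.triple.holds_carrier H.closed a
  exact ⟨H', ⟨F.comp E⟩⟩

/-- Closed `H`-triples that agree about `0 ∈ P` are elementarily equivalent. -/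
theorem realize_sentence_iff {M : ClosedHTriple.{u, w} k} {N : ClosedHTriple.{u, v} k}
    (h : (0 : M.Γ) ∈ M.triple.P ↔ (0 : N.Γ) ∈ N.triple.P) (φ : (HTripleLanguage k).Sentence) :
    M.Str ⊨ φ ↔ N.Str ⊨ φ := by
  obtain ⟨M', ⟨E⟩⟩ := exists_equiv.{u, w, v} M
  obtain ⟨N', ⟨F⟩⟩ := exists_equiv.{u, v, w} N
  rw [StrongHomClass.realize_sentence E, StrongHomClass.realize_sentence F]
  refine sentence_iff ?_ φ
  rw [← realize_zeroMem, ← realize_zeroMem, ← StrongHomClass.realize_sentence E,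
    ← StrongHomClass.realize_sentence F, realize_zeroMem, realize_zeroMem, h]

end ClosedHTriple

end Existence

/-! ### The two completions and their models -/

section Completions

open ClosedHTriple

variable {k : Type u} [Field k] [LinearOrder k] [IsStrictOrderedRing k]

theorem mem_theoryGT_iff {H : ClosedHTriple.{u, w} k} (hH : (0 : H.Γ) ∈ H.triple.P)
    (φ : (HTripleLanguage k).Sentence) : φ ∈ closedHTripleTheoryGT k ↔ H.Str ⊨ φ := by
  constructor
  · intro h
    obtain ⟨H', hH'⟩ := exists_zero_mem k
    exact (realize_sentence_iff (iff_of_true hH' hH) φ).1 (h H' hH')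
  · exact fun h H' hH' => (realize_sentence_iff (iff_of_true hH hH') φ).1 h

theorem mem_theoryLT_iff {H : ClosedHTriple.{u, w} k} (hH : (0 : H.Γ) ∉ H.triple.P)
    (φ : (HTripleLanguage k).Sentence) : φ ∈ closedHTripleTheoryLT k ↔ H.Str ⊨ φ := by
  constructor
  · intro h
    obtain ⟨H', hH'⟩ := exists_zero_notMem k
    exact (realize_sentence_iff (iff_of_false hH' hH) φ).1 (h H' hH')
  · exact fun h H' hH' => (realize_sentence_iff (iff_of_false hH hH') φ).1 h

theorem exists_equiv_of_models {M : Type w} [(HTripleLanguage k).Structure M]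
    (hM : M ⊨ closedHTripleTheory k) :
    ∃ H : ClosedHTriple.{u, w} k, Nonempty (M ≃[HTripleLanguage k] H.triple.Carrier) :=
  exists_closedHTriple fun a => (Ax.realize_sentence M a).1 (hM.realize_of_mem _ fun H =>
    (Ax.realize_sentence _ a).2 (H.triple.holds_carrier H.closed a))

theorem isCompletionOf_completeTheory (H : ClosedHTriple.{u, u} k) :
    IsCompletionOf ((HTripleLanguage k).completeTheory H.Str) (closedHTripleTheory k) := by
  have : Nonempty H.Str := ⟨H.fin 0⟩
  exact ⟨fun φ hφ => hφ H, completeTheory.isComplete _ _,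
    fun φ => (completeTheory.isMaximal _ _).mem_of_models⟩

theorem theoryGT_eq {H : ClosedHTriple.{u, w} k} (hH : (0 : H.Γ) ∈ H.triple.P) :
    closedHTripleTheoryGT k = (HTripleLanguage k).completeTheory H.Str :=
  Set.ext (mem_theoryGT_iff hH)

theorem theoryLT_eq {H : ClosedHTriple.{u, w} k} (hH : (0 : H.Γ) ∉ H.triple.P) :
    closedHTripleTheoryLT k = (HTripleLanguage k).completeTheory H.Str :=
  Set.ext (mem_theoryLT_iff hH)

/-- Any model of `T` is a closed triple up to isomorphism, and a complete, deductively closed theory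
is the full theory of each of its models. -/
theorem IsCompletionOf.exists_eq_completeTheory {T : (HTripleLanguage k).Theory}
    (hT : IsCompletionOf T (closedHTripleTheory k)) :
    ∃ H : ClosedHTriple.{u, u} k, T = (HTripleLanguage k).completeTheory H.Str := by
  obtain ⟨hsub, hc, hcl⟩ := hT
  obtain ⟨M⟩ := hc.1
  obtain ⟨H, ⟨E⟩⟩ := exists_equiv_of_models (M := M) (Theory.Model.mono M.is_model hsub)
  refine ⟨H, ?_⟩
  have h : {φ | T ⊨ᵇ φ} = T := Set.ext fun φ => ⟨hcl φ, Theory.models_sentence_of_mem⟩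
  rw [← h, hc.eq_complete_theory M]
  ext φ
  exact StrongHomClass.realize_sentence E φ

end Completions

open ClosedHTriple in
theorem mainTheorem6 (k : Type u) [Field k] [LinearOrder k] [IsStrictOrderedRing k] :
    -- there are exactly two completions
    closedHTripleTheoryGT k ≠ closedHTripleTheoryLT k ∧
    (∀ T : (HTripleLanguage k).Theory, IsCompletionOf T (closedHTripleTheory k) ↔
      T = closedHTripleTheoryGT k ∨ T = closedHTripleTheoryLT k) ∧
    -- the models of the three theories
    (∀ (M : Type w) [(HTripleLanguage k).Structure M], M ⊨ closedHTripleTheory k ↔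
      ∃ H : ClosedHTriple.{u, w} k, Nonempty (M ≃[HTripleLanguage k] H.triple.Carrier)) ∧
    (∀ (M : Type w) [(HTripleLanguage k).Structure M], M ⊨ closedHTripleTheoryGT k ↔
      ∃ H : ClosedHTriple.{u, w} k, (0 : H.Γ) ∈ H.triple.P ∧
        Nonempty (M ≃[HTripleLanguage k] H.triple.Carrier)) ∧
    (∀ (M : Type w) [(HTripleLanguage k).Structure M], M ⊨ closedHTripleTheoryLT k ↔
      ∃ H : ClosedHTriple.{u, w} k, (0 : H.Γ) ∉ H.triple.P ∧
        Nonempty (M ≃[HTripleLanguage k] H.triple.Carrier)) ∧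
    -- the two descriptions of the cases
    (∀ H : ClosedHTriple.{u, w} k,
      ((0 : H.Γ) ∈ H.triple.P ↔ (H.triple.Psi ∩ {γ | 0 < γ}).Nonempty) ∧
      ((0 : H.Γ) ∉ H.triple.P ↔ H.triple.Psi ⊆ {γ | γ < 0})) := by
  obtain ⟨A, hA⟩ := exists_zero_mem k
  obtain ⟨B, hB⟩ := exists_zero_notMem k
  have hGT : closedHTripleTheory k ⊆ closedHTripleTheoryGT k := fun φ h H _ => h H
  have hLT : closedHTripleTheory k ⊆ closedHTripleTheoryLT k := fun φ h H _ => h H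
  have hmem {H : ClosedHTriple.{u, w} k} {φ} (hφ : φ ∈ closedHTripleTheory k) : H.Str ⊨ φ := by
    by_cases hH : (0 : H.Γ) ∈ H.triple.P
    · exact (mem_theoryGT_iff hH φ).1 (hGT hφ)
    · exact (mem_theoryLT_iff hH φ).1 (hLT hφ)
  have hzero : zeroMem k ∈ closedHTripleTheoryGT k := fun H hH => (realize_zeroMem H).2 hH
  have hnzero : (zeroMem k).not ∈ closedHTripleTheoryLT k := fun H hH => by
    rw [Sentence.realize_not, realize_zeroMem]
    exact hH
  refine ⟨fun h => ?_, fun T => ⟨fun hT => ?_, ?_⟩, fun M _ => ⟨fun hM => ?_, ?_⟩,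
    fun M _ => ⟨fun hM => ?_, ?_⟩, fun M _ => ⟨fun hM => ?_, ?_⟩, fun H => ⟨?_, ?_⟩⟩
  · rw [h] at hzero
    exact hB ((realize_zeroMem B).1 (hzero B hB))
  · obtain ⟨H, rfl⟩ := hT.exists_eq_completeTheory
    by_cases hH : (0 : H.Γ) ∈ H.triple.P
    · exact Or.inl (theoryGT_eq hH).symm
    · exact Or.inr (theoryLT_eq hH).symm
  · rintro (rfl | rfl)
    · rw [theoryGT_eq hA]
      exact isCompletionOf_completeTheory A
    · rw [theoryLT_eq hB]
      exact isCompletionOf_completeTheory B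
  · exact exists_equiv_of_models hM
  · rintro ⟨H, ⟨E⟩⟩
    exact ⟨fun φ hφ => (StrongHomClass.realize_sentence E φ).2 (hmem hφ)⟩
  · obtain ⟨H, ⟨E⟩⟩ := exists_equiv_of_models (Theory.Model.mono hM hGT)
    refine ⟨H, ?_, ⟨E⟩⟩
    exact (realize_zeroMem H).1
      ((StrongHomClass.realize_sentence E _).1 (hM.realize_of_mem _ hzero))
  · rintro ⟨H, hH, ⟨E⟩⟩
    exact ⟨fun φ hφ => (StrongHomClass.realize_sentence E φ).2 ((mem_theoryGT_iff hH φ).1 hφ)⟩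
  · obtain ⟨H, ⟨E⟩⟩ := exists_equiv_of_models (Theory.Model.mono hM hLT)
    refine ⟨H, ?_, ⟨E⟩⟩
    have h := (StrongHomClass.realize_sentence E _).1 (hM.realize_of_mem _ hnzero)
    rwa [Sentence.realize_not, realize_zeroMem] at h
  · rintro ⟨H, hH, ⟨E⟩⟩
    exact ⟨fun φ hφ => (StrongHomClass.realize_sentence E φ).2 ((mem_theoryLT_iff hH φ).1 hφ)⟩
  · constructor
    · intro h
      -- With `0 = z + ps z` in `P`, the element `z` is negative, so `ps z = -z` is positive.
      obtain ⟨z, hz, h0⟩ := H.triple.exists_add_ps_eq H.closed 0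
      rw [← h0, H.triple.add_ps_mem_P_iff hz] at h
      refine ⟨H.triple.ps z, ?_, ?_⟩
      · rw [H.triple.ps_of_ne hz]
        exact ⟨_, rfl⟩
      · change 0 < H.triple.ps z
        grind
    · rintro ⟨x, hx, hx0⟩
      exact H.triple.isHCut.lower (le_of_lt hx0) (H.triple.isHCut.psi_subset hx)
  · constructor
    · intro h x hx
      change x < 0
      by_contra! h0
      exact h (H.triple.isHCut.lower h0 (H.triple.isHCut.psi_subset hx))
    · intro h h0
      obtain ⟨z, hz, h1⟩ := (H.triple.mem_P_iff H.closed).1 h0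
      rw [H.triple.ps_of_ne hz] at h1
      exact (h ⟨_, h1⟩ : (0 : H.Γ) < 0).false
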